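/- Let $I\subset\mathbb{R}$ be an interval and let $M$ be a smooth two-dimensional manifold without boundary. Let $F: I\times M\to\mathbb{R}^3$ be a smooth map such that each $F_t=F(t,\cdot)$ is a smooth embedding, with image $M_t=F_t(M)$, and let $\nu$ be a continuous unit normal field along $F$ (continuous in space and time). Let $H$ denote the mean curvature of $M_t$ with respect to $\nu$, that is, the sum of the principal curvatures, with the sign for which round spheres have $H>0$ with respect to the outward normal. Suppose that $(M_t)_{t\in I}$ evolves by mean curvature flow, $\partial_t F=-H\nu$, and is mean convex, $H\ge 0$. Suppose also that the flow is proper: for every compact interval $[a,b]\subset I$ and every compact $K\subset\mathbb{R}^3$ the set $\{(t,x)\in[a,b]\times M: F(t,x)\in K\}$ is compact. Let $p\in\mathbb{R}^3$ and $t_0\in\mathbb{R}$ be such that the Gaussian area $\int_{M_t}e^{-\frac{|x-p|^2}{4(t_0-t)}}\,d\mathrm{area}(x)$ is finite for all $t\in I$ with $t<t_0$. (If the surfaces are closed, i.e. $M$ is compact, the last two assumptions hold automatically, for all $p$ and $t_0$.) Then, for every $r_0>0$, the integral $$\int_{M_t}\frac{1}{4\pi(t_0-t)}\,e^{-\frac{|x-p|^2}{4(t_0-t)}-r_0H}\,d\mathrm{area}(x)$$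 is finite for each $t\in I$ with $t<t_0$, and it is a monotone decreasing (i.e. non-increasing) function of $t\in I$, $t<t_0$. -/

import Mathlib

open Set MeasureTheory
open scoped Manifold ContDiff RealInnerProductSpace

noncomputable section

/-- The Euclidean plane, on which surfaces are modelled. -/
abbrev Plane : Type := EuclideanSpace ℝ (Fin 2)

/-- The ambient Euclidean space `ℝ³`. -/
abbrev Space : Type := EuclideanSpace ℝ (Fin 3)

/-- The partial derivative `∂ᵢ g (u)` of a map `g : ℝ² → ℝ³`. -/
def coordDeriv (g : Plane → Space) (i : Fin 2) (u : Plane) : Space :=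
  fderiv ℝ g u (EuclideanSpace.single i 1)

section Surface

variable {M : Type*} [TopologicalSpace M] [ChartedSpace Plane M]

/-- The map `f : M → ℝ³` read in the preferred chart around `x`. -/
def localRep (f : M → Space) (x : M) : Plane → Space :=
  f ∘ (extChartAt (𝓡 2) x).symm

/-- The coefficients `g i j = ⟨∂ᵢ f, ∂ⱼ f⟩` at `x` of the metric induced by `f`,
in the preferred chart around `x`. -/
def firstForm (f : M → Space) (x : M) : Matrix (Fin 2) (Fin 2) ℝ :=
  Matrix.of fun i j =>
    ⟪coordDeriv (localRep f x) i (extChartAt (𝓡 2) x x),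
      coordDeriv (localRep f x) j (extChartAt (𝓡 2) x x)⟫

/-- The coefficients `h i j = -⟨∂ᵢ ∂ⱼ f, n⟩` at `x` of the second fundamental form of `f`
with respect to the unit normal `n`, in the preferred chart around `x`. With this sign the unit
sphere with its outward normal has `h = g`. -/
def secondForm (f : M → Space) (n : M → Space) (x : M) : Matrix (Fin 2) (Fin 2) ℝ :=
  Matrix.of fun i j =>
    -⟪coordDeriv (coordDeriv (localRep f x) j) i (extChartAt (𝓡 2) x x), n x⟫

/-- The mean curvature `H = ∑ i j, (g⁻¹) i j * h i j` (the sum of the principal curvatures);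
it does not depend on the chart, and it is `2 / r` on a sphere of radius `r` with its outward
normal. -/
def meanCurvature (f : M → Space) (n : M → Space) (x : M) : ℝ :=
  ((firstForm f x)⁻¹ * secondForm f n x).trace

/-- `F t`, `t ∈ I`, is a smooth family of embedded surfaces `M t = F t (M)` in `ℝ³` with a
continuous choice `ν` of unit normal, which moves by mean curvature:
`∂F/∂t = -H ν`. At an endpoint of `I` that belongs to `I`, the family is smooth up to that endpoint
and the time derivative is one-sided. -/
structure IsSmoothMCF (I : Set ℝ) (F ν : ℝ → M → Space) : Prop where
  smooth : ContMDiffOn (𝓘(ℝ, ℝ).prod (𝓡 2)) 𝓘(ℝ, Space) ∞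
    (fun q : ℝ × M => F q.1 q.2) (I ×ˢ univ)
  immersion : ∀ t ∈ I, ∀ x, Function.Injective (mfderiv (𝓡 2) 𝓘(ℝ, Space) (F t) x)
  embedding : ∀ t ∈ I, Topology.IsEmbedding (F t)
  normal_continuous : ContinuousOn (fun q : ℝ × M => ν q.1 q.2) (I ×ˢ univ)
  normal_unit : ∀ t ∈ I, ∀ x, ‖ν t x‖ = 1
  normal_orthogonal : ∀ t ∈ I, ∀ x, ∀ v : TangentSpace (𝓡 2) x,
    inner (E := Space) ℝ (mfderiv (𝓡 2) 𝓘(ℝ, Space) (F t) x v) (ν t x) = 0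
  evolves : ∀ t ∈ I, ∀ x,
    HasDerivWithinAt (fun s => F s x) (-(meanCurvature (F t) (ν t) x) • ν t x) I t

/-- The flow is proper: over a compact time interval, only a compact part of `M` meets a given
compact subset of `ℝ³`. This is automatic for closed surfaces (`M` compact), and it says that the
surfaces have no edge and that nothing comes in from, or escapes to, infinity in finite time. -/
def IsProperFlow (I : Set ℝ) (F : ℝ → M → Space) : Prop :=
  ∀ a b : ℝ, Icc a b ⊆ I → ∀ K : Set Space, IsCompact K →
    IsCompact {q : ℝ × M | q.1 ∈ Icc a b ∧ F q.1 q.2 ∈ K}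

/-- The flow is mean convex: `H ≥ 0` everywhere, with respect to the chosen normal. -/
def IsMeanConvex (I : Set ℝ) (F ν : ℝ → M → Space) : Prop :=
  ∀ t ∈ I, ∀ x, 0 ≤ meanCurvature (F t) (ν t) x

/-- The area measure of an embedded surface `f : M → ℝ³`: the two-dimensional Hausdorff measure of
`ℝ³`, normalized to agree with Lebesgue measure on planes, on the image of `f`, read on `M`. -/
def areaMeasure [MeasurableSpace M] (f : M → Space) : Measure M :=
  (Measure.euclideanHausdorffMeasure 2 : Measure Space).comap f

end Surface

end

/-!
On a mean curvature flow `(∂ₜ - Δ) H = |A|² H`, so that where `H ≥ 0` the function `exp(-cH)`, `c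
≥ 0`, is a subsolution of the heat equation: `(∂ₜ - Δ) exp(-cH) = -(c |A|² H + c² |∇H|²) exp(-cH)
≤ 0`. The backward heat kernel `ρ = (4π (t₀ - t))⁻¹ exp(-|x - p|² / (4 (t₀ - t)))` satisfies
Huisken's identity `∂ₜρ + Δρ - H² ρ = -ρ (H - ⟨x - p, ν⟩ / (2 (t₀ - t)))² ≤ 0` on the flow, and
the area element satisfies `∂ₜ √g = -H² √g`. For a subsolution `u ≥ 0` with compact support in
space these three facts give `d/dt ∫ u ρ ≤ ∫ (ρ Δu - u Δρ) = 0`.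

The function `exp(-r₀H)` need not have compact support, and on a noncompact surface nothing is
assumed about the decay of the derivatives of the flow. It is therefore replaced by `u =
max(exp(-cH) - δ (|x - p|² + 4 (t - a)), 0)³` with `c = r₀ / 3`. Since `(∂ₜ - Δ) |x - p|² = -4`,
the function in the maximum is still a subsolution for `t ≥ a`, and so is the cube of its positive
part, which is twice differentiable. Because `H ≥ 0`, the function `u` vanishes where `|x - p|² >
1 / δ`, so the properness of the flow makes its support compact, uniformly on compact intervals of
time. As `δ → 0` the integrals of `u ρ` converge to that of `exp(-r₀H) ρ` by dominated
convergence, with the integrable bound `ρ`, and monotonicity passes to the limit.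

The calculus is done for a surface parametrized by an open set of the plane (`IsLocalMCF`), with
the evolution equation `IsLocalMCF.heat_curvH`, the inequality
`IsLocalMCF.conjugate_heat_kernel_le` and their combination `IsLocalMCF.pd_time_weighted_area_le`,
in which the derivative of the integrand is bounded by a divergence. It is transferred to the
manifold by a partition of unity subordinate to charts: each cutoff contributes a boundary term
(`IsSmoothMCF.hasDerivAt_integral_cutoff_weight`), and the boundary terms add up to zero
(`IsSmoothMCF.antitoneOn_integral_cutoffWeight`). The area measure is a Hausdorff measure, which
the area formula `euclideanHausdorffMeasure_image_eq_lintegral` expresses in charts.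
-/

noncomputable section

open Topology Filter

/-! ### The area formula for parametrized surfaces -/

/-- An inequality between measures is local: `X` splits into countably many disjoint measurable
pieces, each contained in one of the given neighbourhoods. -/
theorem measure_le_of_locally_le {X : Type*} [TopologicalSpace X] [SecondCountableTopology X]
    [MeasurableSpace X] [OpensMeasurableSpace X] {μ ν : Measure X}
    (h : ∀ x, ∃ U ∈ 𝓝 x, ∀ A ⊆ U, MeasurableSet A → μ A ≤ ν A) : μ ≤ ν := by
  choose U hU hA using h
  obtain ⟨s, hs, hcov⟩ := TopologicalSpace.countable_cover_nhds
    (f := fun x => interior (U x)) (fun x => interior_mem_nhds.2 (hU x))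
  rcases isEmpty_or_nonempty X with hX | ⟨⟨x₀⟩⟩
  · refine Measure.le_iff.2 fun A _ => ?_
    simp [Set.eq_empty_of_isEmpty A]
  have hsne : s.Nonempty := by
    have : x₀ ∈ ⋃ x ∈ s, interior (U x) := hcov ▸ mem_univ x₀
    simp only [mem_iUnion] at this
    obtain ⟨x, hx, _⟩ := this
    exact ⟨x, hx⟩
  obtain ⟨g, hg⟩ := hs.exists_eq_range hsne
  set V : ℕ → Set X := fun n => interior (U (g n)) with hV
  have hVu : ⋃ n, V n = univ := by
    rw [← hcov, hg]
    simp [hV]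
  have hVm : ∀ n, MeasurableSet (disjointed V n) :=
    fun n => MeasurableSet.disjointed (fun i => isOpen_interior.measurableSet) n
  refine Measure.le_iff.2 fun A hAm => ?_
  have hAe : A = ⋃ n, (A ∩ disjointed V n) := by
    rw [← inter_iUnion, iUnion_disjointed, hVu, inter_univ]
  have hdis : Pairwise (Function.onFun Disjoint fun n => A ∩ disjointed V n) :=
    fun i j hij => (disjoint_disjointed V hij).mono inter_subset_right inter_subset_right
  rw [hAe, measure_iUnion hdis fun n => hAm.inter (hVm n),
    measure_iUnion hdis fun n => hAm.inter (hVm n)]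
  refine ENNReal.tsum_le_tsum fun n => hA (g n) _ ?_ (hAm.inter (hVm n))
  exact inter_subset_right.trans ((disjointed_subset V n).trans interior_subset)

/-- If `f` expands distances on `A` at most `K` times as much as `g`, then `f ∘ g⁻¹` is
`K`-Lipschitz on `g '' A`, which compares the Hausdorff measures of the two images. -/
theorem euclideanHausdorffMeasure_image_le_of_dist_le {X Y Z : Type*}
    [MetricSpace Y] [MeasurableSpace Y] [BorelSpace Y]
    [MetricSpace Z] [MeasurableSpace Z] [BorelSpace Z] (d : ℕ)
    {f : X → Y} {g : X → Z} {A : Set X} {K : NNReal}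
    (h : ∀ x ∈ A, ∀ y ∈ A, dist (f x) (f y) ≤ K * dist (g x) (g y)) :
    μHE[d] (f '' A) ≤ (K : ENNReal) ^ d * μHE[d] (g '' A) := by
  rcases A.eq_empty_or_nonempty with rfl | ⟨x₀, hx₀⟩
  · simp
  have : Nonempty X := ⟨x₀⟩
  set φ : Z → Y := fun z => f (Function.invFunOn g A z) with hφ
  have hinv : ∀ x ∈ A, Function.invFunOn g A (g x) ∈ A ∧ g (Function.invFunOn g A (g x)) = g x :=
    fun x hx => ⟨Function.invFunOn_mem ⟨x, hx, rfl⟩, Function.invFunOn_eq ⟨x, hx, rfl⟩⟩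
  have hφg : ∀ x ∈ A, φ (g x) = f x := by
    intro x hx
    have := h _ (hinv x hx).1 x hx
    rw [(hinv x hx).2, dist_self, mul_zero] at this
    exact dist_le_zero.1 this
  have himg : f '' A = φ '' (g '' A) := by
    rw [image_image]
    exact image_congr fun x hx => (hφg x hx).symm
  have hlip : LipschitzOnWith K φ (g '' A) := by
    refine LipschitzOnWith.of_dist_le_mul ?_
    rintro _ ⟨x, hx, rfl⟩ _ ⟨y, hy, rfl⟩
    rw [hφg x hx, hφg y hy]
    exact h x hx y hy
  have := hlip.hausdorffMeasure_image_le (d := d) (by positivity)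
  rw [himg, Measure.euclideanHausdorffMeasure_def, Measure.euclideanHausdorffMeasure_def,
    Measure.smul_apply, Measure.smul_apply, ENNReal.smul_def, ENNReal.smul_def, smul_eq_mul,
    smul_eq_mul, mul_left_comm]
  gcongr
  simpa using this

/-- The Gram determinant of two vectors: the squared area of the parallelogram they span. -/
def gramDet (v w : Space) : ℝ := ⟪v, v⟫ * ⟪w, w⟫ - ⟪v, w⟫ ^ 2

/-- The area density of a parametrized surface `g`: the square root of the Gram determinant of its
partial derivatives. -/
def areaDensity (g : Plane → Space) (u : Plane) : ℝ :=
  √(gramDet (coordDeriv g 0 u) (coordDeriv g 1 u))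

theorem plane_eq_sum (u : Plane) :
    u = u 0 • EuclideanSpace.single (0 : Fin 2) (1 : ℝ) +
      u 1 • EuclideanSpace.single (1 : Fin 2) (1 : ℝ) := by
  ext i
  fin_cases i <;> simp

theorem injective_of_gramDet_pos (L : Plane →ₗ[ℝ] Space)
    (h : 0 < gramDet (L (EuclideanSpace.single 0 1)) (L (EuclideanSpace.single 1 1))) :
    Function.Injective L := by
  rw [injective_iff_map_eq_zero]
  intro u hu
  set v := L (EuclideanSpace.single 0 1)
  set w := L (EuclideanSpace.single 1 1)
  have hu' : u 0 • v + u 1 • w = 0 := by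
    rw [← hu]
    conv_rhs => rw [plane_eq_sum u]
    simp [v, w]
  have h1 : u 0 * ⟪v, v⟫ + u 1 * ⟪v, w⟫ = 0 := by
    have := congrArg (fun z => ⟪v, z⟫) hu'
    simpa [inner_add_right, inner_smul_right] using this
  have h2 : u 0 * ⟪v, w⟫ + u 1 * ⟪w, w⟫ = 0 := by
    have := congrArg (fun z => ⟪w, z⟫) hu'
    simpa [inner_add_right, inner_smul_right, real_inner_comm] using this
  unfold gramDet at h
  have e0 : u 0 = 0 := by
    have : u 0 * (⟪v, v⟫ * ⟪w, w⟫ - ⟪v, w⟫ ^ 2) = 0 := by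
      linear_combination ⟪w, w⟫ * h1 - ⟪v, w⟫ * h2
    exact (mul_eq_zero.1 this).resolve_right h.ne'
  have e1 : u 1 = 0 := by
    have : u 1 * (⟪v, v⟫ * ⟪w, w⟫ - ⟪v, w⟫ ^ 2) = 0 := by
      linear_combination ⟪v, v⟫ * h2 - ⟪v, w⟫ * h1
    exact (mul_eq_zero.1 this).resolve_right h.ne'
  rw [plane_eq_sum u, e0, e1]
  simp

/-- An injective linear map of the plane to space is a linear map of the plane followed by an
isometry; the determinant of the planar map is, up to sign, the square root of the Gram
determinant. -/
theorem exists_planar_model (L : Plane →ₗ[ℝ] Space)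
    (h : 0 < gramDet (L (EuclideanSpace.single 0 1)) (L (EuclideanSpace.single 1 1))) :
    ∃ T : Plane →ₗ[ℝ] Plane, (∀ u, ‖T u‖ = ‖L u‖) ∧
      |LinearMap.det T| =
        √(gramDet (L (EuclideanSpace.single 0 1)) (L (EuclideanSpace.single 1 1))) := by
  have hinj := injective_of_gramDet_pos L h
  have hfr : Module.finrank ℝ (LinearMap.range L) = 2 := by
    rw [LinearMap.finrank_range_of_inj hinj]
    simp
  let b := (stdOrthonormalBasis ℝ (LinearMap.range L)).reindex (finCongr hfr)
  let T : Plane →ₗ[ℝ] Plane := b.repr.toLinearEquiv.toLinearMap ∘ₗ L.rangeRestrict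
  have hTL : ∀ u v, ⟪T u, T v⟫ = ⟪L u, L v⟫ := by
    intro u v
    have : ⟪T u, T v⟫ = ⟪L.rangeRestrict u, L.rangeRestrict v⟫ := b.repr.inner_map_map _ _
    rw [this]
    rfl
  refine ⟨T, fun u => ?_, ?_⟩
  · have : ‖T u‖ = ‖L.rangeRestrict u‖ := b.repr.norm_map _
    rw [this]
    rfl
  · symm
    rw [Real.sqrt_eq_iff_mul_self_eq (le_of_lt h) (abs_nonneg _), abs_mul_abs_self]
    have hdet : LinearMap.det T =
        (LinearMap.toMatrix (EuclideanSpace.basisFun (Fin 2) ℝ).toBasis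
          (EuclideanSpace.basisFun (Fin 2) ℝ).toBasis T).det := by
      rw [LinearMap.det_toMatrix]
    rw [hdet, Matrix.det_fin_two]
    simp only [gramDet, ← hTL]
    simp [LinearMap.toMatrix_apply, EuclideanSpace.inner_eq_star_dotProduct, dotProduct,
      Fin.sum_univ_two, EuclideanSpace.real_norm_sq_eq]
    ring

theorem coordDeriv_continuousOn {f : Plane → Space} {V : Set Plane} (hV : IsOpen V)
    (hf : ContDiffOn ℝ 1 f V) (i : Fin 2) : ContinuousOn (coordDeriv f i) V :=
  (hf.continuousOn_fderiv_of_isOpen hV le_rfl).clm_apply continuousOn_const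

theorem areaDensity_continuousOn {f : Plane → Space} {V : Set Plane} (hV : IsOpen V)
    (hf : ContDiffOn ℝ 1 f V) : ContinuousOn (areaDensity f) V := by
  have h0 := coordDeriv_continuousOn hV hf 0
  have h1 := coordDeriv_continuousOn hV hf 1
  exact (((h0.inner h0).mul (h1.inner h1)).sub ((h0.inner h1).pow 2)).sqrt

/-- Near a point, a `C¹` immersion distorts lengths, relative to its linearization, by a factor
close to `1`. -/
theorem exists_nhds_dist_comparison {f : Plane → Space} {x : Plane} (hf : ContDiffAt ℝ 1 f x)
    (hD : 0 < gramDet (coordDeriv f 0 x) (coordDeriv f 1 x)) {c : NNReal} (hc : 1 < c) :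
    ∃ T : Plane →ₗ[ℝ] Plane, |LinearMap.det T| = areaDensity f x ∧ ∃ U ∈ 𝓝 x, ∀ y ∈ U, ∀ z ∈ U,
      dist (f y) (f z) ≤ c * dist (T y) (T z) ∧ dist (T y) (T z) ≤ c * dist (f y) (f z) := by
  set L : Plane →L[ℝ] Space := fderiv ℝ f x with hL
  obtain ⟨T, hT, hdet⟩ := exists_planar_model (L : Plane →ₗ[ℝ] Space) hD
  refine ⟨T, hdet, ?_⟩
  have hinj : Function.Injective L := injective_of_gramDet_pos (L : Plane →ₗ[ℝ] Space) hD
  obtain ⟨K, hK0, hK⟩ := (L : Plane →ₗ[ℝ] Space).exists_antilipschitzWith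
    (LinearMap.ker_eq_bot.2 hinj)
  have hKb : ∀ u, ‖u‖ ≤ K * ‖L u‖ := by
    intro u
    have := hK.le_mul_dist u 0
    simpa using this
  have hc' : (1 : ℝ) < c := by exact_mod_cast hc
  have hcpos : (0 : ℝ) < c := by linarith
  have hKpos : (0 : ℝ) < K := by exact_mod_cast hK0
  -- The error of the linearization has to be at most `θ ‖L (y - z)‖`, with both `1 + θ` and
  -- `(1 - θ)⁻¹` at most `c`.
  set θ : ℝ := 1 - 1 / c with hθ
  have hθpos : 0 < θ := by
    rw [hθ, sub_pos, div_lt_one hcpos]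
    exact hc'
  have hθ1 : 1 + θ ≤ c := by
    have : 0 ≤ ((c : ℝ) - 1) ^ 2 / c := by positivity
    have e : ((c : ℝ) - 1) ^ 2 / c = c - (1 + θ) := by
      rw [hθ]
      field_simp
      ring
    linarith
  have hθ2 : c * (1 - θ) = 1 := by
    rw [hθ]
    field_simp
    ring
  have hstrict : HasStrictFDerivAt f L x := hf.hasStrictFDerivAt one_ne_zero
  have hlit := hstrict.isLittleO.def (c := θ / K) (by positivity)
  rw [nhds_prod_eq] at hlit
  obtain ⟨U, hU, hUU⟩ := Filter.eventually_prod_self_iff'.1 hlit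
  refine ⟨U, hU, fun y hy z hz => ?_⟩
  have h1 : ‖f y - f z - L (y - z)‖ ≤ θ / K * ‖y - z‖ := hUU y hy z hz
  have h2 : θ / K * ‖y - z‖ ≤ θ * ‖L (y - z)‖ := by
    calc θ / K * ‖y - z‖ ≤ θ / K * (K * ‖L (y - z)‖) := by gcongr; exact hKb _
      _ = θ * ‖L (y - z)‖ := by field_simp
  have h3 : ‖T (y - z)‖ = ‖L (y - z)‖ := hT _
  rw [dist_eq_norm, dist_eq_norm, ← map_sub, h3]
  have h4 : ‖f y - f z‖ ≤ ‖f y - f z - L (y - z)‖ + ‖L (y - z)‖ := by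
    simpa using norm_add_le (f y - f z - L (y - z)) (L (y - z))
  have h5 : ‖L (y - z)‖ ≤ ‖f y - f z - L (y - z)‖ + ‖f y - f z‖ := by
    have := norm_sub_le (f y - f z) (f y - f z - L (y - z))
    rw [sub_sub_cancel] at this
    linarith
  constructor
  · have : (1 + θ) * ‖L (y - z)‖ ≤ c * ‖L (y - z)‖ := by gcongr
    linarith
  · have h6 : (1 - θ) * ‖L (y - z)‖ ≤ ‖f y - f z‖ := by linarith
    calc ‖L (y - z)‖ = c * ((1 - θ) * ‖L (y - z)‖) := by rw [← mul_assoc, hθ2, one_mul]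
      _ ≤ c * ‖f y - f z‖ := by gcongr

theorem areaDensity_pos {f : Plane → Space} {u : Plane}
    (hD : 0 < gramDet (coordDeriv f 0 u) (coordDeriv f 1 u)) : 0 < areaDensity f u :=
  Real.sqrt_pos.2 hD

/-- Near a point, the area of the image and the integral of the area density differ by a factor
close to `1`: two factors `c` come from the distortion of lengths by `f`, the third from the
oscillation of the density. -/
theorem exists_nhds_area_comparison {f : Plane → Space} {V : Set Plane} (hV : IsOpen V)
    (hf : ContDiffOn ℝ 1 f V)
    (hD : ∀ u ∈ V, 0 < gramDet (coordDeriv f 0 u) (coordDeriv f 1 u)) {x : Plane} (hx : x ∈ V)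
    {c : NNReal} (hc : 1 < c) :
    ∃ U ∈ 𝓝 x, ∀ A ⊆ U, MeasurableSet A →
      μHE[2] (f '' A) ≤ c ^ 3 * ∫⁻ u in A, ENNReal.ofReal (areaDensity f u) ∧
      ∫⁻ u in A, ENNReal.ofReal (areaDensity f u) ≤ c ^ 3 * μHE[2] (f '' A) := by
  obtain ⟨T, hdet, U, hU, hTU⟩ :=
    exists_nhds_dist_comparison (hf.contDiffAt (hV.mem_nhds hx)) (hD x hx) hc
  have hx0 := areaDensity_pos (hD x hx)
  have hc' : (1 : ℝ) < c := by exact_mod_cast hc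
  have hcont : ContinuousAt (areaDensity f) x :=
    (areaDensity_continuousOn hV hf).continuousAt (hV.mem_nhds hx)
  have hlt : ∀ᶠ u in 𝓝 x, areaDensity f u < c * areaDensity f x :=
    hcont.eventually (gt_mem_nhds (by nlinarith))
  have hgt : ∀ᶠ u in 𝓝 x, areaDensity f x / c < areaDensity f u :=
    hcont.eventually (lt_mem_nhds (div_lt_self hx0 hc'))
  refine ⟨U ∩ {u | areaDensity f u < c * areaDensity f x ∧ areaDensity f x / c < areaDensity f u},
    Filter.inter_mem hU (hlt.and hgt), fun A hA hAm => ?_⟩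
  have hTA : μHE[2] (T '' A) = ENNReal.ofReal (areaDensity f x) * volume A := by
    rw [EuclideanSpace.euclideanHausdorffMeasure_eq_volume, Measure.addHaar_image_linearMap, hdet]
  have i1 : μHE[2] (f '' A) ≤ (c : ENNReal) ^ 2 * μHE[2] (T '' A) :=
    euclideanHausdorffMeasure_image_le_of_dist_le 2 fun y hy z hz =>
      (hTU y (hA hy).1 z (hA hz).1).1
  have i2 : μHE[2] (T '' A) ≤ (c : ENNReal) ^ 2 * μHE[2] (f '' A) :=
    euclideanHausdorffMeasure_image_le_of_dist_le 2 fun y hy z hz =>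
      (hTU y (hA hy).1 z (hA hz).1).2
  have i3 : ENNReal.ofReal (areaDensity f x) * volume A ≤
      c * ∫⁻ u in A, ENNReal.ofReal (areaDensity f u) := by
    rw [← lintegral_const_mul' _ _ ENNReal.coe_ne_top, ← setLIntegral_const]
    refine setLIntegral_mono' hAm fun u hu => ?_
    rw [← ENNReal.ofReal_coe_nnreal, ← ENNReal.ofReal_mul (by positivity)]
    refine ENNReal.ofReal_le_ofReal ?_
    have := (hA hu).2.2
    rw [div_lt_iff₀ (by linarith)] at this
    linarith
  have i4 : ∫⁻ u in A, ENNReal.ofReal (areaDensity f u) ≤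
      c * (ENNReal.ofReal (areaDensity f x) * volume A) := by
    rw [← mul_assoc, ← setLIntegral_const]
    refine setLIntegral_mono' hAm fun u hu => ?_
    rw [← ENNReal.ofReal_coe_nnreal, ← ENNReal.ofReal_mul (by positivity)]
    exact ENNReal.ofReal_le_ofReal (hA hu).2.1.le
  rw [hTA] at i1 i2
  constructor
  · calc _ ≤ _ := i1
      _ ≤ (c : ENNReal) ^ 2 * (c * ∫⁻ u in A, ENNReal.ofReal (areaDensity f u)) := by gcongr
      _ = _ := by ring
  · calc _ ≤ _ := i4
      _ ≤ c * ((c : ENNReal) ^ 2 * μHE[2] (f '' A)) := by gcongr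
      _ = _ := by ring

theorem le_of_forall_one_lt_pow_mul {a b : ENNReal}
    (h : ∀ c : NNReal, 1 < c → a ≤ c ^ 3 * b) : a ≤ b := by
  have hlim : Tendsto (fun c : NNReal => ((c : ENNReal)) ^ 3 * b) (𝓝[>] 1) (𝓝 (1 ^ 3 * b)) := by
    refine ENNReal.Tendsto.mul_const ?_ (Or.inl (by simp))
    refine Tendsto.mono_left ?_ nhdsWithin_le_nhds
    have : Continuous fun c : NNReal => ((c ^ 3 : NNReal) : ENNReal) := by fun_prop
    simpa using this.tendsto 1
  rw [one_pow, one_mul] at hlim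
  exact ge_of_tendsto hlim (eventually_nhdsWithin_of_forall fun c hc => h c hc)

/-- The **area formula** for an injective immersed parametrized surface. -/
theorem euclideanHausdorffMeasure_image_eq_lintegral {f : Plane → Space} {V : Set Plane}
    (hV : IsOpen V) (hf : ContDiffOn ℝ 1 f V) (hinj : InjOn f V)
    (hD : ∀ u ∈ V, 0 < gramDet (coordDeriv f 0 u) (coordDeriv f 1 u)) {A : Set Plane}
    (hAV : A ⊆ V) (hA : MeasurableSet A) :
    μHE[2] (f '' A) = ∫⁻ u in A, ENNReal.ofReal (areaDensity f u) := by
  have hemb : MeasurableEmbedding (V.domRestrict f) :=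
    hf.continuousOn.measurableEmbedding hV.measurableSet hinj
  set dens : Plane → ENNReal := fun u => ENNReal.ofReal (areaDensity f u)
  set μ : Measure V := (μHE[2] : Measure Space).comap (V.domRestrict f)
  set ν : Measure V := (volume.withDensity dens).comap (Subtype.val : V → Plane)
  have hval := MeasurableEmbedding.subtype_coe hV.measurableSet
  have hμ : ∀ B : Set V, μ B = μHE[2] (f '' (Subtype.val '' B)) := by
    intro B
    rw [hemb.comap_apply, image_image]
    rfl
  have hν : ∀ B : Set V, MeasurableSet B → ν B = ∫⁻ u in Subtype.val '' B, dens u := by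
    intro B hB
    rw [hval.comap_apply, withDensity_apply _ (hval.measurableSet_image.2 hB)]
  have key : ∀ c : NNReal, 1 < c → μ ≤ (c ^ 3 : NNReal) • ν ∧ ν ≤ (c ^ 3 : NNReal) • μ := by
    intro c hc
    constructor <;>
    · refine measure_le_of_locally_le fun x => ?_
      obtain ⟨U, hU, hUA⟩ := exists_nhds_area_comparison hV hf hD x.2 hc
      refine ⟨Subtype.val ⁻¹' U, continuous_subtype_val.continuousAt hU, fun B hB hBm => ?_⟩
      have := hUA (Subtype.val '' B) (image_subset_iff.2 hB) (hval.measurableSet_image.2 hBm)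
      rw [Measure.smul_apply, hμ, hν B hBm, ENNReal.smul_def, smul_eq_mul]
      push_cast
      first | exact this.1 | exact this.2
  have hAe : Subtype.val '' (Subtype.val ⁻¹' A : Set V) = A := by
    rw [Subtype.image_preimage_coe, inter_eq_right.2 hAV]
  have hAm : MeasurableSet (Subtype.val ⁻¹' A : Set V) := measurable_subtype_coe hA
  have e1 := hμ (Subtype.val ⁻¹' A)
  have e2 := hν _ hAm
  rw [hAe] at e1 e2
  rw [← e1, ← e2]
  refine le_antisymm (le_of_forall_one_lt_pow_mul fun c hc => ?_)
    (le_of_forall_one_lt_pow_mul fun c hc => ?_)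
  · have := (key c hc).1 (Subtype.val ⁻¹' A)
    rwa [Measure.smul_apply, ENNReal.smul_def, smul_eq_mul, ENNReal.coe_pow] at this
  · have := (key c hc).2 (Subtype.val ⁻¹' A)
    rwa [Measure.smul_apply, ENNReal.smul_def, smul_eq_mul, ENNReal.coe_pow] at this

/-! ### Directional derivatives and the tangent plane -/

section DirectionalDerivative

variable {W E : Type*} [NormedAddCommGroup W] [NormedSpace ℝ W]
  [NormedAddCommGroup E] [NormedSpace ℝ E]

/-- The derivative of `φ` in the direction `v`, as a function of the point. -/
def pd (v : W) (φ : W → E) (q : W) : E := fderiv ℝ φ q v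

theorem pd_congr {φ ψ : W → E} {Ω : Set W} (hΩ : IsOpen Ω) (h : ∀ q ∈ Ω, φ q = ψ q) (v : W)
    {q : W} (hq : q ∈ Ω) : pd v φ q = pd v ψ q := by
  unfold pd
  rw [Filter.EventuallyEq.fderiv_eq (Filter.eventually_of_mem (hΩ.mem_nhds hq) h)]

theorem pd_const (v : W) (c : E) (q : W) : pd v (fun _ => c) q = 0 := by
  simp [pd]

theorem pd_add {φ ψ : W → E} {q : W} (hφ : DifferentiableAt ℝ φ q) (hψ : DifferentiableAt ℝ ψ q)
    (v : W) : pd v (fun x => φ x + ψ x) q = pd v φ q + pd v ψ q := by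
  simp [pd, fderiv_fun_add hφ hψ]

theorem pd_sub {φ ψ : W → E} {q : W} (hφ : DifferentiableAt ℝ φ q) (hψ : DifferentiableAt ℝ ψ q)
    (v : W) : pd v (fun x => φ x - ψ x) q = pd v φ q - pd v ψ q := by
  simp [pd, fderiv_fun_sub hφ hψ]

theorem pd_neg (φ : W → E) (q v : W) : pd v (fun x => -φ x) q = -pd v φ q := by
  simp [pd, fderiv_fun_neg]

theorem pd_mul {φ ψ : W → ℝ} {q : W} (hφ : DifferentiableAt ℝ φ q) (hψ : DifferentiableAt ℝ ψ q)
    (v : W) : pd v (fun x => φ x * ψ x) q = pd v φ q * ψ q + φ q * pd v ψ q := by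
  simp [pd, fderiv_fun_mul hφ hψ]
  ring

theorem pd_const_mul {ψ : W → ℝ} {q : W} (c : ℝ) (hψ : DifferentiableAt ℝ ψ q)
    (v : W) : pd v (fun x => c * ψ x) q = c * pd v ψ q := by
  rw [pd_mul (differentiableAt_const c) hψ, pd_const]
  ring

theorem pd_smul {φ : W → ℝ} {ψ : W → E} {q : W} (hφ : DifferentiableAt ℝ φ q)
    (hψ : DifferentiableAt ℝ ψ q) (v : W) :
    pd v (fun x => φ x • ψ x) q = pd v φ q • ψ q + φ q • pd v ψ q := by
  simp [pd, fderiv_fun_smul hφ hψ]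
  abel

theorem pd_inner {φ ψ : W → Space} {q : W} (hφ : DifferentiableAt ℝ φ q)
    (hψ : DifferentiableAt ℝ ψ q) (v : W) :
    pd v (fun x => ⟪φ x, ψ x⟫) q = ⟪pd v φ q, ψ q⟫ + ⟪φ q, pd v ψ q⟫ := by
  simp [pd, fderiv_inner_apply ℝ hφ hψ]
  ring

theorem pd_comp {β : ℝ → ℝ} {φ : W → ℝ} {q : W} {β' : ℝ} (hβ : HasDerivAt β β' (φ q))
    (hφ : DifferentiableAt ℝ φ q) (v : W) : pd v (fun x => β (φ x)) q = β' * pd v φ q := by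
  unfold pd
  have := (hβ.comp_hasFDerivAt q hφ.hasFDerivAt).fderiv
  have e : (fun x => β (φ x)) = β ∘ φ := rfl
  rw [e, this]
  simp

theorem ContDiffOn.pd {φ : W → E} {Ω : Set W} {m n : WithTop ℕ∞} (hφ : ContDiffOn ℝ n φ Ω)
    (hΩ : IsOpen Ω) (hmn : m + 1 ≤ n) (v : W) : ContDiffOn ℝ m (pd v φ) Ω :=
  (hφ.fderiv_of_isOpen hΩ hmn).clm_apply contDiffOn_const

theorem ContDiffOn.diffAt {φ : W → E} {Ω : Set W} {n : WithTop ℕ∞} (hφ : ContDiffOn ℝ n φ Ω)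
    (hΩ : IsOpen Ω) (hn : n ≠ 0) {q : W} (hq : q ∈ Ω) : DifferentiableAt ℝ φ q :=
  (hφ.contDiffAt (hΩ.mem_nhds hq)).differentiableAt hn

theorem pd_comm {φ : W → E} {q : W} (hφ : ContDiffAt ℝ 2 φ q) (v w : W) :
    pd v (pd w φ) q = pd w (pd v φ) q := by
  have hsymm : IsSymmSndFDerivAt ℝ φ q := hφ.isSymmSndFDerivAt (by simp)
  have hd : DifferentiableAt ℝ (fderiv ℝ φ) q :=
    (hφ.fderiv_right (m := 1) (by norm_num)).differentiableAt one_ne_zero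
  have key : ∀ v w : W, pd v (pd w φ) q = fderiv ℝ (fderiv ℝ φ) q v w := by
    intro v w
    unfold pd
    rw [fderiv_clm_apply hd (differentiableAt_const w)]
    simp
  rw [key, key]
  exact hsymm v w

end DirectionalDerivative

section TangentPlane

/-- The inner product, in the dual of the plane spanned by `v` and `w`, of two covectors whose
values at `v` and `w` are `a₁, a₂` and `b₁, b₂`; that is `∑ i j, gⁱʲ aᵢ bⱼ`. -/
def dualInner (v w : Space) (a₁ a₂ b₁ b₂ : ℝ) : ℝ :=
  (⟪w, w⟫ * (a₁ * b₁) - ⟪v, w⟫ * (a₁ * b₂ + a₂ * b₁) + ⟪v, v⟫ * (a₂ * b₂)) / gramDet v w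

/-- The trace, with respect to the metric of the plane spanned by `v` and `w`, of the symmetric
bilinear form with values `a` at `(v, v)`, `b` at `(v, w)` and `c` at `(w, w)`. -/
def metricTrace (v w : Space) (a b c : ℝ) : ℝ :=
  (⟪w, w⟫ * a - 2 * ⟪v, w⟫ * b + ⟪v, v⟫ * c) / gramDet v w

/-- The orthogonal projection of `a` to the plane spanned by `v` and `w`. -/
def tangentPart (v w a : Space) : Space :=
  ((⟪w, w⟫ * ⟪a, v⟫ - ⟪v, w⟫ * ⟪a, w⟫) / gramDet v w) • v +
    ((⟪v, v⟫ * ⟪a, w⟫ - ⟪v, w⟫ * ⟪a, v⟫) / gramDet v w) • w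

variable {v w n : Space}

theorem eq_zero_of_orthogonal_frame (hD : 0 < gramDet v w) (hn : ‖n‖ = 1) (hv : ⟪v, n⟫ = 0)
    (hw : ⟪w, n⟫ = 0) {r : Space} (h1 : ⟪r, v⟫ = 0) (h2 : ⟪r, w⟫ = 0) (h3 : ⟪r, n⟫ = 0) :
    r = 0 := by
  have hnn : ⟪n, n⟫ = 1 := by rw [real_inner_self_eq_norm_sq, hn]; norm_num
  have hli : LinearIndependent ℝ ![v, w, n] := by
    rw [Fintype.linearIndependent_iff]
    intro g hg
    simp only [Fin.sum_univ_three, Matrix.cons_val_zero, Matrix.cons_val_one,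
      Matrix.cons_val_two, Matrix.head_cons, Matrix.tail_cons] at hg
    have e1 : g 0 * ⟪v, v⟫ + g 1 * ⟪v, w⟫ = 0 := by
      have := congrArg (fun z => ⟪v, z⟫) hg
      simpa [inner_add_right, inner_smul_right, hv] using this
    have e2 : g 0 * ⟪v, w⟫ + g 1 * ⟪w, w⟫ = 0 := by
      have := congrArg (fun z => ⟪w, z⟫) hg
      simpa [inner_add_right, inner_smul_right, hw, real_inner_comm] using this
    have e3 : g 2 = 0 := by
      have := congrArg (fun z => ⟪z, n⟫) hg
      simpa [inner_add_left, inner_smul_left, hw, hv, hnn, hn] using this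
    unfold gramDet at hD
    have i0 : g 0 * (⟪v, v⟫ * ⟪w, w⟫ - ⟪v, w⟫ ^ 2) = 0 := by
      linear_combination ⟪w, w⟫ * e1 - ⟪v, w⟫ * e2
    have i1 : g 1 * (⟪v, v⟫ * ⟪w, w⟫ - ⟪v, w⟫ ^ 2) = 0 := by
      linear_combination ⟪v, v⟫ * e2 - ⟪v, w⟫ * e1
    intro i
    fin_cases i
    · exact (mul_eq_zero.1 i0).resolve_right hD.ne'
    · exact (mul_eq_zero.1 i1).resolve_right hD.ne'
    · exact e3
  let b := basisOfLinearIndependentOfCardEqFinrank hli (by simp)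
  refine InnerProductSpace.ext_inner_right_basis b fun i => ?_
  rw [inner_zero_left]
  fin_cases i <;> simp [b, h1, h2, h3]

theorem eq_tangentPart_add (hD : 0 < gramDet v w) (hn : ‖n‖ = 1) (hv : ⟪v, n⟫ = 0)
    (hw : ⟪w, n⟫ = 0) (a : Space) : a = tangentPart v w a + ⟪a, n⟫ • n := by
  have hnn : ⟪n, n⟫ = 1 := by rw [real_inner_self_eq_norm_sq, hn]; norm_num
  rw [← sub_eq_zero]
  have hD' := hD.ne'
  apply eq_zero_of_orthogonal_frame hD hn hv hw
  · simp only [tangentPart, inner_sub_left, inner_add_left, inner_smul_left, conj_trivial,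
      real_inner_comm v n, real_inner_comm v w, hv]
    field_simp
    unfold gramDet
    ring
  · simp only [tangentPart, inner_sub_left, inner_add_left, inner_smul_left, conj_trivial,
      real_inner_comm w n, hw]
    field_simp
    unfold gramDet
    ring
  · simp only [tangentPart, inner_sub_left, inner_add_left, inner_smul_left, conj_trivial,
      hv, hw, hnn]
    ring

/-- Parseval's identity for the tangent plane and its normal line. -/
theorem inner_eq_dualInner_add (hD : 0 < gramDet v w) (hn : ‖n‖ = 1) (hv : ⟪v, n⟫ = 0)
    (hw : ⟪w, n⟫ = 0) (a b : Space) :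
    ⟪a, b⟫ = dualInner v w ⟪a, v⟫ ⟪a, w⟫ ⟪b, v⟫ ⟪b, w⟫ + ⟪a, n⟫ * ⟪b, n⟫ := by
  conv_lhs => rw [eq_tangentPart_add hD hn hv hw a]
  simp only [tangentPart, dualInner, inner_add_left, inner_smul_left, conj_trivial,
    real_inner_comm b v, real_inner_comm b w,
    real_inner_comm b n]
  ring

theorem dualInner_self_nonneg (hD : 0 < gramDet v w) (a b : ℝ) :
    0 ≤ dualInner v w a b a b := by
  refine div_nonneg ?_ hD.le
  have : ⟪w, w⟫ * (a * a) - ⟪v, w⟫ * (a * b + b * a) + ⟪v, v⟫ * (b * b) =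
      ⟪a • w - b • v, a • w - b • v⟫ := by
    simp only [inner_sub_left, inner_sub_right, inner_smul_left, inner_smul_right, conj_trivial,
      real_inner_comm v w]
    ring
  rw [this]
  exact real_inner_self_nonneg

theorem metricTrace_gram_nonneg (hD : 0 < gramDet v w) (a b : Space) :
    0 ≤ metricTrace v w ⟪a, a⟫ ⟪a, b⟫ ⟪b, b⟫ := by
  refine div_nonneg ?_ hD.le
  have hvv : 0 < ⟪v, v⟫ := by
    refine lt_of_le_of_ne real_inner_self_nonneg fun h => ?_
    unfold gramDet at hD
    rw [← h] at hD
    nlinarith [sq_nonneg ⟪v, w⟫]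
  have key : ⟪v, v⟫ * (⟪w, w⟫ * ⟪a, a⟫ - 2 * ⟪v, w⟫ * ⟪a, b⟫ + ⟪v, v⟫ * ⟪b, b⟫) =
      ⟪⟪v, v⟫ • b - ⟪v, w⟫ • a, ⟪v, v⟫ • b - ⟪v, w⟫ • a⟫ + gramDet v w * ⟪a, a⟫ := by
    simp only [gramDet, inner_sub_left, inner_sub_right, inner_smul_left, inner_smul_right,
      conj_trivial, real_inner_comm a b]
    ring
  have : 0 ≤ ⟪v, v⟫ * (⟪w, w⟫ * ⟪a, a⟫ - 2 * ⟪v, w⟫ * ⟪a, b⟫ + ⟪v, v⟫ * ⟪b, b⟫) := by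
    rw [key]
    have := real_inner_self_nonneg (x := a)
    have := real_inner_self_nonneg (x := ⟪v, v⟫ • b - ⟪v, w⟫ • a)
    positivity
  exact nonneg_of_mul_nonneg_right this hvv

end TangentPlane

/-! ### Evolution equations on a mean curvature flow -/

theorem two_le_infty : (2 : WithTop ℕ∞) ≤ ∞ :=
  WithTop.coe_le_coe.2 (le_top : (2 : ℕ∞) ≤ ⊤)

section LocalFlow

variable {W : Type*} [NormedAddCommGroup W] [NormedSpace ℝ W]

/-- The coefficient `h(v, w) = -⟨∂_v ∂_w X, ν⟩` of the second fundamental form. -/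
def sff (X ν : W → Space) (v w : W) (q : W) : ℝ := -⟪pd v (pd w X) q, ν q⟫

/-- The mean curvature of the surface parametrized by `X` in the directions `e₁`, `e₂`. -/
def curvH (e₁ e₂ : W) (X ν : W → Space) (q : W) : ℝ :=
  metricTrace (pd e₁ X q) (pd e₂ X q) (sff X ν e₁ e₁ q) (sff X ν e₁ e₂ q) (sff X ν e₂ e₂ q)

/-- A moving parametrized surface: `X` is defined on an open set `Ω` of a space of parameters, in
which `e₀` is the direction of time and `e₁`, `e₂` are those of the surface; it moves with velocity
`-H ν`. -/
structure IsLocalMCF (Ω : Set W) (e₀ e₁ e₂ : W) (X ν : W → Space) : Prop where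
  isOpen : IsOpen Ω
  smooth : ContDiffOn ℝ ∞ X Ω
  smooth_normal : ContDiffOn ℝ ∞ ν Ω
  norm_normal : ∀ q ∈ Ω, ‖ν q‖ = 1
  orth₁ : ∀ q ∈ Ω, ⟪pd e₁ X q, ν q⟫ = 0
  orth₂ : ∀ q ∈ Ω, ⟪pd e₂ X q, ν q⟫ = 0
  gram_pos : ∀ q ∈ Ω, 0 < gramDet (pd e₁ X q) (pd e₂ X q)
  evolves : ∀ q ∈ Ω, pd e₀ X q = -(curvH e₁ e₂ X ν q) • ν q

/-- The inner product of the gradients of `u` and `w` along the surface. -/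
def gradInnerLoc (e₁ e₂ : W) (X : W → Space) (u w : W → ℝ) (q : W) : ℝ :=
  dualInner (pd e₁ X q) (pd e₂ X q) (pd e₁ u q) (pd e₂ u q) (pd e₁ w q) (pd e₂ w q)

/-- The value at `(v, w)` of the covariant Hessian of `u` along the surface. -/
def hess (e₁ e₂ : W) (X : W → Space) (u : W → ℝ) (v w : W) (q : W) : ℝ :=
  pd v (pd w u) q - dualInner (pd e₁ X q) (pd e₂ X q) ⟪pd v (pd w X) q, pd e₁ X q⟫
    ⟪pd v (pd w X) q, pd e₂ X q⟫ (pd e₁ u q) (pd e₂ u q)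

/-- The Laplacian of `u` along the surface. -/
def lap (e₁ e₂ : W) (X : W → Space) (u : W → ℝ) (q : W) : ℝ :=
  metricTrace (pd e₁ X q) (pd e₂ X q) (hess e₁ e₂ X u e₁ e₁ q) (hess e₁ e₂ X u e₁ e₂ q)
    (hess e₁ e₂ X u e₂ e₂ q)

/-- The heat operator `∂ₜ u - Δ u` along the moving surface. -/
def heat (e₀ e₁ e₂ : W) (X : W → Space) (u : W → ℝ) (q : W) : ℝ :=
  pd e₀ u q - lap e₁ e₂ X u q

section Calculus

variable {Ω : Set W} {e₀ e₁ e₂ : W} {X : W → Space} {u w : W → ℝ} {q : W}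

theorem pd_pd_comp {β : ℝ → ℝ} (hβ : ContDiff ℝ 2 β) (hΩ : IsOpen Ω) (hu : ContDiffOn ℝ 2 u Ω)
    (hq : q ∈ Ω) (v w : W) :
    pd v (pd w fun x => β (u x)) q =
      deriv β (u q) * pd v (pd w u) q + deriv (deriv β) (u q) * (pd v u q * pd w u q) := by
  have hd : Differentiable ℝ β := hβ.differentiable two_ne_zero
  have hβ' : ContDiff ℝ 1 (deriv β) := by
    have : ContDiff ℝ (1 + 1) β := by norm_num; exact hβ
    exact (contDiff_succ_iff_deriv.1 this).2.2
  have hd' : Differentiable ℝ (deriv β) := hβ'.differentiable one_ne_zero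
  have h1 : ∀ x ∈ Ω, pd w (fun x => β (u x)) x = deriv β (u x) * pd w u x := fun x hx =>
    pd_comp (hd _).hasDerivAt (hu.diffAt hΩ two_ne_zero hx) w
  have hw1 : ContDiffOn ℝ 1 (pd w u) Ω := hu.pd hΩ (by norm_num) w
  have huq := hu.diffAt hΩ two_ne_zero hq
  rw [pd_congr hΩ h1 v hq, pd_mul (φ := fun x => deriv β (u x)) ((hd' _).comp q huq)
      (hw1.diffAt hΩ one_ne_zero hq),
    pd_comp (hd' _).hasDerivAt huq]
  ring

theorem heat_comp {β : ℝ → ℝ} (hβ : ContDiff ℝ 2 β) (hΩ : IsOpen Ω) (hu : ContDiffOn ℝ 2 u Ω)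
    (hq : q ∈ Ω) :
    heat e₀ e₁ e₂ X (fun x => β (u x)) q =
      deriv β (u q) * heat e₀ e₁ e₂ X u q -
        deriv (deriv β) (u q) * gradInnerLoc e₁ e₂ X u u q := by
  have hd : Differentiable ℝ β := hβ.differentiable two_ne_zero
  have huq := hu.diffAt hΩ two_ne_zero hq
  simp only [heat, lap, hess, gradInnerLoc, metricTrace, dualInner, pd_pd_comp hβ hΩ hu hq,
    pd_comp (hd _).hasDerivAt huq]
  ring

theorem pd_pd_sub (hΩ : IsOpen Ω) (hu : ContDiffOn ℝ 2 u Ω) (hw : ContDiffOn ℝ 2 w Ω)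
    (hq : q ∈ Ω) (a b : W) :
    pd a (pd b fun x => u x - w x) q = pd a (pd b u) q - pd a (pd b w) q := by
  rw [pd_congr hΩ (fun x hx => pd_sub (hu.diffAt hΩ two_ne_zero hx)
    (hw.diffAt hΩ two_ne_zero hx) b) a hq]
  exact pd_sub ((hu.pd (m := 1) hΩ (by norm_num) b).diffAt hΩ one_ne_zero hq)
    ((hw.pd (m := 1) hΩ (by norm_num) b).diffAt hΩ one_ne_zero hq) a

theorem pd_pd_const_mul (hΩ : IsOpen Ω) (hu : ContDiffOn ℝ 2 u Ω) (hq : q ∈ Ω) (c : ℝ)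
    (a b : W) : pd a (pd b fun x => c * u x) q = c * pd a (pd b u) q := by
  rw [pd_congr hΩ (fun x hx => pd_const_mul c (hu.diffAt hΩ two_ne_zero hx) b) a hq]
  exact pd_const_mul c ((hu.pd (m := 1) hΩ (by norm_num) b).diffAt hΩ one_ne_zero hq) a

theorem heat_sub_const_mul (hΩ : IsOpen Ω) (hu : ContDiffOn ℝ 2 u Ω) (hw : ContDiffOn ℝ 2 w Ω)
    (hq : q ∈ Ω) (c : ℝ) :
    heat e₀ e₁ e₂ X (fun x => u x - c * w x) q =
      heat e₀ e₁ e₂ X u q - c * heat e₀ e₁ e₂ X w q := by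
  have hcw : ContDiffOn ℝ 2 (fun x => c * w x) Ω := contDiffOn_const.mul hw
  have huq := hu.diffAt hΩ two_ne_zero hq
  have hwq := hw.diffAt hΩ two_ne_zero hq
  simp only [heat, lap, hess, metricTrace, dualInner, pd_pd_sub hΩ hu hcw hq,
    pd_pd_const_mul hΩ hw hq, pd_sub huq (hcw.diffAt hΩ two_ne_zero hq), pd_const_mul c hwq]
  ring

end Calculus

namespace IsLocalMCF

variable {Ω : Set W} {e₀ e₁ e₂ : W} {X ν : W → Space} {q : W}

theorem diffX (h : IsLocalMCF Ω e₀ e₁ e₂ X ν) (hq : q ∈ Ω) : DifferentiableAt ℝ X q :=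
  h.smooth.diffAt h.isOpen (by simp) hq

theorem diffN (h : IsLocalMCF Ω e₀ e₁ e₂ X ν) (hq : q ∈ Ω) : DifferentiableAt ℝ ν q :=
  h.smooth_normal.diffAt h.isOpen (by simp) hq

theorem smooth_pd (h : IsLocalMCF Ω e₀ e₁ e₂ X ν) (v : W) : ContDiffOn ℝ ∞ (pd v X) Ω :=
  h.smooth.pd h.isOpen (m := ∞) le_rfl v

theorem diff_pd (h : IsLocalMCF Ω e₀ e₁ e₂ X ν) (hq : q ∈ Ω) (v : W) :
    DifferentiableAt ℝ (pd v X) q :=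
  (h.smooth_pd v).diffAt h.isOpen (by simp) hq

theorem diff_pd_pd (h : IsLocalMCF Ω e₀ e₁ e₂ X ν) (hq : q ∈ Ω) (v w : W) :
    DifferentiableAt ℝ (pd v (pd w X)) q :=
  ((h.smooth_pd w).pd h.isOpen (m := ∞) le_rfl v).diffAt h.isOpen (by simp) hq

theorem comm (h : IsLocalMCF Ω e₀ e₁ e₂ X ν) (hq : q ∈ Ω) (v w : W) :
    pd v (pd w X) q = pd w (pd v X) q :=
  pd_comm ((h.smooth.contDiffAt (h.isOpen.mem_nhds hq)).of_le two_le_infty) v w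

theorem comm₃ (h : IsLocalMCF Ω e₀ e₁ e₂ X ν) (hq : q ∈ Ω) (v w z : W) :
    pd v (pd w (pd z X)) q = pd w (pd z (pd v X)) q := by
  rw [pd_comm (((h.smooth_pd z).contDiffAt (h.isOpen.mem_nhds hq)).of_le two_le_infty) v w]
  exact pd_congr h.isOpen (fun x hx => h.comm hx v z) w hq

theorem smooth_gramDet (h : IsLocalMCF Ω e₀ e₁ e₂ X ν) :
    ContDiffOn ℝ ∞ (fun q => gramDet (pd e₁ X q) (pd e₂ X q)) Ω := by
  have h1 := h.smooth_pd e₁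
  have h2 := h.smooth_pd e₂
  exact ((h1.inner ℝ h1).mul (h2.inner ℝ h2)).sub ((h1.inner ℝ h2).pow 2)

theorem smooth_sff (h : IsLocalMCF Ω e₀ e₁ e₂ X ν) (v w : W) :
    ContDiffOn ℝ ∞ (sff X ν v w) Ω :=
  (((h.smooth_pd w).pd h.isOpen (m := ∞) le_rfl v).inner ℝ h.smooth_normal).neg

theorem smooth_curvH (h : IsLocalMCF Ω e₀ e₁ e₂ X ν) : ContDiffOn ℝ ∞ (curvH e₁ e₂ X ν) Ω := by
  have h1 := h.smooth_pd e₁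
  have h2 := h.smooth_pd e₂
  unfold curvH metricTrace
  refine ContDiffOn.div ?_ h.smooth_gramDet fun q hq => (h.gram_pos q hq).ne'
  exact ((((h2.inner ℝ h2)).mul (h.smooth_sff e₁ e₁)).sub
    ((contDiffOn_const.mul (h1.inner ℝ h2)).mul (h.smooth_sff e₁ e₂))).add
    ((h1.inner ℝ h1).mul (h.smooth_sff e₂ e₂))

theorem diffH (h : IsLocalMCF Ω e₀ e₁ e₂ X ν) (hq : q ∈ Ω) :
    DifferentiableAt ℝ (curvH e₁ e₂ X ν) q :=
  h.smooth_curvH.diffAt h.isOpen (by simp) hq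

theorem inner_normal_self (h : IsLocalMCF Ω e₀ e₁ e₂ X ν) (hq : q ∈ Ω) : ⟪ν q, ν q⟫ = 1 := by
  rw [real_inner_self_eq_norm_sq, h.norm_normal q hq]
  norm_num

theorem inner_pd_normal_normal (h : IsLocalMCF Ω e₀ e₁ e₂ X ν) (hq : q ∈ Ω) (v : W) :
    ⟪pd v ν q, ν q⟫ = 0 := by
  have h1 := pd_inner (h.diffN hq) (h.diffN hq) v
  rw [pd_congr h.isOpen (fun x hx => h.inner_normal_self hx) v hq, pd_const,
    real_inner_comm (pd v ν q) (ν q)] at h1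
  linarith

theorem inner_pd_pd_normal_normal (h : IsLocalMCF Ω e₀ e₁ e₂ X ν) (hq : q ∈ Ω) (v w : W) :
    ⟪pd v (pd w ν) q, ν q⟫ = -⟪pd v ν q, pd w ν q⟫ := by
  have hd : DifferentiableAt ℝ (pd w ν) q :=
    (h.smooth_normal.pd h.isOpen (m := ∞) (by simp) w).diffAt h.isOpen (by simp) hq
  have h1 := pd_inner hd (h.diffN hq) v
  rw [pd_congr h.isOpen (fun x hx => h.inner_pd_normal_normal hx w) v hq, pd_const,
    real_inner_comm (pd v ν q) (pd w ν q)] at h1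
  linarith

/-- The Weingarten equation: the tangential components of the derivative of the normal are the
coefficients of the second fundamental form. -/
theorem weingarten (h : IsLocalMCF Ω e₀ e₁ e₂ X ν) (hq : q ∈ Ω) (v : W) {w : W}
    (hw : w = e₁ ∨ w = e₂) : ⟪pd v ν q, pd w X q⟫ = sff X ν v w q := by
  have horth : ∀ x ∈ Ω, ⟪pd w X x, ν x⟫ = 0 := by
    rcases hw with rfl | rfl
    exacts [h.orth₁, h.orth₂]
  have h1 := pd_inner (h.diff_pd hq w) (h.diffN hq) v
  rw [pd_congr h.isOpen horth v hq, pd_const, real_inner_comm (pd v ν q) (pd w X q)] at h1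
  unfold sff
  linarith

theorem sff_comm (h : IsLocalMCF Ω e₀ e₁ e₂ X ν) (hq : q ∈ Ω) (v w : W) :
    sff X ν v w q = sff X ν w v q := by
  rw [sff, sff, h.comm hq]

theorem pd_velocity (h : IsLocalMCF Ω e₀ e₁ e₂ X ν) (hq : q ∈ Ω) (v : W) :
    pd v (pd e₀ X) q =
      -(pd v (curvH e₁ e₂ X ν) q • ν q + curvH e₁ e₂ X ν q • pd v ν q) := by
  have h1 : ∀ x ∈ Ω, pd e₀ X x = -(curvH e₁ e₂ X ν x • ν x) := fun x hx => by
    rw [h.evolves x hx, neg_smul]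
  rw [pd_congr h.isOpen h1 v hq, pd_neg, pd_smul (h.diffH hq) (h.diffN hq)]

theorem inner_pd_pd_velocity (h : IsLocalMCF Ω e₀ e₁ e₂ X ν) (hq : q ∈ Ω) (v w : W) :
    ⟪pd v (pd w (pd e₀ X)) q, ν q⟫ =
      -pd v (pd w (curvH e₁ e₂ X ν)) q + curvH e₁ e₂ X ν q * ⟪pd v ν q, pd w ν q⟫ := by
  have hHw : DifferentiableAt ℝ (pd w (curvH e₁ e₂ X ν)) q :=
    (h.smooth_curvH.pd h.isOpen (m := ∞) (by simp) w).diffAt h.isOpen (by simp) hq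
  have hNw : DifferentiableAt ℝ (pd w ν) q :=
    (h.smooth_normal.pd h.isOpen (m := ∞) (by simp) w).diffAt h.isOpen (by simp) hq
  rw [pd_congr h.isOpen (fun x hx => h.pd_velocity hx w) v hq, pd_neg,
    pd_add (hHw.fun_smul (h.diffN hq)) ((h.diffH hq).fun_smul hNw), pd_smul hHw (h.diffN hq),
    pd_smul (h.diffH hq) hNw]
  simp only [inner_neg_left, inner_add_left, inner_smul_left, conj_trivial,
    h.inner_normal_self hq, h.inner_pd_normal_normal hq, h.inner_pd_pd_normal_normal hq]
  ring

/-- The evolution of the metric: `∂ₜ gᵢⱼ = -2 H hᵢⱼ`. -/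
theorem pd_time_metric (h : IsLocalMCF Ω e₀ e₁ e₂ X ν) (hq : q ∈ Ω) {v w : W}
    (hv : v = e₁ ∨ v = e₂) (hw : w = e₁ ∨ w = e₂) :
    pd e₀ (fun x => ⟪pd v X x, pd w X x⟫) q = -2 * curvH e₁ e₂ X ν q * sff X ν v w q := by
  have horth : ∀ z, z = e₁ ∨ z = e₂ → ⟪ν q, pd z X q⟫ = 0 := by
    rintro z (rfl | rfl)
    · rw [real_inner_comm, h.orth₁ q hq]
    · rw [real_inner_comm, h.orth₂ q hq]
  rw [pd_inner (h.diff_pd hq v) (h.diff_pd hq w), h.comm hq e₀ v, h.comm hq e₀ w,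
    h.pd_velocity hq, h.pd_velocity hq, real_inner_comm _ (pd v X q)]
  simp only [inner_neg_left, inner_add_left, inner_smul_left, conj_trivial, horth v hv,
    horth w hw, h.weingarten hq _ hv, h.weingarten hq _ hw, h.sff_comm hq w v]
  ring

theorem inner_pd_time_normal (h : IsLocalMCF Ω e₀ e₁ e₂ X ν) (hq : q ∈ Ω) {w : W}
    (hw : w = e₁ ∨ w = e₂) : ⟪pd e₀ ν q, pd w X q⟫ = pd w (curvH e₁ e₂ X ν) q := by
  rw [h.weingarten hq e₀ hw, sff, h.comm hq, h.pd_velocity hq, inner_neg_left, inner_add_left,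
    inner_smul_left, inner_smul_left, h.inner_normal_self hq, h.inner_pd_normal_normal hq]
  simp

theorem inner_eq (h : IsLocalMCF Ω e₀ e₁ e₂ X ν) (hq : q ∈ Ω) (a b : Space) :
    ⟪a, b⟫ = dualInner (pd e₁ X q) (pd e₂ X q) ⟪a, pd e₁ X q⟫ ⟪a, pd e₂ X q⟫
      ⟪b, pd e₁ X q⟫ ⟪b, pd e₂ X q⟫ + ⟪a, ν q⟫ * ⟪b, ν q⟫ :=
  inner_eq_dualInner_add (h.gram_pos q hq) (h.norm_normal q hq) (h.orth₁ q hq) (h.orth₂ q hq) a b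

/-- The evolution of the second fundamental form: `∂ₜ h = ∇² H - H h²`. -/
theorem pd_time_sff (h : IsLocalMCF Ω e₀ e₁ e₂ X ν) (hq : q ∈ Ω) (v w : W) :
    pd e₀ (sff X ν v w) q = hess e₁ e₂ X (curvH e₁ e₂ X ν) v w q -
      curvH e₁ e₂ X ν q * ⟪pd v ν q, pd w ν q⟫ := by
  have h1 : pd e₀ (sff X ν v w) q = -pd e₀ (fun x => ⟪pd v (pd w X) x, ν x⟫) q := pd_neg _ _ _
  rw [h1, pd_inner (h.diff_pd_pd hq v w) (h.diffN hq), h.comm₃ hq e₀ v w,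
    h.inner_pd_pd_velocity hq, h.inner_eq hq (pd v (pd w X) q) (pd e₀ ν q),
    h.inner_pd_normal_normal hq, h.inner_pd_time_normal hq (Or.inl rfl),
    h.inner_pd_time_normal hq (Or.inr rfl), hess]
  ring

/-- The evolution of the squared area element: `∂ₜ det g = -2 H² det g`. -/
theorem pd_time_gramDet (h : IsLocalMCF Ω e₀ e₁ e₂ X ν) (hq : q ∈ Ω) :
    pd e₀ (fun x => gramDet (pd e₁ X x) (pd e₂ X x)) q =
      -2 * curvH e₁ e₂ X ν q ^ 2 * gramDet (pd e₁ X q) (pd e₂ X q) := by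
  have h1 := h.diff_pd hq e₁
  have h2 := h.diff_pd hq e₂
  have hD := (h.gram_pos q hq).ne'
  have i11 := h1.inner ℝ h1
  have i12 := h1.inner ℝ h2
  have i22 := h2.inner ℝ h2
  simp only [gramDet, pow_two]
  rw [pd_sub (i11.fun_mul i22) (i12.fun_mul i12), pd_mul i11 i22, pd_mul i12 i12,
    h.pd_time_metric hq (Or.inl rfl) (Or.inl rfl), h.pd_time_metric hq (Or.inl rfl) (Or.inr rfl),
    h.pd_time_metric hq (Or.inr rfl) (Or.inr rfl)]
  have hH : curvH e₁ e₂ X ν q * gramDet (pd e₁ X q) (pd e₂ X q) =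
      ⟪pd e₂ X q, pd e₂ X q⟫ * sff X ν e₁ e₁ q - 2 * ⟪pd e₁ X q, pd e₂ X q⟫ * sff X ν e₁ e₂ q +
        ⟪pd e₁ X q, pd e₁ X q⟫ * sff X ν e₂ e₂ q := by
    rw [curvH, metricTrace, div_mul_cancel₀ _ hD]
  simp only [gramDet, pow_two] at hH
  linear_combination (-2 * curvH e₁ e₂ X ν q) * (-1 : ℝ) * hH

/-- The evolution of the mean curvature, `(∂ₜ - Δ) H = |A|² H`, with the squared norm `|A|²` of
the second fundamental form written as that of the differential of the normal. -/
theorem heat_curvH (h : IsLocalMCF Ω e₀ e₁ e₂ X ν) (hq : q ∈ Ω) :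
    heat e₀ e₁ e₂ X (curvH e₁ e₂ X ν) q =
      metricTrace (pd e₁ X q) (pd e₂ X q) ⟪pd e₁ ν q, pd e₁ ν q⟫ ⟪pd e₁ ν q, pd e₂ ν q⟫
        ⟪pd e₂ ν q, pd e₂ ν q⟫ * curvH e₁ e₂ X ν q := by
  have h1 := h.diff_pd hq e₁
  have h2 := h.diff_pd hq e₂
  have hD := (h.gram_pos q hq).ne'
  have i11 := h1.inner ℝ h1
  have i12 := h1.inner ℝ h2
  have i22 := h2.inner ℝ h2
  have s11 : DifferentiableAt ℝ (sff X ν e₁ e₁) q :=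
    (h.smooth_sff e₁ e₁).diffAt h.isOpen (by simp) hq
  have s12 : DifferentiableAt ℝ (sff X ν e₁ e₂) q :=
    (h.smooth_sff e₁ e₂).diffAt h.isOpen (by simp) hq
  have s22 : DifferentiableAt ℝ (sff X ν e₂ e₂) q :=
    (h.smooth_sff e₂ e₂).diffAt h.isOpen (by simp) hq
  have sD : DifferentiableAt ℝ (fun x => gramDet (pd e₁ X x) (pd e₂ X x)) q :=
    h.smooth_gramDet.diffAt h.isOpen (by simp) hq
  -- The definition of `H` without its denominator; its derivative in time is `key`.
  have hH : ∀ x ∈ Ω, curvH e₁ e₂ X ν x * gramDet (pd e₁ X x) (pd e₂ X x) =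
      ⟪pd e₂ X x, pd e₂ X x⟫ * sff X ν e₁ e₁ x - 2 * (⟪pd e₁ X x, pd e₂ X x⟫ * sff X ν e₁ e₂ x) +
        ⟪pd e₁ X x, pd e₁ X x⟫ * sff X ν e₂ e₂ x := fun x hx => by
    rw [curvH, metricTrace, div_mul_cancel₀ _ (h.gram_pos x hx).ne']
    ring
  have key := pd_congr h.isOpen hH e₀ hq
  rw [pd_mul (h.diffH hq) sD, h.pd_time_gramDet hq,
    pd_add ((i22.fun_mul s11).fun_sub ((differentiableAt_const 2).fun_mul (i12.fun_mul s12)))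
      (i11.fun_mul s22),
    pd_sub (i22.fun_mul s11) ((differentiableAt_const 2).fun_mul (i12.fun_mul s12)),
    pd_const_mul 2 (i12.fun_mul s12), pd_mul i22 s11, pd_mul i12 s12, pd_mul i11 s22,
    h.pd_time_metric hq (Or.inl rfl) (Or.inl rfl), h.pd_time_metric hq (Or.inl rfl) (Or.inr rfl),
    h.pd_time_metric hq (Or.inr rfl) (Or.inr rfl), h.pd_time_sff hq, h.pd_time_sff hq,
    h.pd_time_sff hq] at key
  have hHq := hH q hq
  have w1 : ∀ v w : W, ⟪pd v ν q, pd w ν q⟫ = dualInner (pd e₁ X q) (pd e₂ X q)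
      (sff X ν v e₁ q) (sff X ν v e₂ q) (sff X ν w e₁ q) (sff X ν w e₂ q) := by
    intro v w
    rw [h.inner_eq hq, h.inner_pd_normal_normal hq, h.weingarten hq _ (Or.inl rfl),
      h.weingarten hq _ (Or.inr rfl), h.weingarten hq _ (Or.inl rfl),
      h.weingarten hq _ (Or.inr rfl)]
    ring
  simp only [heat, lap, metricTrace, w1, dualInner] at key ⊢
  rw [h.sff_comm hq e₂ e₁] at key ⊢
  have hDe : gramDet (pd e₁ X q) (pd e₂ X q) =
    ⟪pd e₁ X q, pd e₁ X q⟫ * ⟪pd e₂ X q, pd e₂ X q⟫ - ⟪pd e₁ X q, pd e₂ X q⟫ ^ 2 := rfl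
  generalize gramDet (pd e₁ X q) (pd e₂ X q) = D at *
  generalize ⟪pd e₁ X q, pd e₁ X q⟫ = E at *
  generalize ⟪pd e₁ X q, pd e₂ X q⟫ = F at *
  generalize ⟪pd e₂ X q, pd e₂ X q⟫ = G at *
  generalize hess e₁ e₂ X (curvH e₁ e₂ X ν) e₁ e₁ q = A11 at *
  generalize hess e₁ e₂ X (curvH e₁ e₂ X ν) e₁ e₂ q = A12 at *
  generalize hess e₁ e₂ X (curvH e₁ e₂ X ν) e₂ e₂ q = A22 at *
  generalize pd e₀ (curvH e₁ e₂ X ν) q = H' at *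
  generalize curvH e₁ e₂ X ν q = H at *
  generalize sff X ν e₁ e₁ q = a at *
  generalize sff X ν e₁ e₂ q = b at *
  generalize sff X ν e₂ e₂ q = c at *
  -- With `|A|² = H² - 2 det h / det g`, the identity of Cayley and Hamilton, what is left is
  -- linear in `key`.
  have hk : G * ((G * (a * a) - F * (a * b + b * a) + E * (b * b)) / D) -
      2 * F * ((G * (a * b) - F * (a * c + b * b) + E * (b * c)) / D) +
      E * ((G * (b * b) - F * (b * c + c * b) + E * (c * c)) / D) =
      H ^ 2 * D - 2 * (a * c - b ^ 2) := by
    field_simp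
    linear_combination (-(H * D) - (G * a - 2 * (F * b) + E * c)) * hHq +
      2 * (a * c - b ^ 2) * hDe
  rw [hk, sub_eq_iff_eq_add, div_mul_eq_mul_div, ← add_div, eq_div_iff hD]
  linear_combination key - H * hk

end IsLocalMCF

end LocalFlow

/-! ### The cube of the positive part, and the divergence form of the Laplacian -/

theorem hasDerivAt_posPart_pow (n : ℕ) (x : ℝ) :
    HasDerivAt (fun y : ℝ => max y 0 ^ (n + 2)) ((n + 2) * max x 0 ^ (n + 1)) x := by
  rcases lt_trichotomy x 0 with hx | rfl | hx
  · have h : (fun y : ℝ => max y 0 ^ (n + 2)) =ᶠ[𝓝 x] fun _ => 0 := by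
      filter_upwards [gt_mem_nhds hx] with y hy
      rw [max_eq_right (le_of_lt hy)]
      simp
    rw [max_eq_right hx.le]
    simpa using (hasDerivAt_const x (0 : ℝ)).congr_of_eventuallyEq h
  · have : HasDerivAt (fun y : ℝ => max y 0 ^ (n + 2)) 0 0 := by
      rw [hasDerivAt_iff_isLittleO_nhds_zero]
      refine Asymptotics.IsBigO.trans_isLittleO (g := fun h : ℝ => h ^ (n + 2)) ?_ ?_
      · refine Asymptotics.IsBigO.of_bound 1 (Eventually.of_forall fun h => ?_)
        simp only [zero_add, max_self, smul_zero, sub_zero, one_mul, norm_pow, Real.norm_eq_abs]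
        rw [zero_pow (by omega), sub_zero]
        rw [abs_pow, abs_of_nonneg (le_max_right h 0)]
        gcongr
        exact max_le (le_abs_self h) (abs_nonneg h)
      · simpa using Asymptotics.isLittleO_pow_id (𝕜 := ℝ) (n := n + 2) (by omega)
    simpa using this
  · have h : (fun y : ℝ => max y 0 ^ (n + 2)) =ᶠ[𝓝 x] fun y => y ^ (n + 2) := by
      filter_upwards [lt_mem_nhds hx] with y hy
      rw [max_eq_left (le_of_lt hy)]
    rw [max_eq_left hx.le]
    simpa using (hasDerivAt_pow (n + 2) x).congr_of_eventuallyEq h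

theorem deriv_posPart_cube :
    deriv (fun y : ℝ => max y 0 ^ 3) = fun y => 3 * max y 0 ^ 2 := by
  ext x
  rw [(hasDerivAt_posPart_pow 1 x).deriv]
  norm_num

theorem deriv_deriv_posPart_cube :
    deriv (deriv fun y : ℝ => max y 0 ^ 3) = fun y => 6 * max y 0 := by
  rw [deriv_posPart_cube]
  ext x
  rw [((hasDerivAt_posPart_pow 0 x).const_mul 3).deriv]
  norm_num
  ring

theorem contDiff_posPart_cube : ContDiff ℝ 2 fun y : ℝ => max y 0 ^ 3 := by
  have h1 : Differentiable ℝ fun y : ℝ => max y 0 ^ 3 := fun x =>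
    (hasDerivAt_posPart_pow 1 x).differentiableAt
  have h2 : Differentiable ℝ fun y : ℝ => 3 * max y 0 ^ 2 := fun x =>
    ((hasDerivAt_posPart_pow 0 x).const_mul 3).differentiableAt
  have : ContDiff ℝ (1 + 1) fun y : ℝ => max y 0 ^ 3 := by
    rw [contDiff_succ_iff_deriv]
    refine ⟨h1, by simp, ?_⟩
    have : ContDiff ℝ (0 + 1) (deriv fun y : ℝ => max y 0 ^ 3) := by
      rw [contDiff_succ_iff_deriv, deriv_deriv_posPart_cube]
      refine ⟨by rw [deriv_posPart_cube]; exact h2, by simp, ?_⟩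
      rw [contDiff_zero]
      fun_prop
    simpa using this
  have e : (1 + 1 : WithTop ℕ∞) = 2 := by norm_num
  rwa [e] at this

section LocalFlow

variable {W : Type*} [NormedAddCommGroup W] [NormedSpace ℝ W]

/-- The first component of the density-weighted gradient field `√g gⁱʲ ∂ⱼ u`. -/
def flux₁ (e₁ e₂ : W) (X : W → Space) (u : W → ℝ) (q : W) : ℝ :=
  (⟪pd e₂ X q, pd e₂ X q⟫ * pd e₁ u q - ⟪pd e₁ X q, pd e₂ X q⟫ * pd e₂ u q) /
    √(gramDet (pd e₁ X q) (pd e₂ X q))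

/-- The second component of the density-weighted gradient field `√g gⁱʲ ∂ⱼ u`. -/
def flux₂ (e₁ e₂ : W) (X : W → Space) (u : W → ℝ) (q : W) : ℝ :=
  (⟪pd e₁ X q, pd e₁ X q⟫ * pd e₂ u q - ⟪pd e₁ X q, pd e₂ X q⟫ * pd e₁ u q) /
    √(gramDet (pd e₁ X q) (pd e₂ X q))

namespace IsLocalMCF

variable {Ω : Set W} {e₀ e₁ e₂ : W} {X ν : W → Space} {q : W} {u w : W → ℝ}

theorem smooth_sqrt_gramDet (h : IsLocalMCF Ω e₀ e₁ e₂ X ν) :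
    ContDiffOn ℝ ∞ (fun q => √(gramDet (pd e₁ X q) (pd e₂ X q))) Ω :=
  h.smooth_gramDet.sqrt fun q hq => (h.gram_pos q hq).ne'

theorem smooth_flux₁ (h : IsLocalMCF Ω e₀ e₁ e₂ X ν) (hu : ContDiffOn ℝ 2 u Ω) :
    ContDiffOn ℝ 1 (flux₁ e₁ e₂ X u) Ω := by
  have h1 := (h.smooth_pd e₁).of_le (m := 1) (by simp)
  have h2 := (h.smooth_pd e₂).of_le (m := 1) (by simp)
  refine ContDiffOn.div ?_ (h.smooth_sqrt_gramDet.of_le (by simp))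
    fun q hq => (Real.sqrt_pos.2 (h.gram_pos q hq)).ne'
  exact ((h2.inner ℝ h2).mul (hu.pd h.isOpen (by norm_num) e₁)).sub
    ((h1.inner ℝ h2).mul (hu.pd h.isOpen (by norm_num) e₂))

theorem smooth_flux₂ (h : IsLocalMCF Ω e₀ e₁ e₂ X ν) (hu : ContDiffOn ℝ 2 u Ω) :
    ContDiffOn ℝ 1 (flux₂ e₁ e₂ X u) Ω := by
  have h1 := (h.smooth_pd e₁).of_le (m := 1) (by simp)
  have h2 := (h.smooth_pd e₂).of_le (m := 1) (by simp)
  refine ContDiffOn.div ?_ (h.smooth_sqrt_gramDet.of_le (by simp))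
    fun q hq => (Real.sqrt_pos.2 (h.gram_pos q hq)).ne'
  exact ((h1.inner ℝ h1).mul (hu.pd h.isOpen (by norm_num) e₂)).sub
    ((h1.inner ℝ h2).mul (hu.pd h.isOpen (by norm_num) e₁))

/-- The Laplacian in divergence form: `∂ᵢ(√g gⁱʲ ∂ⱼ u) = √g Δ u`. -/
theorem divergence_flux (h : IsLocalMCF Ω e₀ e₁ e₂ X ν) (hq : q ∈ Ω)
    (hu : ContDiffOn ℝ 2 u Ω) :
    pd e₁ (flux₁ e₁ e₂ X u) q + pd e₂ (flux₂ e₁ e₂ X u) q =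
      √(gramDet (pd e₁ X q) (pd e₂ X q)) * lap e₁ e₂ X u q := by
  set S : W → ℝ := fun q => √(gramDet (pd e₁ X q) (pd e₂ X q)) with hS
  have h1 := h.diff_pd hq e₁
  have h2 := h.diff_pd hq e₂
  have i11 := h1.inner ℝ h1
  have i12 := h1.inner ℝ h2
  have i22 := h2.inner ℝ h2
  -- The fluxes and the root `S = √g` satisfy polynomial relations without denominators, which are
  -- differentiated instead of the quotients.
  have hSp : ∀ x ∈ Ω, 0 < S x := fun x hx => Real.sqrt_pos.2 (h.gram_pos x hx)
  have hSS : ∀ x ∈ Ω, S x * S x = ⟪pd e₁ X x, pd e₁ X x⟫ * ⟪pd e₂ X x, pd e₂ X x⟫ -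
      ⟪pd e₁ X x, pd e₂ X x⟫ * ⟪pd e₁ X x, pd e₂ X x⟫ := fun x hx => by
    rw [hS, Real.mul_self_sqrt (h.gram_pos x hx).le, gramDet, pow_two]
  have sS : DifferentiableAt ℝ S q := h.smooth_sqrt_gramDet.diffAt h.isOpen (by simp) hq
  have u1 : DifferentiableAt ℝ (pd e₁ u) q :=
    (hu.pd (m := 1) h.isOpen (by norm_num) e₁).diffAt h.isOpen one_ne_zero hq
  have u2 : DifferentiableAt ℝ (pd e₂ u) q :=
    (hu.pd (m := 1) h.isOpen (by norm_num) e₂).diffAt h.isOpen one_ne_zero hq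
  have f1 := (h.smooth_flux₁ hu).diffAt h.isOpen one_ne_zero hq
  have f2 := (h.smooth_flux₂ hu).diffAt h.isOpen one_ne_zero hq
  have k1 : ∀ x ∈ Ω, flux₁ e₁ e₂ X u x * S x =
      ⟪pd e₂ X x, pd e₂ X x⟫ * pd e₁ u x - ⟪pd e₁ X x, pd e₂ X x⟫ * pd e₂ u x := fun x hx =>
    div_mul_cancel₀ _ (hSp x hx).ne'
  have k2 : ∀ x ∈ Ω, flux₂ e₁ e₂ X u x * S x =
      ⟪pd e₁ X x, pd e₁ X x⟫ * pd e₂ u x - ⟪pd e₁ X x, pd e₂ X x⟫ * pd e₁ u x := fun x hx =>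
    div_mul_cancel₀ _ (hSp x hx).ne'
  have d1 := pd_congr h.isOpen k1 e₁ hq
  have d2 := pd_congr h.isOpen k2 e₂ hq
  have dS1 := pd_congr h.isOpen hSS e₁ hq
  have dS2 := pd_congr h.isOpen hSS e₂ hq
  rw [pd_mul f1 sS, pd_sub (i22.fun_mul u1) (i12.fun_mul u2), pd_mul i22 u1, pd_mul i12 u2,
    pd_inner h2 h2, pd_inner h1 h2] at d1
  rw [pd_mul f2 sS, pd_sub (i11.fun_mul u2) (i12.fun_mul u1), pd_mul i11 u2, pd_mul i12 u1,
    pd_inner h1 h1, pd_inner h1 h2] at d2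
  rw [pd_mul sS sS, pd_sub (i11.fun_mul i22) (i12.fun_mul i12), pd_mul i11 i22, pd_mul i12 i12,
    pd_inner h1 h1, pd_inner h2 h2, pd_inner h1 h2] at dS1 dS2
  have c := h.comm hq e₂ e₁
  have cu := pd_comm (hu.contDiffAt (h.isOpen.mem_nhds hq)) e₂ e₁
  have hk1 := k1 q hq
  have hk2 := k2 q hq
  have hSq := hSS q hq
  have hSqp := hSp q hq
  have hD : gramDet (pd e₁ X q) (pd e₂ X q) = S q * S q := by
    rw [hSq, gramDet, pow_two]
  rw [c] at d2 dS2
  rw [cu] at d2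
  simp only [lap, hess, metricTrace, dualInner, hD, Real.sqrt_mul_self hSqp.le]
  simp only [real_inner_comm (pd e₁ (pd e₁ X) q) (pd e₁ X q),
    real_inner_comm (pd e₁ (pd e₂ X) q) (pd e₁ X q),
    real_inner_comm (pd e₁ (pd e₂ X) q) (pd e₂ X q),
    real_inner_comm (pd e₂ (pd e₂ X) q) (pd e₂ X q),
    real_inner_comm (pd e₂ (pd e₂ X) q) (pd e₁ X q)] at *
  generalize ⟪pd e₁ X q, pd e₁ X q⟫ = E at *
  generalize ⟪pd e₁ X q, pd e₂ X q⟫ = F at *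
  generalize ⟪pd e₂ X q, pd e₂ X q⟫ = G at *
  generalize ⟪pd e₁ (pd e₁ X) q, pd e₁ X q⟫ = a1 at *
  generalize ⟪pd e₁ (pd e₁ X) q, pd e₂ X q⟫ = a2 at *
  generalize ⟪pd e₁ (pd e₂ X) q, pd e₁ X q⟫ = b1 at *
  generalize ⟪pd e₁ (pd e₂ X) q, pd e₂ X q⟫ = b2 at *
  generalize ⟪pd e₂ (pd e₂ X) q, pd e₁ X q⟫ = c1 at *
  generalize ⟪pd e₂ (pd e₂ X) q, pd e₂ X q⟫ = c2 at *
  generalize pd e₁ S q = S1 at *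
  generalize pd e₂ S q = S2 at *
  generalize S q = s at *
  generalize pd e₁ (flux₁ e₁ e₂ X u) q = Y1 at *
  generalize pd e₂ (flux₂ e₁ e₂ X u) q = Y2 at *
  generalize flux₁ e₁ e₂ X u q = y1 at *
  generalize flux₂ e₁ e₂ X u q = y2 at *
  generalize pd e₁ (pd e₁ u) q = u11 at *
  generalize pd e₁ (pd e₂ u) q = u12 at *
  generalize pd e₂ (pd e₂ u) q = u22 at *
  generalize pd e₁ u q = v1 at *
  generalize pd e₂ u q = v2 at *
  clear_value S
  field_simp
  linear_combination s ^ 2 * d1 + s ^ 2 * d2 - s * S1 * hk1 - s * S2 * hk2 -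
    (G * v1 - F * v2) / 2 * dS1 - (E * v2 - F * v1) / 2 * dS2 +
    ((b2 + b2) * v1 - (a2 + b1) * v2 + (b1 + b1) * v2 - (b2 + c1) * v1) * hSq

end IsLocalMCF

end LocalFlow

/-! ### The barrier, the backward heat kernel and the local monotonicity formula -/

section LocalFlow

variable {W : Type*} [NormedAddCommGroup W] [NormedSpace ℝ W]

/-- The squared distance of the moving surface from the point `p`. -/
def sqDist (X : W → Space) (p : Space) (q : W) : ℝ := ⟪X q - p, X q - p⟫

/-- The logarithm, up to the constant `-log (4π)`, of the backward heat kernel centred at `(p, t₀)`,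
restricted to the moving surface; `T` is the time function. -/
def logKernel (X : W → Space) (T : W →L[ℝ] ℝ) (p : Space) (t₀ : ℝ) (q : W) : ℝ :=
  -Real.log (t₀ - T q) - (4 * (t₀ - T q))⁻¹ * sqDist X p q

/-- The function `e^{-cH} - δ (|x - p|² + 4 (t - a))`, a subsolution of the heat equation on a mean
convex mean curvature flow, whose positive part has compact support. -/
def barrier (H : W → ℝ) (X : W → Space) (T : W →L[ℝ] ℝ) (p : Space) (a c δ : ℝ) (q : W) : ℝ :=
  Real.exp (-c * H q) - δ * (sqDist X p q - -4 * (T q - a))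

theorem pd_comp_clm {β : ℝ → ℝ} {β' : ℝ} {T : W →L[ℝ] ℝ} {q : W} (hβ : HasDerivAt β β' (T q))
    (v : W) : pd v (fun x => β (T x)) q = β' * T v := by
  rw [pd_comp hβ T.differentiableAt]
  simp [pd]

namespace IsLocalMCF

variable {Ω : Set W} {e₀ e₁ e₂ : W} {X ν : W → Space} {q : W} {u w : W → ℝ}
  {T : W →L[ℝ] ℝ} {p : Space} {t₀ : ℝ}

theorem smooth_sqDist (h : IsLocalMCF Ω e₀ e₁ e₂ X ν) (p : Space) :
    ContDiffOn ℝ ∞ (sqDist X p) Ω :=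
  (h.smooth.sub contDiffOn_const).inner ℝ (h.smooth.sub contDiffOn_const)

theorem pd_sqDist (h : IsLocalMCF Ω e₀ e₁ e₂ X ν) (hq : q ∈ Ω) (v : W) :
    pd v (sqDist X p) q = 2 * ⟪X q - p, pd v X q⟫ := by
  have hd : DifferentiableAt ℝ (fun x => X x - p) q := (h.diffX hq).sub_const p
  have e : pd v (fun x => X x - p) q = pd v X q := by
    rw [pd_sub (h.diffX hq) (differentiableAt_const p), pd_const, sub_zero]
  change pd v (fun x => ⟪X x - p, X x - p⟫) q = _
  rw [pd_inner hd hd, e, real_inner_comm (pd v X q)]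
  ring

theorem pd_pd_sqDist (h : IsLocalMCF Ω e₀ e₁ e₂ X ν) (hq : q ∈ Ω) (v w : W) :
    pd v (pd w (sqDist X p)) q =
      2 * ⟪pd v (pd w X) q, X q - p⟫ + 2 * ⟪pd v X q, pd w X q⟫ := by
  have hd : DifferentiableAt ℝ (fun x => X x - p) q := (h.diffX hq).sub_const p
  have e : pd v (fun x => X x - p) q = pd v X q := by
    rw [pd_sub (h.diffX hq) (differentiableAt_const p), pd_const, sub_zero]
  rw [pd_congr h.isOpen (fun x hx => h.pd_sqDist hx w) v hq,
    pd_const_mul 2 (hd.inner ℝ (h.diff_pd hq w)), pd_inner hd (h.diff_pd hq w), e,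
    real_inner_comm (pd v (pd w X) q)]
  ring

theorem hess_sqDist (h : IsLocalMCF Ω e₀ e₁ e₂ X ν) (hq : q ∈ Ω) (v w : W) :
    hess e₁ e₂ X (sqDist X p) v w q =
      2 * ⟪pd v X q, pd w X q⟫ - 2 * sff X ν v w q * ⟪X q - p, ν q⟫ := by
  rw [hess, h.pd_pd_sqDist hq, h.inner_eq hq (pd v (pd w X) q) (X q - p), h.pd_sqDist hq,
    h.pd_sqDist hq, sff]
  simp only [dualInner]
  ring

theorem lap_sqDist (h : IsLocalMCF Ω e₀ e₁ e₂ X ν) (hq : q ∈ Ω) :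
    lap e₁ e₂ X (sqDist X p) q = 4 - 2 * curvH e₁ e₂ X ν q * ⟪X q - p, ν q⟫ := by
  have hD := (h.gram_pos q hq).ne'
  rw [lap, h.hess_sqDist hq, h.hess_sqDist hq, h.hess_sqDist hq, curvH]
  simp only [metricTrace]
  field_simp
  simp only [gramDet]
  ring

theorem pd_time_sqDist (h : IsLocalMCF Ω e₀ e₁ e₂ X ν) (hq : q ∈ Ω) :
    pd e₀ (sqDist X p) q = -2 * curvH e₁ e₂ X ν q * ⟪X q - p, ν q⟫ := by
  rw [h.pd_sqDist hq, h.evolves q hq, inner_smul_right]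
  ring

/-- On a mean curvature flow, `(∂ₜ - Δ) |x - p|² = -4`. -/
theorem heat_sqDist (h : IsLocalMCF Ω e₀ e₁ e₂ X ν) (hq : q ∈ Ω) :
    heat e₀ e₁ e₂ X (sqDist X p) q = -4 := by
  rw [heat, h.lap_sqDist hq, h.pd_time_sqDist hq]
  ring

theorem gradInnerLoc_sqDist (h : IsLocalMCF Ω e₀ e₁ e₂ X ν) (hq : q ∈ Ω) :
    gradInnerLoc e₁ e₂ X (sqDist X p) (sqDist X p) q =
      4 * (sqDist X p q - ⟪X q - p, ν q⟫ ^ 2) := by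
  rw [sqDist, h.inner_eq hq (X q - p) (X q - p), gradInnerLoc, h.pd_sqDist hq, h.pd_sqDist hq]
  simp only [dualInner]
  ring

theorem heat_time (h : IsLocalMCF Ω e₀ e₁ e₂ X ν) (hq : q ∈ Ω) (h0 : T e₀ = 1) (h1 : T e₁ = 0)
    (h2 : T e₂ = 0) (a : ℝ) : heat e₀ e₁ e₂ X (fun x => T x - a) q = 1 := by
  have hv : ∀ v x, pd v (fun x => T x - a) x = T v := fun v x => by
    rw [pd_comp_clm (β := fun y => y - a) ((hasDerivAt_id _).sub_const a), one_mul]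
  have hvw : ∀ v w, pd v (pd w fun x => T x - a) q = 0 := fun v w => by
    rw [pd_congr h.isOpen (fun x _ => hv w x) v hq, pd_const]
  simp [heat, lap, hess, hv, hvw, h0, h1, h2, metricTrace, dualInner]

theorem smooth_barrier (h : IsLocalMCF Ω e₀ e₁ e₂ X ν) (a c δ : ℝ) :
    ContDiffOn ℝ ∞ (barrier (curvH e₁ e₂ X ν) X T p a c δ) Ω := by
  refine ContDiffOn.sub ?_ ?_
  · exact (contDiffOn_const.mul h.smooth_curvH).exp
  · exact contDiffOn_const.mul ((h.smooth_sqDist p).sub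
      (contDiffOn_const.mul (T.contDiff.contDiffOn.sub contDiffOn_const)))

/-- The barrier is a subsolution: `(∂ₜ - Δ) e^{-cH} = -c |A|² H e^{-cH} - c² |∇H|² e^{-cH}`, and
the subtracted term solves the heat equation. -/
theorem heat_barrier_nonpos (h : IsLocalMCF Ω e₀ e₁ e₂ X ν) (hq : q ∈ Ω) (h0 : T e₀ = 1)
    (h1 : T e₁ = 0) (h2 : T e₂ = 0) (hH : 0 ≤ curvH e₁ e₂ X ν q) (a δ : ℝ) {c : ℝ} (hc : 0 ≤ c) :
    heat e₀ e₁ e₂ X (barrier (curvH e₁ e₂ X ν) X T p a c δ) q ≤ 0 := by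
  have hβ : ContDiff ℝ 2 fun y : ℝ => Real.exp (-c * y) := by fun_prop
  have hH2 : ContDiffOn ℝ 2 (curvH e₁ e₂ X ν) Ω := h.smooth_curvH.of_le two_le_infty
  have hY2 : ContDiffOn ℝ 2 (sqDist X p) Ω := (h.smooth_sqDist p).of_le two_le_infty
  have hT2 : ContDiffOn ℝ 2 (fun x => T x - a) Ω := T.contDiff.contDiffOn.sub contDiffOn_const
  have d1 : deriv (fun y : ℝ => Real.exp (-c * y)) = fun y => -c * Real.exp (-c * y) := by
    ext y
    have := ((hasDerivAt_id y).const_mul (-c)).exp.deriv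
    simp only [id, mul_one] at this
    rw [this]
    ring
  have d2 : deriv (deriv fun y : ℝ => Real.exp (-c * y)) = fun y => c ^ 2 * Real.exp (-c * y) := by
    rw [d1]
    ext y
    have := (((hasDerivAt_id y).const_mul (-c)).exp.const_mul (-c)).deriv
    simp only [id, mul_one] at this
    rw [this]
    ring
  unfold barrier
  rw [heat_sub_const_mul (u := fun x => Real.exp (-c * curvH e₁ e₂ X ν x)) h.isOpen
    (hβ.comp_contDiffOn hH2) (hY2.sub (contDiffOn_const.mul hT2)) hq,
    heat_sub_const_mul h.isOpen hY2 hT2 hq, h.heat_sqDist hq, h.heat_time hq h0 h1 h2,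
    heat_comp (β := fun y => Real.exp (-c * y)) hβ h.isOpen hH2 hq, h.heat_curvH hq, d2, d1]
  have i1 := metricTrace_gram_nonneg (h.gram_pos q hq) (pd e₁ ν q) (pd e₂ ν q)
  have i2 : 0 ≤ gradInnerLoc e₁ e₂ X (curvH e₁ e₂ X ν) (curvH e₁ e₂ X ν) q :=
    dualInner_self_nonneg (h.gram_pos q hq) _ _
  have j1 := mul_nonneg (mul_nonneg hc (Real.exp_pos (-c * curvH e₁ e₂ X ν q)).le)
    (mul_nonneg i1 hH)
  have j2 := mul_nonneg (mul_nonneg (sq_nonneg c) (Real.exp_pos (-c * curvH e₁ e₂ X ν q)).le) i2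
  linarith

/-- The cube of the positive part of a subsolution of the heat equation is a subsolution. -/
theorem heat_posPart_cube_nonpos (h : IsLocalMCF Ω e₀ e₁ e₂ X ν) (hq : q ∈ Ω)
    (hu : ContDiffOn ℝ 2 u Ω) (hu0 : heat e₀ e₁ e₂ X u q ≤ 0) :
    heat e₀ e₁ e₂ X (fun x => max (u x) 0 ^ 3) q ≤ 0 := by
  rw [heat_comp contDiff_posPart_cube h.isOpen hu hq, deriv_deriv_posPart_cube,
    deriv_posPart_cube]
  have i2 : 0 ≤ gradInnerLoc e₁ e₂ X u u q := dualInner_self_nonneg (h.gram_pos q hq) _ _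
  have j1 : 0 ≤ max (u q) 0 := le_max_right _ _
  have j2 := mul_nonneg (mul_nonneg (by norm_num : (0 : ℝ) ≤ 6) j1) i2
  have j3 := mul_nonneg (mul_nonneg (by norm_num : (0 : ℝ) ≤ 3) (sq_nonneg (max (u q) 0)))
    (neg_nonneg.2 hu0)
  linarith

theorem smooth_logKernel (h : IsLocalMCF Ω e₀ e₁ e₂ X ν) (hT : ∀ q ∈ Ω, T q < t₀) :
    ContDiffOn ℝ ∞ (logKernel X T p t₀) Ω := by
  have hs : ContDiffOn ℝ ∞ (fun q => t₀ - T q) Ω := contDiffOn_const.sub T.contDiff.contDiffOn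
  have hne : ∀ q ∈ Ω, t₀ - T q ≠ 0 := fun q hq => (sub_pos.2 (hT q hq)).ne'
  refine (hs.log hne).neg.sub ?_
  exact ((contDiffOn_const.mul hs).inv fun q hq => mul_ne_zero four_ne_zero (hne q hq)).mul
    (h.smooth_sqDist p)

theorem pd_logKernel (h : IsLocalMCF Ω e₀ e₁ e₂ X ν) (hq : q ∈ Ω) (hT : T q < t₀) (v : W) :
    pd v (logKernel X T p t₀) q = (t₀ - T q)⁻¹ * T v -
      (4⁻¹ * ((t₀ - T q) ^ 2)⁻¹ * T v * sqDist X p q +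
        (4 * (t₀ - T q))⁻¹ * pd v (sqDist X p) q) := by
  have hne : t₀ - T q ≠ 0 := (sub_pos.2 hT).ne'
  have hd : HasDerivAt (fun y : ℝ => t₀ - y) (-1) (T q) := by
    simpa using (hasDerivAt_id (T q)).const_sub t₀
  have b1 : HasDerivAt (fun y : ℝ => -Real.log (t₀ - y)) (t₀ - T q)⁻¹ (T q) := by
    refine (hd.log hne).neg.congr_deriv ?_
    rw [neg_div, neg_neg, one_div]
  have b2 : HasDerivAt (fun y : ℝ => (4 * (t₀ - y))⁻¹) (4⁻¹ * ((t₀ - T q) ^ 2)⁻¹) (T q) := by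
    refine ((hd.const_mul 4).inv (mul_ne_zero four_ne_zero hne)).congr_deriv ?_
    rw [mul_pow]
    field_simp
  have hY : DifferentiableAt ℝ (sqDist X p) q := (h.smooth_sqDist p).diffAt h.isOpen (by simp) hq
  have c1 : DifferentiableAt ℝ (fun x => -Real.log (t₀ - T x)) q :=
    b1.differentiableAt.comp (f := T) q T.differentiableAt
  have c2 : DifferentiableAt ℝ (fun x => (4 * (t₀ - T x))⁻¹) q :=
    b2.differentiableAt.comp (f := T) q T.differentiableAt
  unfold logKernel
  rw [pd_sub c1 (c2.fun_mul hY), pd_mul c2 hY, pd_comp_clm b1, pd_comp_clm b2]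

theorem lap_logKernel (h : IsLocalMCF Ω e₀ e₁ e₂ X ν) (hq : q ∈ Ω) (hT : ∀ q ∈ Ω, T q < t₀)
    (h1 : T e₁ = 0) (h2 : T e₂ = 0) :
    lap e₁ e₂ X (logKernel X T p t₀) q =
      -(4 * (t₀ - T q))⁻¹ * lap e₁ e₂ X (sqDist X p) q := by
  have hv : ∀ v, T v = 0 → ∀ x ∈ Ω, pd v (logKernel X T p t₀) x =
      -(4 * (t₀ - T x))⁻¹ * pd v (sqDist X p) x := fun v hv x hx => by
    rw [h.pd_logKernel hx (hT x hx), hv]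
    ring
  have hvw : ∀ v w, T v = 0 → T w = 0 → pd v (pd w (logKernel X T p t₀)) q =
      -(4 * (t₀ - T q))⁻¹ * pd v (pd w (sqDist X p)) q := fun v w hv0 hw0 => by
    have hne : t₀ - T q ≠ 0 := (sub_pos.2 (hT q hq)).ne'
    have b2 : DifferentiableAt ℝ (fun y : ℝ => -(4 * (t₀ - y))⁻¹) (T q) := by
      refine DifferentiableAt.fun_neg (DifferentiableAt.fun_inv (by fun_prop) ?_)
      exact mul_ne_zero four_ne_zero hne
    have c2 : DifferentiableAt ℝ (fun x => -(4 * (t₀ - T x))⁻¹) q :=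
      b2.comp (f := T) q T.differentiableAt
    have hY : DifferentiableAt ℝ (pd w (sqDist X p)) q :=
      ((h.smooth_sqDist p).pd h.isOpen (m := ∞) le_rfl w).diffAt h.isOpen (by simp) hq
    rw [pd_congr h.isOpen (hv w hw0) v hq, pd_mul c2 hY, pd_comp_clm b2.hasDerivAt, hv0]
    ring
  simp only [lap, hess, metricTrace, dualInner, hvw _ _ h1 h1, hvw _ _ h1 h2, hvw _ _ h2 h2,
    hv _ h1 q hq, hv _ h2 q hq]
  ring

theorem gradInnerLoc_logKernel (h : IsLocalMCF Ω e₀ e₁ e₂ X ν) (hq : q ∈ Ω) (hT : T q < t₀)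
    (h1 : T e₁ = 0) (h2 : T e₂ = 0) :
    gradInnerLoc e₁ e₂ X (logKernel X T p t₀) (logKernel X T p t₀) q =
      ((4 * (t₀ - T q))⁻¹) ^ 2 * gradInnerLoc e₁ e₂ X (sqDist X p) (sqDist X p) q := by
  simp only [gradInnerLoc, dualInner, h.pd_logKernel hq hT, h1, h2]
  ring

/-- Huisken's identity for the backward heat kernel `ρ` on a mean curvature flow, in the form of
an inequality: `∂ₜρ + Δρ - H²ρ = -ρ (H - ⟨x - p, ν⟩ / (2 (t₀ - t)))² ≤ 0`. -/
theorem conjugate_heat_kernel_le (h : IsLocalMCF Ω e₀ e₁ e₂ X ν) (hq : q ∈ Ω)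
    (hT : ∀ q ∈ Ω, T q < t₀) (h0 : T e₀ = 1) (h1 : T e₁ = 0) (h2 : T e₂ = 0) :
    pd e₀ (fun x => Real.exp (logKernel X T p t₀ x)) q +
        lap e₁ e₂ X (fun x => Real.exp (logKernel X T p t₀ x)) q ≤
      curvH e₁ e₂ X ν q ^ 2 * Real.exp (logKernel X T p t₀ q) := by
  have hψ : ContDiffOn ℝ 2 (logKernel X T p t₀) Ω := (h.smooth_logKernel hT).of_le two_le_infty
  have hne : t₀ - T q ≠ 0 := (sub_pos.2 (hT q hq)).ne'
  have e := heat_comp (e₀ := e₀) (e₁ := e₁) (e₂ := e₂) (X := X) Real.contDiff_exp h.isOpen hψ hq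
  have e0 := pd_comp (Real.hasDerivAt_exp _) (hψ.diffAt h.isOpen two_ne_zero hq) e₀
  simp only [Real.deriv_exp, heat] at e
  rw [e0, h.gradInnerLoc_logKernel hq (hT q hq) h1 h2, h.lap_logKernel hq hT h1 h2,
    h.lap_sqDist hq, h.gradInnerLoc_sqDist hq, h.pd_logKernel hq (hT q hq), h0,
    h.pd_time_sqDist hq] at e
  rw [e0, h.pd_logKernel hq (hT q hq), h0, h.pd_time_sqDist hq]
  have hpos := Real.exp_pos (logKernel X T p t₀ q)
  have key : 0 ≤ Real.exp (logKernel X T p t₀ q) *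
      (curvH e₁ e₂ X ν q - ⟪X q - p, ν q⟫ / (2 * (t₀ - T q))) ^ 2 := by positivity
  generalize lap e₁ e₂ X (fun x => Real.exp (logKernel X T p t₀ x)) q = Λ at *
  have : Λ = Real.exp (logKernel X T p t₀ q) * (-(t₀ - T q)⁻¹ + (2 * (t₀ - T q))⁻¹ *
      curvH e₁ e₂ X ν q * ⟪X q - p, ν q⟫ + (4 * (t₀ - T q) ^ 2)⁻¹ *
      (sqDist X p q - ⟪X q - p, ν q⟫ ^ 2)) := by
    field_simp at e ⊢
    linarith
  rw [this]
  have e2 : Real.exp (logKernel X T p t₀ q) *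
      (curvH e₁ e₂ X ν q - ⟪X q - p, ν q⟫ / (2 * (t₀ - T q))) ^ 2 =
      curvH e₁ e₂ X ν q ^ 2 * Real.exp (logKernel X T p t₀ q) -
      (Real.exp (logKernel X T p t₀ q) * (((t₀ - T q)⁻¹ * 1 -
        (4⁻¹ * ((t₀ - T q) ^ 2)⁻¹ * 1 * sqDist X p q +
          (4 * (t₀ - T q))⁻¹ * (-2 * curvH e₁ e₂ X ν q * ⟪X q - p, ν q⟫)))) +
      Real.exp (logKernel X T p t₀ q) * (-(t₀ - T q)⁻¹ + (2 * (t₀ - T q))⁻¹ *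
      curvH e₁ e₂ X ν q * ⟪X q - p, ν q⟫ + (4 * (t₀ - T q) ^ 2)⁻¹ *
      (sqDist X p q - ⟪X q - p, ν q⟫ ^ 2))) := by
    field_simp
    ring
  linarith

/-- The evolution of the area element: `∂ₜ √g = -H² √g`. -/
theorem pd_time_sqrt_gramDet (h : IsLocalMCF Ω e₀ e₁ e₂ X ν) (hq : q ∈ Ω) :
    pd e₀ (fun x => √(gramDet (pd e₁ X x) (pd e₂ X x))) q =
      -curvH e₁ e₂ X ν q ^ 2 * √(gramDet (pd e₁ X q) (pd e₂ X q)) := by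
  have hpos := h.gram_pos q hq
  have hs := Real.sqrt_pos.2 hpos
  rw [pd_comp (φ := fun x => gramDet (pd e₁ X x) (pd e₂ X x)) (Real.hasDerivAt_sqrt hpos.ne')
    (h.smooth_gramDet.diffAt h.isOpen (by simp) hq),
    h.pd_time_gramDet hq]
  have := Real.mul_self_sqrt hpos.le
  field_simp
  linear_combination curvH e₁ e₂ X ν q ^ 2 * this

/-- The local form of the weighted monotonicity formula: the time derivative of the weighted area
element is at most a spatial divergence. -/
theorem pd_time_weighted_area_le (h : IsLocalMCF Ω e₀ e₁ e₂ X ν) (hq : q ∈ Ω) {ρ : W → ℝ}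
    (hu : ContDiffOn ℝ 2 u Ω) (hρ : ContDiffOn ℝ 2 ρ Ω) (hu0 : 0 ≤ u q) (hρ0 : 0 ≤ ρ q)
    (hheat : heat e₀ e₁ e₂ X u q ≤ 0)
    (hconj : pd e₀ ρ q + lap e₁ e₂ X ρ q ≤ curvH e₁ e₂ X ν q ^ 2 * ρ q) :
    pd e₀ (fun x => u x * ρ x * √(gramDet (pd e₁ X x) (pd e₂ X x))) q ≤
      pd e₁ (fun x => ρ x * flux₁ e₁ e₂ X u x - u x * flux₁ e₁ e₂ X ρ x) q +
        pd e₂ (fun x => ρ x * flux₂ e₁ e₂ X u x - u x * flux₂ e₁ e₂ X ρ x) q := by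
  have du := hu.diffAt h.isOpen two_ne_zero hq
  have dρ := hρ.diffAt h.isOpen two_ne_zero hq
  have dS : DifferentiableAt ℝ (fun x => √(gramDet (pd e₁ X x) (pd e₂ X x))) q :=
    h.smooth_sqrt_gramDet.diffAt h.isOpen (by simp) hq
  have f1 := (h.smooth_flux₁ hu).diffAt h.isOpen one_ne_zero hq
  have f2 := (h.smooth_flux₂ hu).diffAt h.isOpen one_ne_zero hq
  have g1 := (h.smooth_flux₁ hρ).diffAt h.isOpen one_ne_zero hq
  have g2 := (h.smooth_flux₂ hρ).diffAt h.isOpen one_ne_zero hq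
  have kd := h.divergence_flux hq hu
  have kρ := h.divergence_flux hq hρ
  rw [pd_mul (du.fun_mul dρ) dS, pd_mul du dρ, h.pd_time_sqrt_gramDet hq,
    pd_sub (dρ.fun_mul f1) (du.fun_mul g1), pd_sub (dρ.fun_mul f2) (du.fun_mul g2), pd_mul dρ f1,
    pd_mul du g1, pd_mul dρ f2, pd_mul du g2]
  -- The terms `⟨∇ρ, ∇u⟩` cancel in the divergence of `ρ ∇u - u ∇ρ`.
  have cross : pd e₁ ρ q * flux₁ e₁ e₂ X u q + pd e₂ ρ q * flux₂ e₁ e₂ X u q =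
      pd e₁ u q * flux₁ e₁ e₂ X ρ q + pd e₂ u q * flux₂ e₁ e₂ X ρ q := by
    simp only [flux₁, flux₂]
    ring
  have hs := Real.sqrt_nonneg (gramDet (pd e₁ X q) (pd e₂ X q))
  have i1 := mul_nonneg hs (mul_nonneg hρ0 (neg_nonneg.2 hheat))
  have i2 := mul_nonneg hs (mul_nonneg hu0 (sub_nonneg.2 hconj))
  simp only [heat] at i1
  generalize √(gramDet (pd e₁ X q) (pd e₂ X q)) = S at *
  generalize pd e₁ (flux₁ e₁ e₂ X u) q = a1 at *
  generalize pd e₁ (flux₁ e₁ e₂ X ρ) q = a2 at *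
  have ka : a1 = S * lap e₁ e₂ X u q - pd e₂ (flux₂ e₁ e₂ X u) q := by linarith
  have kb : a2 = S * lap e₁ e₂ X ρ q - pd e₂ (flux₂ e₁ e₂ X ρ) q := by linarith
  rw [ka, kb]
  linarith

end IsLocalMCF

end LocalFlow

/-! ### Integration against a cutoff in the plane -/

section LocalIntegrals

variable {V : Set Plane} {χ : Plane → ℝ}

theorem continuousOn_cutoff_mul {J : Set ℝ} (hV : IsOpen V) (hχ : Continuous χ)
    (hsub : tsupport χ ⊆ V) {G : ℝ × Plane → ℝ} (hG : ContinuousOn G (J ×ˢ V)) :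
    ContinuousOn (fun q : ℝ × Plane => χ q.2 * G q) (J ×ˢ univ) := by
  rintro ⟨t, u⟩ ⟨ht, -⟩
  by_cases hu : u ∈ V
  · have hmem : J ×ˢ V ∈ 𝓝[J ×ˢ univ] (t, u) := by
      rw [nhdsWithin_prod_eq, nhdsWithin_univ]
      exact prod_mem_prod self_mem_nhdsWithin (hV.mem_nhds hu)
    exact (hχ.comp continuous_snd).continuousWithinAt.mul
      ((hG (t, u) ⟨ht, hu⟩).mono_of_mem_nhdsWithin hmem)
  · have hu' : u ∉ tsupport χ := fun h => hu (hsub h)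
    have hev : (fun q : ℝ × Plane => χ q.2 * G q) =ᶠ[𝓝 (t, u)] fun _ => 0 := by
      have := (notMem_tsupport_iff_eventuallyEq.1 hu')
      filter_upwards [continuous_snd.continuousAt.eventually this] with q hq
      simp only [Pi.zero_apply] at hq
      simp [hq]
    exact (continuousAt_const.congr hev.symm).continuousWithinAt

theorem continuous_cutoff_mul_slice (hV : IsOpen V) (hχ : Continuous χ)
    (hsub : tsupport χ ⊆ V) {g : Plane → ℝ} (hg : ContinuousOn g V) :
    Continuous (fun u => χ u * g u) := by
  refine ContinuousOn.continuous_of_tsupport_subset (hχ.continuousOn.mul hg) hV ?_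
  exact (tsupport_mul_subset_left).trans hsub

theorem integrable_cutoff_mul (hV : IsOpen V) (hχ : Continuous χ) (hc : HasCompactSupport χ)
    (hsub : tsupport χ ⊆ V) {g : Plane → ℝ} (hg : ContinuousOn g V) :
    Integrable (fun u => χ u * g u) :=
  (continuous_cutoff_mul_slice hV hχ hsub hg).integrable_of_hasCompactSupport hc.mul_right

theorem continuousOn_integral_cutoff_mul {J : Set ℝ} (hV : IsOpen V) (hχ : Continuous χ)
    (hc : HasCompactSupport χ) (hsub : tsupport χ ⊆ V) {G : ℝ × Plane → ℝ}
    (hG : ContinuousOn G (J ×ˢ V)) : ContinuousOn (fun t => ∫ u, χ u * G (t, u)) J := by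
  refine continuousOn_integral_of_compact_support (f := fun t u => χ u * G (t, u)) hc
    (continuousOn_cutoff_mul hV hχ hsub hG) fun t u _ hu => ?_
  rw [image_eq_zero_of_notMem_tsupport hu, zero_mul]

theorem hasDerivAt_slice {G : ℝ × Plane → ℝ} {t : ℝ} {u : Plane}
    (hG : DifferentiableAt ℝ G (t, u)) :
    HasDerivAt (fun s => G (s, u)) (pd ((1 : ℝ), (0 : Plane)) G (t, u)) t := by
  have h1 : HasDerivAt (fun s : ℝ => (s, u)) ((1 : ℝ), (0 : Plane)) t :=
    (hasDerivAt_id t).prodMk (hasDerivAt_const t u)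
  exact hG.hasFDerivAt.comp_hasDerivAt t h1

theorem hasFDerivAt_slice {E : Type*} [NormedAddCommGroup E] [NormedSpace ℝ E]
    {G : ℝ × Plane → E} {t : ℝ} {u : Plane} (hG : DifferentiableAt ℝ G (t, u)) :
    HasFDerivAt (fun v => G (t, v))
      ((fderiv ℝ G (t, u)).comp (ContinuousLinearMap.inr ℝ ℝ Plane)) u :=
  hG.hasFDerivAt.comp u (hasFDerivAt_prodMk_right t u)

theorem pd_slice {E : Type*} [NormedAddCommGroup E] [NormedSpace ℝ E] {G : ℝ × Plane → E}
    {t : ℝ} {u : Plane} (hG : DifferentiableAt ℝ G (t, u)) (v : Plane) :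
    pd v (fun x => G (t, x)) u = pd ((0 : ℝ), v) G (t, u) := by
  rw [pd, (hasFDerivAt_slice hG).fderiv]
  simp [pd]

/-- Differentiation under the integral sign, for a density cut off by a compactly supported
function of the space variables. -/
theorem hasDerivAt_integral_cutoff_mul {a b : ℝ} (hV : IsOpen V) (hχ : Continuous χ)
    (hc : HasCompactSupport χ) (hsub : tsupport χ ⊆ V) {G : ℝ × Plane → ℝ}
    (hG : ContDiffOn ℝ 1 G (Ioo a b ×ˢ V)) {t : ℝ} (ht : t ∈ Ioo a b) :
    HasDerivAt (fun t => ∫ u, χ u * G (t, u))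
      (∫ u, χ u * pd ((1 : ℝ), (0 : Plane)) G (t, u)) t := by
  have hΩ : IsOpen (Ioo a b ×ˢ V) := isOpen_Ioo.prod hV
  obtain ⟨a', ha', ha't⟩ := exists_between ht.1
  obtain ⟨b', hb', hb'b⟩ := exists_between ht.2
  have hsubI : Icc a' b' ⊆ Ioo a b := fun s hs => ⟨ha'.trans_le hs.1, hs.2.trans_lt hb'b⟩
  have hG' : ContinuousOn (pd ((1 : ℝ), (0 : Plane)) G) (Ioo a b ×ˢ V) :=
    (hG.pd hΩ (m := 0) (by norm_num) _).continuousOn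
  have hslice : ∀ s ∈ Ioo a b, ContinuousOn (fun u => G (s, u)) V := fun s hs =>
    hG.continuousOn.comp (by fun_prop) fun u hu => ⟨hs, hu⟩
  have hslice' : ∀ s ∈ Ioo a b, ContinuousOn (fun u => pd ((1 : ℝ), (0 : Plane)) G (s, u)) V :=
    fun s hs => hG'.comp (by fun_prop) fun u hu => ⟨hs, hu⟩
  have hcont := continuousOn_cutoff_mul hV hχ hsub hG'
  obtain ⟨C, hC⟩ := (isCompact_Icc.prod hc).exists_bound_of_continuousOn
    (s := Icc a' b' ×ˢ tsupport χ) (hcont.mono (prod_mono hsubI (subset_univ _)))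
  refine (hasDerivAt_integral_of_dominated_loc_of_deriv_le (s := Ioo a' b')
    (F := fun s u => χ u * G (s, u)) (F' := fun s u => χ u * pd ((1 : ℝ), (0 : Plane)) G (s, u))
    (bound := (tsupport χ).indicator fun _ => C) (Ioo_mem_nhds ha't hb') ?_ ?_ ?_ ?_ ?_ ?_).2
  · filter_upwards [Ioo_mem_nhds ht.1 ht.2] with s hs
    exact (continuous_cutoff_mul_slice hV hχ hsub (hslice s hs)).aestronglyMeasurable
  · exact integrable_cutoff_mul hV hχ hc hsub (hslice t ht)
  · exact (continuous_cutoff_mul_slice hV hχ hsub (hslice' t ht)).aestronglyMeasurable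
  · refine Eventually.of_forall fun u s hs => ?_
    by_cases hu : u ∈ tsupport χ
    · rw [indicator_of_mem hu]
      exact hC (s, u) ⟨Ioo_subset_Icc_self hs, hu⟩
    · rw [indicator_of_notMem hu, image_eq_zero_of_notMem_tsupport hu]
      simp
  · rw [integrable_indicator_iff (isClosed_tsupport χ).measurableSet]
    exact integrableOn_const hc.measure_ne_top
  · refine Eventually.of_forall fun u s hs => ?_
    by_cases hu : u ∈ tsupport χ
    · exact (hasDerivAt_slice (hG.diffAt hΩ one_ne_zero
        ⟨hsubI (Ioo_subset_Icc_self hs), hsub hu⟩)).const_mul _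
    · simp only [image_eq_zero_of_notMem_tsupport hu, zero_mul]
      exact hasDerivAt_const s 0

theorem integral_cutoff_mul_pd (hV : IsOpen V) (hχ : ContDiff ℝ 1 χ) (hc : HasCompactSupport χ)
    (hsub : tsupport χ ⊆ V) {g : Plane → ℝ} (hg : ContDiffOn ℝ 1 g V) (v : Plane) :
    ∫ u, χ u * pd v g u = -∫ u, pd v χ u * g u := by
  have hχ' : Continuous (pd v χ) := (hχ.continuous_fderiv one_ne_zero).clm_apply continuous_const
  have hsup : tsupport (pd v χ) ⊆ tsupport χ := tsupport_fderiv_apply_subset ℝ v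
  have hc' : HasCompactSupport (pd v χ) := hc.of_isClosed_subset (isClosed_tsupport _) hsup
  refine integral_mul_fderiv_eq_neg_fderiv_mul_of_integrable (f := χ) (g := g) (v := v) ?_ ?_ ?_
    (fun x _ => hχ.differentiable one_ne_zero x)
    (fun x hx => hg.diffAt hV one_ne_zero (hsub hx))
  · exact integrable_cutoff_mul hV hχ' hc' (hsup.trans hsub) hg.continuousOn
  · exact integrable_cutoff_mul hV hχ.continuous hc hsub
      (hg.pd hV (m := 0) (by norm_num) v).continuousOn
  · exact integrable_cutoff_mul hV hχ.continuous hc hsub hg.continuousOn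

/-- The direction of time in `ℝ × ℝ²`. -/
abbrev timeDir : ℝ × Plane := (1, 0)

/-- The first coordinate direction in `ℝ × ℝ²`. -/
abbrev dir₁ : ℝ × Plane := (0, EuclideanSpace.single 0 1)

/-- The second coordinate direction in `ℝ × ℝ²`. -/
abbrev dir₂ : ℝ × Plane := (0, EuclideanSpace.single 1 1)

/-- The integrand `⟨ρ ∇u - u ∇ρ, ∇χ⟩` of the boundary term which a cutoff `χ` of the space
variables brings into Green's formula. -/
def greenTerm (X : ℝ × Plane → Space) (χ : Plane → ℝ) (u ρ : ℝ × Plane → ℝ) (q : ℝ × Plane) : ℝ :=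
  ρ q * gradInnerLoc dir₁ dir₂ X (fun x => χ x.2) u q -
    u q * gradInnerLoc dir₁ dir₂ X (fun x => χ x.2) ρ q

variable {a b : ℝ} {X ν : ℝ × Plane → Space} {u ρ : ℝ × Plane → ℝ}

theorem pd_snd (hχ : ContDiff ℝ 1 χ) (v : Plane) (q : ℝ × Plane) :
    pd ((0 : ℝ), v) (fun x => χ x.2) q = pd v χ q.2 := by
  have hd : DifferentiableAt ℝ (fun x : ℝ × Plane => χ x.2) q :=
    (hχ.differentiable one_ne_zero q.2).comp (f := Prod.snd) q differentiableAt_snd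
  exact (pd_slice (G := fun x : ℝ × Plane => χ x.2) (t := q.1) (u := q.2) hd v).symm

/-- Localized weighted monotonicity: the time derivative of the weighted area cut off by `χ` is at
most the boundary term of Green's formula. -/
theorem IsLocalMCF.hasDerivAt_weighted_area (h : IsLocalMCF (Ioo a b ×ˢ V) timeDir dir₁ dir₂ X ν)
    (hV : IsOpen V) (hχ : ContDiff ℝ 1 χ) (hc : HasCompactSupport χ) (hsub : tsupport χ ⊆ V)
    (hχ0 : ∀ x, 0 ≤ χ x)
    (hu : ContDiffOn ℝ 2 u (Ioo a b ×ˢ V)) (hρ : ContDiffOn ℝ 2 ρ (Ioo a b ×ˢ V))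
    (hu0 : ∀ q ∈ Ioo a b ×ˢ V, 0 ≤ u q) (hρ0 : ∀ q ∈ Ioo a b ×ˢ V, 0 ≤ ρ q)
    (hheat : ∀ q ∈ Ioo a b ×ˢ V, heat timeDir dir₁ dir₂ X u q ≤ 0)
    (hconj : ∀ q ∈ Ioo a b ×ˢ V,
      pd timeDir ρ q + lap dir₁ dir₂ X ρ q ≤ curvH dir₁ dir₂ X ν q ^ 2 * ρ q)
    {t : ℝ} (ht : t ∈ Ioo a b) :
    ∃ d, HasDerivAt (fun t => ∫ x, χ x *
        (u (t, x) * ρ (t, x) * √(gramDet (pd dir₁ X (t, x)) (pd dir₂ X (t, x))))) d t ∧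
      Integrable (fun x => greenTerm X χ u ρ (t, x) *
        √(gramDet (pd dir₁ X (t, x)) (pd dir₂ X (t, x)))) ∧
      d ≤ -∫ x, greenTerm X χ u ρ (t, x) *
        √(gramDet (pd dir₁ X (t, x)) (pd dir₂ X (t, x))) := by
  have hΩ := h.isOpen
  set G : ℝ × Plane → ℝ := fun q => u q * ρ q * √(gramDet (pd dir₁ X q) (pd dir₂ X q)) with hGdef
  have hG : ContDiffOn ℝ 1 G (Ioo a b ×ˢ V) :=
    ((hu.mul hρ).of_le (by norm_num)).mul (h.smooth_sqrt_gramDet.of_le (by simp))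
  have hmap : MapsTo (fun x : Plane => (t, x)) V (Ioo a b ×ˢ V) := fun x hx => ⟨ht, hx⟩
  set Z₁ : ℝ × Plane → ℝ := fun q => ρ q * flux₁ dir₁ dir₂ X u q - u q * flux₁ dir₁ dir₂ X ρ q
  set Z₂ : ℝ × Plane → ℝ := fun q => ρ q * flux₂ dir₁ dir₂ X u q - u q * flux₂ dir₁ dir₂ X ρ q
  have hu1 : ContDiffOn ℝ 1 u (Ioo a b ×ˢ V) := hu.of_le (by norm_num)
  have hρ1 : ContDiffOn ℝ 1 ρ (Ioo a b ×ˢ V) := hρ.of_le (by norm_num)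
  have hZ₁ : ContDiffOn ℝ 1 Z₁ (Ioo a b ×ˢ V) :=
    (hρ1.mul (h.smooth_flux₁ hu)).sub (hu1.mul (h.smooth_flux₁ hρ))
  have hZ₂ : ContDiffOn ℝ 1 Z₂ (Ioo a b ×ˢ V) :=
    (hρ1.mul (h.smooth_flux₂ hu)).sub (hu1.mul (h.smooth_flux₂ hρ))
  have hZ₁t : ContDiffOn ℝ 1 (fun x => Z₁ (t, x)) V :=
    hZ₁.comp (by fun_prop) hmap
  have hZ₂t : ContDiffOn ℝ 1 (fun x => Z₂ (t, x)) V :=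
    hZ₂.comp (by fun_prop) hmap
  have cG : ContinuousOn (fun x => pd timeDir G (t, x)) V :=
    (hG.pd hΩ (m := 0) (by norm_num) _).continuousOn.comp (by fun_prop) hmap
  set v₁ : Plane := EuclideanSpace.single 0 1
  set v₂ : Plane := EuclideanSpace.single 1 1
  have c₁ := (hZ₁t.pd hV (m := 0) (by norm_num) v₁).continuousOn
  have c₂ := (hZ₂t.pd hV (m := 0) (by norm_num) v₂).continuousOn
  have k₁ : Continuous (pd v₁ χ) :=
    (hχ.continuous_fderiv one_ne_zero).clm_apply continuous_const
  have k₂ : Continuous (pd v₂ χ) :=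
    (hχ.continuous_fderiv one_ne_zero).clm_apply continuous_const
  have s₁ : tsupport (pd v₁ χ) ⊆ tsupport χ := tsupport_fderiv_apply_subset ℝ v₁
  have s₂ : tsupport (pd v₂ χ) ⊆ tsupport χ := tsupport_fderiv_apply_subset ℝ v₂
  have i₁ := integrable_cutoff_mul hV k₁ (hc.of_isClosed_subset (isClosed_tsupport _) s₁)
    (s₁.trans hsub) hZ₁t.continuousOn
  have i₂ := integrable_cutoff_mul hV k₂ (hc.of_isClosed_subset (isClosed_tsupport _) s₂)
    (s₂.trans hsub) hZ₂t.continuousOn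
  have hgreen : (fun x => greenTerm X χ u ρ (t, x) *
      √(gramDet (pd dir₁ X (t, x)) (pd dir₂ X (t, x)))) =
      fun x => pd v₁ χ x * Z₁ (t, x) + pd v₂ χ x * Z₂ (t, x) := by
    ext x
    by_cases hx : x ∈ V
    · have hD := h.gram_pos _ (hmap hx)
      have hS := Real.mul_self_sqrt hD.le
      have hSp := Real.sqrt_pos.2 hD
      simp only [Z₁, Z₂, flux₁, flux₂, greenTerm, gradInnerLoc, dualInner, pd_snd hχ, v₁, v₂]
      generalize gramDet (pd dir₁ X (t, x)) (pd dir₂ X (t, x)) = D at *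
      generalize √D = S at *
      subst hS
      field_simp
      ring
    · have hx' : x ∉ tsupport χ := fun h' => hx (hsub h')
      have z₁ : pd v₁ χ x = 0 := image_eq_zero_of_notMem_tsupport fun h' => hx' (s₁ h')
      have z₂ : pd v₂ χ x = 0 := image_eq_zero_of_notMem_tsupport fun h' => hx' (s₂ h')
      simp only [v₁, v₂] at z₁ z₂
      simp only [greenTerm, gradInnerLoc, dualInner, pd_snd hχ, v₁, v₂, z₁, z₂]
      ring
  refine ⟨_, hasDerivAt_integral_cutoff_mul hV hχ.continuous hc hsub hG ht, ?_, ?_⟩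
  · rw [hgreen]
    exact i₁.add i₂
  have hle : ∫ x, χ x * pd timeDir G (t, x) ≤
      ∫ x, (χ x * pd v₁ (fun y => Z₁ (t, y)) x + χ x * pd v₂ (fun y => Z₂ (t, y)) x) := by
    refine integral_mono (integrable_cutoff_mul hV hχ.continuous hc hsub cG)
      ((integrable_cutoff_mul hV hχ.continuous hc hsub c₁).add
        (integrable_cutoff_mul hV hχ.continuous hc hsub c₂)) fun x => ?_
    simp only
    by_cases hx : x ∈ V
    · have hq := hmap hx
      rw [← mul_add, pd_slice (hZ₁.diffAt hΩ one_ne_zero hq),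
        pd_slice (hZ₂.diffAt hΩ one_ne_zero hq)]
      exact mul_le_mul_of_nonneg_left (h.pd_time_weighted_area_le hq hu hρ (hu0 _ hq) (hρ0 _ hq)
        (hheat _ hq) (hconj _ hq)) (hχ0 x)
    · rw [image_eq_zero_of_notMem_tsupport fun h' => hx (hsub h')]
      simp
  refine hle.trans (le_of_eq ?_)
  rw [hgreen, integral_add (integrable_cutoff_mul hV hχ.continuous hc hsub c₁)
    (integrable_cutoff_mul hV hχ.continuous hc hsub c₂),
    integral_cutoff_mul_pd hV hχ hc hsub hZ₁t, integral_cutoff_mul_pd hV hχ hc hsub hZ₂t,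
    ← neg_add, ← integral_add i₁ i₂]

end LocalIntegrals

/-! ### Change of coordinates -/

/-- The first standard basis vector of the plane. -/
abbrev unit₁ : Plane := EuclideanSpace.single 0 1

/-- The second standard basis vector of the plane. -/
abbrev unit₂ : Plane := EuclideanSpace.single 1 1

/-- The Jacobian determinant of a map of the plane. -/
def jacobian (ψ : Plane → Plane) (x : Plane) : ℝ :=
  pd unit₁ ψ x 0 * pd unit₂ ψ x 1 - pd unit₂ ψ x 0 * pd unit₁ ψ x 1

section ChartChange

variable {E : Type*} [NormedAddCommGroup E] [NormedSpace ℝ E] {ψ : Plane → Plane} {x : Plane}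

/-- The chain rule for a change of coordinates of the plane. -/
theorem pd_comp_chart {g : Plane → E} (hg : DifferentiableAt ℝ g (ψ x))
    (hψ : DifferentiableAt ℝ ψ x) (v : Plane) :
    pd v (fun y => g (ψ y)) x =
      pd v ψ x 0 • pd unit₁ g (ψ x) + pd v ψ x 1 • pd unit₂ g (ψ x) := by
  have h1 : pd v (fun y => g (ψ y)) x = fderiv ℝ g (ψ x) (pd v ψ x) := by
    have : fderiv ℝ (g ∘ ψ) x = _ := fderiv_comp x hg hψ
    simp only [pd]
    change fderiv ℝ (g ∘ ψ) x v = _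
    rw [this]
    rfl
  rw [h1]
  conv_lhs => rw [plane_eq_sum (pd v ψ x)]
  rw [map_add, map_smul, map_smul]
  rfl

theorem pd_pd_comp_chart {g : Plane → E} (hg : ContDiffAt ℝ 2 g (ψ x))
    (hψ : ContDiffAt ℝ 2 ψ x) (v w : Plane) :
    pd v (pd w fun y => g (ψ y)) x =
      (pd v (fun y => pd w ψ y 0) x • pd unit₁ g (ψ x) +
        pd v (fun y => pd w ψ y 1) x • pd unit₂ g (ψ x)) +
      (pd w ψ x 0 • (pd v ψ x 0 • pd unit₁ (pd unit₁ g) (ψ x) +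
          pd v ψ x 1 • pd unit₂ (pd unit₁ g) (ψ x)) +
        pd w ψ x 1 • (pd v ψ x 0 • pd unit₁ (pd unit₂ g) (ψ x) +
          pd v ψ x 1 • pd unit₂ (pd unit₂ g) (ψ x))) := by
  have hev : pd w (fun y => g (ψ y)) =ᶠ[𝓝 x] fun y =>
      pd w ψ y 0 • pd unit₁ g (ψ y) + pd w ψ y 1 • pd unit₂ g (ψ y) := by
    have h1 : ∀ᶠ y in 𝓝 x, ContDiffAt ℝ 2 ψ y := hψ.eventually (by simp)
    have h2 : ∀ᶠ y in 𝓝 x, ContDiffAt ℝ 2 g (ψ y) :=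
      hψ.continuousAt.eventually (hg.eventually (by simp))
    filter_upwards [h1, h2] with y hy1 hy2
    exact pd_comp_chart (hy2.differentiableAt two_ne_zero) (hy1.differentiableAt two_ne_zero) w
  have dψ : DifferentiableAt ℝ ψ x := hψ.differentiableAt two_ne_zero
  have dw : DifferentiableAt ℝ (pd w ψ) x :=
    ((hψ.fderiv_right (m := 1) (by norm_num)).clm_apply contDiffAt_const).differentiableAt
      one_ne_zero
  have dwi : ∀ i : Fin 2, DifferentiableAt ℝ (fun y => pd w ψ y i) x := fun i =>
    (EuclideanSpace.proj (𝕜 := ℝ) i : Plane →L[ℝ] ℝ).differentiableAt.comp x dw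
  have dg : ∀ z, DifferentiableAt ℝ (pd z g) (ψ x) := fun z =>
    ((hg.fderiv_right (m := 1) (by norm_num)).clm_apply contDiffAt_const).differentiableAt
      one_ne_zero
  have dgψ : ∀ z, DifferentiableAt ℝ (fun y => pd z g (ψ y)) x := fun z => (dg z).comp x dψ
  have e : pd v (pd w fun y => g (ψ y)) x = pd v (fun y =>
      pd w ψ y 0 • pd unit₁ g (ψ y) + pd w ψ y 1 • pd unit₂ g (ψ y)) x := by
    unfold pd at hev ⊢
    rw [hev.fderiv_eq]
  rw [e, pd_add ((dwi 0).fun_smul (dgψ _)) ((dwi 1).fun_smul (dgψ _)),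
    pd_smul (dwi 0) (dgψ _), pd_smul (dwi 1) (dgψ _), pd_comp_chart (dg _) dψ,
    pd_comp_chart (dg _) dψ]
  abel

theorem gramDet_pd_comp_chart {g : Plane → Space} (hg : DifferentiableAt ℝ g (ψ x))
    (hψ : DifferentiableAt ℝ ψ x) :
    gramDet (pd unit₁ (fun y => g (ψ y)) x) (pd unit₂ (fun y => g (ψ y)) x) =
      jacobian ψ x ^ 2 * gramDet (pd unit₁ g (ψ x)) (pd unit₂ g (ψ x)) := by
  simp only [pd_comp_chart hg hψ, gramDet, jacobian, inner_add_left, inner_add_right,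
    inner_smul_left, inner_smul_right, conj_trivial,
    real_inner_comm (pd unit₁ g (ψ x)) (pd unit₂ g (ψ x))]
  ring

theorem gradInnerLoc_comp_chart {g : Plane → Space} {u w : Plane → ℝ}
    (hg : DifferentiableAt ℝ g (ψ x)) (hu : DifferentiableAt ℝ u (ψ x))
    (hw : DifferentiableAt ℝ w (ψ x)) (hψ : DifferentiableAt ℝ ψ x) (hJ : jacobian ψ x ≠ 0)
    (hD : gramDet (pd unit₁ g (ψ x)) (pd unit₂ g (ψ x)) ≠ 0) :
    gradInnerLoc unit₁ unit₂ (fun y => g (ψ y)) (fun y => u (ψ y)) (fun y => w (ψ y)) x =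
      gradInnerLoc unit₁ unit₂ g u w (ψ x) := by
  rw [gradInnerLoc, gradInnerLoc, dualInner, dualInner, gramDet_pd_comp_chart hg hψ,
    div_eq_div_iff (mul_ne_zero (pow_ne_zero 2 hJ) hD) hD]
  simp only [pd_comp_chart hg hψ, pd_comp_chart hu hψ, pd_comp_chart hw hψ, jacobian,
    inner_add_left, inner_add_right, inner_smul_left, inner_smul_right, conj_trivial, smul_eq_mul,
    real_inner_comm (pd unit₁ g (ψ x)) (pd unit₂ g (ψ x))]
  ring

/-- The mean curvature does not depend on the parametrization. -/
theorem curvH_comp_chart {g : Plane → Space} {n : Space} (hg : ContDiffAt ℝ 2 g (ψ x))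
    (hψ : ContDiffAt ℝ 2 ψ x) (hJ : jacobian ψ x ≠ 0)
    (hD : gramDet (pd unit₁ g (ψ x)) (pd unit₂ g (ψ x)) ≠ 0)
    (h1 : ⟪pd unit₁ g (ψ x), n⟫ = 0) (h2 : ⟪pd unit₂ g (ψ x), n⟫ = 0) :
    curvH unit₁ unit₂ (fun y => g (ψ y)) (fun _ => n) x =
      curvH unit₁ unit₂ g (fun _ => n) (ψ x) := by
  have dg := hg.differentiableAt two_ne_zero
  have dψ := hψ.differentiableAt two_ne_zero
  rw [curvH, curvH, metricTrace, metricTrace, gramDet_pd_comp_chart dg dψ,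
    div_eq_div_iff (mul_ne_zero (pow_ne_zero 2 hJ) hD) hD]
  simp only [sff, pd_pd_comp_chart hg hψ, pd_comp_chart dg dψ, jacobian,
    inner_add_left, inner_add_right, inner_smul_left, inner_smul_right, conj_trivial, h1, h2,
    real_inner_comm (pd unit₁ g (ψ x)) (pd unit₂ g (ψ x)), pd_comm hg unit₂ unit₁]
  ring

theorem jacobian_ne_zero (h : Function.Injective (fderiv ℝ ψ x)) : jacobian ψ x ≠ 0 := by
  intro hJ
  have key : ∀ c d : ℝ, c * pd unit₁ ψ x 0 + d * pd unit₂ ψ x 0 = 0 →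
      c * pd unit₁ ψ x 1 + d * pd unit₂ ψ x 1 = 0 → c = 0 ∧ d = 0 := by
    intro c d h0 h1
    have hz : fderiv ℝ ψ x (c • unit₁ + d • unit₂) = 0 := by
      rw [map_add, map_smul, map_smul]
      ext i
      fin_cases i
      · simpa [pd] using h0
      · simpa [pd] using h1
    have := h (hz.trans (map_zero _).symm)
    have t0 := congrArg (fun z : Plane => z 0) this
    have t1 := congrArg (fun z : Plane => z 1) this
    simp at t0 t1
    exact ⟨t0, t1⟩
  unfold jacobian at hJ
  obtain ⟨e1, e2⟩ := key (pd unit₂ ψ x 1) (-pd unit₁ ψ x 1) (by linarith) (by ring)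
  obtain ⟨e3, e4⟩ := key (pd unit₂ ψ x 0) (-pd unit₁ ψ x 0) (by ring) (by linarith)
  have := key 1 0 (by linarith) (by linarith)
  exact one_ne_zero this.1

theorem gramDet_pos_of_injective {L : Plane →L[ℝ] Space} (h : Function.Injective L) :
    0 < gramDet (L unit₁) (L unit₂) := by
  by_contra! hD
  -- The residue of the projection of `L unit₁` to `L unit₂`, scaled to avoid a division, has
  -- squared norm `‖L unit₂‖²` times the Gram determinant.
  have hz : L (⟪L unit₂, L unit₂⟫ • unit₁ - ⟪L unit₁, L unit₂⟫ • unit₂) = 0 := by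
    rw [← inner_self_eq_zero (𝕜 := ℝ)]
    refine le_antisymm ?_ real_inner_self_nonneg
    have : ⟪L (⟪L unit₂, L unit₂⟫ • unit₁ - ⟪L unit₁, L unit₂⟫ • unit₂),
        L (⟪L unit₂, L unit₂⟫ • unit₁ - ⟪L unit₁, L unit₂⟫ • unit₂)⟫ =
        ⟪L unit₂, L unit₂⟫ * gramDet (L unit₁) (L unit₂) := by
      simp only [map_sub, map_smul, gramDet, inner_sub_left, inner_sub_right, inner_smul_left,
        inner_smul_right, conj_trivial, real_inner_comm (L unit₁) (L unit₂)]
      ring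
    rw [this]
    exact mul_nonpos_of_nonneg_of_nonpos real_inner_self_nonneg hD
  have h0 := congrArg (fun z : Plane => z 0) (h (hz.trans (map_zero _).symm))
  have h2 : ⟪L unit₂, L unit₂⟫ = 0 := by simpa using h0
  have h3 := h ((inner_self_eq_zero.1 h2).trans (map_zero _).symm)
  have h4 := congrArg (fun z : Plane => z 1) h3
  simp at h4

end ChartChange

section Slices

variable {E : Type*} [NormedAddCommGroup E] [NormedSpace ℝ E]

/-- The spatial partial derivatives of a map which is smooth on `J × V`, up to the ends of the
interval `J`, are smooth on `J × V`, up to the ends. -/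
theorem contDiffOn_pd_slice {J : Set ℝ} (hJ : UniqueDiffOn ℝ J) {V : Set Plane} (hV : IsOpen V)
    {Φ : ℝ × Plane → E} (hΦ : ContDiffOn ℝ ∞ Φ (J ×ˢ V)) (v : Plane) :
    ContDiffOn ℝ ∞ (fun q : ℝ × Plane => pd v (fun x => Φ (q.1, x)) q.2) (J ×ˢ V) := by
  have hS : UniqueDiffOn ℝ (J ×ˢ V) := hJ.prod hV.uniqueDiffOn
  have h1 : ContDiffOn ℝ ∞ (fun q => fderivWithin ℝ Φ (J ×ˢ V) q ((0 : ℝ), v)) (J ×ˢ V) :=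
    (hΦ.fderivWithin hS (m := ∞) le_rfl).clm_apply contDiffOn_const
  refine h1.congr ?_
  rintro ⟨t, x⟩ ⟨ht, hx⟩
  have hd : DifferentiableWithinAt ℝ Φ (J ×ˢ V) (t, x) :=
    hΦ.differentiableOn (by simp) _ ⟨ht, hx⟩
  have h2 := hd.hasFDerivWithinAt.comp x (hasFDerivAt_prodMk_right t x).hasFDerivWithinAt
    (s := V) (fun y hy => ⟨ht, hy⟩)
  have h3 := (h2.hasFDerivAt (hV.mem_nhds hx)).fderiv
  simp only [pd]
  change fderiv ℝ (Φ ∘ fun x => (t, x)) x v = _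
  rw [h3]
  simp

theorem continuousOn_metricTrace {Y : Type*} [TopologicalSpace Y] {S : Set Y}
    {v w : Y → Space} {a b c : Y → ℝ} (hv : ContinuousOn v S) (hw : ContinuousOn w S)
    (ha : ContinuousOn a S) (hb : ContinuousOn b S) (hc : ContinuousOn c S)
    (hD : ∀ y ∈ S, gramDet (v y) (w y) ≠ 0) :
    ContinuousOn (fun y => metricTrace (v y) (w y) (a y) (b y) (c y)) S := by
  refine ContinuousOn.div ?_ ?_ hD
  · exact (((hw.inner hw).mul ha).sub ((continuousOn_const.mul (hv.inner hw)).mul hb)).add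
      ((hv.inner hv).mul hc)
  · exact ((hv.inner hv).mul (hw.inner hw)).sub ((hv.inner hw).pow 2)

end Slices

/-! ### Surfaces in the charts of a manifold -/

section Charts

variable {M : Type*} [TopologicalSpace M] [ChartedSpace Plane M]

/-- The inverse of the preferred chart around `x`. -/
abbrev chartInv (x : M) : Plane → M := (extChartAt (𝓡 2) x).symm

/-- The image of the preferred chart around `x`. -/
abbrev chartDom (x : M) : Set Plane := (extChartAt (𝓡 2) x).target

theorem isOpen_chartDom (x : M) : IsOpen (chartDom x) := isOpen_extChartAt_target x

theorem continuousOn_chartInv (x : M) : ContinuousOn (chartInv x) (chartDom x) :=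
  continuousOn_extChartAt_symm x

variable [IsManifold (𝓡 2) ∞ M]

/-- The change of coordinates from the preferred chart around `y` to that around `x₀`, near `y`. -/
theorem exists_transition {x₀ y : M} (hy : y ∈ (extChartAt (𝓡 2) x₀).source) :
    ∃ ψ : Plane → Plane, ContDiffAt ℝ ∞ ψ (extChartAt (𝓡 2) y y) ∧
      ψ (extChartAt (𝓡 2) y y) = extChartAt (𝓡 2) x₀ y ∧
      jacobian ψ (extChartAt (𝓡 2) y y) ≠ 0 ∧
      ∀ᶠ u in 𝓝 (extChartAt (𝓡 2) y y), chartInv y u = chartInv x₀ (ψ u) := by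
  set u₀ := extChartAt (𝓡 2) y y with hu₀
  set ψ : Plane → Plane := fun u => extChartAt (𝓡 2) x₀ (chartInv y u) with hψdef
  set θ : Plane → Plane := fun u => extChartAt (𝓡 2) y (chartInv x₀ u) with hθdef
  have hyy : chartInv y u₀ = y := extChartAt_to_inv (I := 𝓡 2) y
  have hψ₀ : ψ u₀ = extChartAt (𝓡 2) x₀ y := by simp only [hψdef, hyy]
  have hx₀y : chartInv x₀ (extChartAt (𝓡 2) x₀ y) = y := (extChartAt (𝓡 2) x₀).left_inv hy
  have hψs : ContDiffAt ℝ ∞ ψ u₀ := by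
    rw [← contMDiffAt_iff_contDiffAt]
    have h1 : ContMDiffAt (𝓡 2) (𝓡 2) ∞ (chartInv y) u₀ :=
      (contMDiffOn_extChartAt_symm y).contMDiffAt (extChartAt_target_mem_nhds y)
    have h2 : ContMDiffAt (𝓡 2) 𝓘(ℝ, Plane) ∞ (extChartAt (𝓡 2) x₀) (chartInv y u₀) := by
      rw [hyy]
      exact contMDiffAt_extChartAt' (by rwa [extChartAt_source] at hy)
    exact h2.comp u₀ h1
  have hθs : ContDiffAt ℝ ∞ θ (ψ u₀) := by
    rw [← contMDiffAt_iff_contDiffAt]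
    have h1 : ContMDiffAt (𝓡 2) (𝓡 2) ∞ (chartInv x₀) (ψ u₀) := by
      rw [hψ₀]
      exact (contMDiffOn_extChartAt_symm x₀).contMDiffAt
        ((isOpen_chartDom x₀).mem_nhds ((extChartAt (𝓡 2) x₀).map_source hy))
    have h2 : ContMDiffAt (𝓡 2) 𝓘(ℝ, Plane) ∞ (extChartAt (𝓡 2) y) (chartInv x₀ (ψ u₀)) := by
      rw [hψ₀, hx₀y]
      exact contMDiffAt_extChartAt
    exact h2.comp (ψ u₀) h1
  have hcont : ContinuousAt (chartInv y) u₀ :=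
    (continuousOn_chartInv y).continuousAt (extChartAt_target_mem_nhds y)
  have hev : ∀ᶠ u in 𝓝 u₀, chartInv y u ∈ (extChartAt (𝓡 2) x₀).source := by
    refine hcont.eventually ((isOpen_extChartAt_source x₀).mem_nhds ?_)
    rwa [hyy]
  have htr : ∀ᶠ u in 𝓝 u₀, chartInv y u = chartInv x₀ (ψ u) :=
    hev.mono fun u hu => ((extChartAt (𝓡 2) x₀).left_inv hu).symm
  refine ⟨ψ, hψs, hψ₀, jacobian_ne_zero ?_, htr⟩
  have hid : (θ ∘ ψ) =ᶠ[𝓝 u₀] id := by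
    filter_upwards [htr, extChartAt_target_mem_nhds (I := 𝓡 2) y] with u hu huV
    simp only [Function.comp, hθdef, id]
    rw [← hu]
    exact (extChartAt (𝓡 2) y).right_inv huV
  have hcomp := fderiv_comp u₀ (hθs.differentiableAt (by simp)) (hψs.differentiableAt (by simp))
  rw [hid.fderiv_eq, fderiv_id] at hcomp
  intro v w hvw
  have e : ∀ z, fderiv ℝ θ (ψ u₀) (fderiv ℝ ψ u₀ z) = z := fun z => by
    have := congrArg (fun L : Plane →L[ℝ] Plane => L z) hcomp
    simpa using this.symm
  rw [← e v, ← e w, hvw]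

theorem contDiffOn_comp_chartInv {f : M → Space} (hf : ContMDiff (𝓡 2) 𝓘(ℝ, Space) ∞ f) (x : M) :
    ContDiffOn ℝ ∞ (fun u => f (chartInv x u)) (chartDom x) := by
  rw [← contMDiffOn_iff_contDiffOn]
  exact hf.comp_contMDiffOn (contMDiffOn_extChartAt_symm x)

/-- The differential of `f` read in a chart is the differential of `f` on the surface, composed
with the isomorphism of tangent spaces given by the chart. -/
theorem fderiv_comp_chartInv {f : M → Space} (hf : ContMDiff (𝓡 2) 𝓘(ℝ, Space) ∞ f) (x : M)
    {u : Plane} (hu : u ∈ chartDom x) :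
    ∃ L : Plane →L[ℝ] TangentSpace (𝓡 2) (chartInv x u), Function.Injective L ∧
      ∀ v, pd v (fun u => f (chartInv x u)) u =
        mfderiv (𝓡 2) 𝓘(ℝ, Space) f (chartInv x u) (L v) := by
  have hinv := isInvertible_mfderivWithin_extChartAt_symm (I := 𝓡 2) hu
  rw [show range (𝓡 2) = univ from (𝓡 2).range_eq_univ, mfderivWithin_univ] at hinv
  refine ⟨mfderiv 𝓘(ℝ, Plane) (𝓡 2) (chartInv x) u, hinv.injective, fun v => ?_⟩
  have hd : MDifferentiableAt 𝓘(ℝ, Plane) (𝓡 2) (chartInv x) u :=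
    ((contMDiffOn_extChartAt_symm (n := ∞) x).contMDiffAt
      ((isOpen_chartDom x).mem_nhds hu)).mdifferentiableAt (by simp)
  have := mfderiv_comp u ((hf _).mdifferentiableAt (by simp)) hd
  unfold pd
  rw [← mfderiv_eq_fderiv]
  change mfderiv 𝓘(ℝ, Plane) 𝓘(ℝ, Space) (f ∘ chartInv x) u v = _
  rw [this]
  rfl

theorem gramDet_comp_chartInv_pos {f : M → Space} (hf : ContMDiff (𝓡 2) 𝓘(ℝ, Space) ∞ f)
    (himm : ∀ x, Function.Injective (mfderiv (𝓡 2) 𝓘(ℝ, Space) f x)) (x : M)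
    {u : Plane} (hu : u ∈ chartDom x) :
    0 < gramDet (pd unit₁ (fun u => f (chartInv x u)) u)
      (pd unit₂ (fun u => f (chartInv x u)) u) := by
  obtain ⟨L, hL, hLv⟩ := fderiv_comp_chartInv hf x hu
  refine gramDet_pos_of_injective (L := fderiv ℝ (fun u => f (chartInv x u)) u) ?_
  intro v w hvw
  refine hL (himm _ ?_)
  rw [← hLv v, ← hLv w]
  exact hvw

theorem inner_pd_comp_chartInv {f n : M → Space} (hf : ContMDiff (𝓡 2) 𝓘(ℝ, Space) ∞ f)
    (horth : ∀ x, ∀ v : TangentSpace (𝓡 2) x,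
      inner (E := Space) ℝ (mfderiv (𝓡 2) 𝓘(ℝ, Space) f x v) (n x) = 0) (x : M)
    {u : Plane} (hu : u ∈ chartDom x) (v : Plane) :
    ⟪pd v (fun u => f (chartInv x u)) u, n (chartInv x u)⟫ = 0 := by
  obtain ⟨L, hL, hLv⟩ := fderiv_comp_chartInv hf x hu
  rw [hLv]
  exact horth _ _

theorem meanCurvature_eq_curvH {f : M → Space} (hf : ContMDiff (𝓡 2) 𝓘(ℝ, Space) ∞ f)
    (n : M → Space) (x : M) :
    meanCurvature f n x = curvH unit₁ unit₂ (fun u => f (chartInv x u)) (fun _ => n x)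
      (extChartAt (𝓡 2) x x) := by
  have hs : ContDiffAt ℝ 2 (fun u => f (chartInv x u)) (extChartAt (𝓡 2) x x) :=
    ((contDiffOn_comp_chartInv hf x).contDiffAt (extChartAt_target_mem_nhds x)).of_le
      two_le_infty
  have hc := pd_comm hs unit₂ unit₁
  have hg : ∀ i j, firstForm f x i j =
      ⟪pd (EuclideanSpace.single i 1) (fun u => f (chartInv x u)) (extChartAt (𝓡 2) x x),
        pd (EuclideanSpace.single j 1) (fun u => f (chartInv x u)) (extChartAt (𝓡 2) x x)⟫ :=
    fun i j => rfl
  have hh : ∀ i j, secondForm f n x i j = sff (fun u => f (chartInv x u)) (fun _ => n x)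
      (EuclideanSpace.single i 1) (EuclideanSpace.single j 1) (extChartAt (𝓡 2) x x) :=
    fun i j => rfl
  have hs21 : sff (fun u => f (chartInv x u)) (fun _ => n x) unit₂ unit₁ (extChartAt (𝓡 2) x x) =
      sff (fun u => f (chartInv x u)) (fun _ => n x) unit₁ unit₂ (extChartAt (𝓡 2) x x) := by
    rw [sff, sff, hc]
  rw [meanCurvature, Matrix.inv_def, Matrix.adjugate_fin_two, Matrix.trace_fin_two,
    Matrix.det_fin_two, Ring.inverse_eq_inv]
  simp only [Matrix.smul_apply, Matrix.mul_apply, Fin.sum_univ_two,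
    Matrix.of_apply, Matrix.cons_val_zero, Matrix.cons_val_one, Matrix.cons_val', smul_eq_mul,
    hg, hh, hs21, Matrix.empty_val', Matrix.cons_val_fin_one]
  rw [curvH, metricTrace, gramDet,
    real_inner_comm (pd unit₁ (fun u => f (chartInv x u)) (extChartAt (𝓡 2) x x))
      (pd unit₂ (fun u => f (chartInv x u)) (extChartAt (𝓡 2) x x))]
  ring

/-- The mean curvature, defined at each point through the preferred chart around this point, can
be computed in any one preferred chart on the whole domain of the chart. -/
theorem meanCurvature_eq_curvH_chart {f n : M → Space} (hf : ContMDiff (𝓡 2) 𝓘(ℝ, Space) ∞ f)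
    (himm : ∀ x, Function.Injective (mfderiv (𝓡 2) 𝓘(ℝ, Space) f x))
    (horth : ∀ x, ∀ v : TangentSpace (𝓡 2) x,
      inner (E := Space) ℝ (mfderiv (𝓡 2) 𝓘(ℝ, Space) f x v) (n x) = 0) {x : M}
    {u : Plane} (hu : u ∈ chartDom x) :
    meanCurvature f n (chartInv x u) =
      curvH unit₁ unit₂ (fun u => f (chartInv x u)) (fun u => n (chartInv x u)) u := by
  have hy : chartInv x u ∈ (extChartAt (𝓡 2) x).source := (extChartAt (𝓡 2) x).map_target hu
  obtain ⟨ψ, hψ, hψ₀, hJ, hev⟩ := exists_transition hy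
  have hψ₀' : ψ (extChartAt (𝓡 2) (chartInv x u) (chartInv x u)) = u := by
    rw [hψ₀]
    exact (extChartAt (𝓡 2) x).right_inv hu
  rw [meanCurvature_eq_curvH hf]
  have hev' : (fun v => f (chartInv (chartInv x u) v)) =ᶠ[𝓝 (extChartAt (𝓡 2) (chartInv x u)
      (chartInv x u))] fun v => f (chartInv x (ψ v)) := hev.mono fun v hv => by
    simp only
    rw [hv]
  have hcongr : ∀ g₁ g₂ : Plane → Space, ∀ z, g₁ =ᶠ[𝓝 z] g₂ → ∀ n : Plane → Space,
      curvH unit₁ unit₂ g₁ n z = curvH unit₁ unit₂ g₂ n z := by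
    intro g₁ g₂ z h n
    have h1 : ∀ v, pd v g₁ =ᶠ[𝓝 z] pd v g₂ := fun v => by
      filter_upwards [h.eventuallyEq_nhds] with y hy
      simp only [pd]
      rw [hy.fderiv_eq]
    have h2 : ∀ v w, pd v (pd w g₁) z = pd v (pd w g₂) z := fun v w => by
      unfold pd at h1 ⊢
      rw [(h1 w).fderiv_eq]
    simp only [curvH, sff, h2, (h1 _).eq_of_nhds]
  rw [hcongr _ _ _ hev']
  have hs : ContDiffAt ℝ 2 (fun u => f (chartInv x u)) u :=
    ((contDiffOn_comp_chartInv hf x).contDiffAt ((isOpen_chartDom x).mem_nhds hu)).of_le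
      two_le_infty
  rw [curvH_comp_chart (g := fun u => f (chartInv x u)) (by rwa [hψ₀']) (hψ.of_le two_le_infty) hJ,
    hψ₀']
  · rfl
  · rw [hψ₀']
    exact (gramDet_comp_chartInv_pos hf himm x hu).ne'
  · rw [hψ₀']
    exact inner_pd_comp_chartInv hf horth x hu _
  · rw [hψ₀']
    exact inner_pd_comp_chartInv hf horth x hu _

/-- The inner product of the gradients of `u` and `w` on the surface `f`, in the preferred chart
around the point; it does not depend on the chart. -/
def surfaceGradInner (f : M → Space) (u w : M → ℝ) (x : M) : ℝ :=
  gradInnerLoc unit₁ unit₂ (fun v => f (chartInv x v)) (fun v => u (chartInv x v))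
    (fun v => w (chartInv x v)) (extChartAt (𝓡 2) x x)

theorem surfaceGradInner_eq_chart {f : M → Space} (hf : ContMDiff (𝓡 2) 𝓘(ℝ, Space) ∞ f)
    (himm : ∀ x, Function.Injective (mfderiv (𝓡 2) 𝓘(ℝ, Space) f x)) {x : M}
    {v : Plane} (hv : v ∈ chartDom x) {u w : M → ℝ}
    (hu : DifferentiableAt ℝ (fun v => u (chartInv x v)) v)
    (hw : DifferentiableAt ℝ (fun v => w (chartInv x v)) v) :
    surfaceGradInner f u w (chartInv x v) =
      gradInnerLoc unit₁ unit₂ (fun v => f (chartInv x v)) (fun v => u (chartInv x v))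
        (fun v => w (chartInv x v)) v := by
  have hy : chartInv x v ∈ (extChartAt (𝓡 2) x).source := (extChartAt (𝓡 2) x).map_target hv
  obtain ⟨ψ, hψ, hψ₀, hJ, hev⟩ := exists_transition hy
  have hψ₀' : ψ (extChartAt (𝓡 2) (chartInv x v) (chartInv x v)) = v := by
    rw [hψ₀]
    exact (extChartAt (𝓡 2) x).right_inv hv
  have hpd : ∀ (E : Type) [NormedAddCommGroup E] [NormedSpace ℝ E] (g : M → E) (z : Plane),
      pd z (fun v' => g (chartInv (chartInv x v) v'))
        (extChartAt (𝓡 2) (chartInv x v) (chartInv x v)) =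
      pd z (fun v' => g (chartInv x (ψ v')))
        (extChartAt (𝓡 2) (chartInv x v) (chartInv x v)) := by
    intro E _ _ g z
    have hev' : (fun v' => g (chartInv (chartInv x v) v')) =ᶠ[𝓝 (extChartAt (𝓡 2) (chartInv x v)
        (chartInv x v))] fun v' => g (chartInv x (ψ v')) := hev.mono fun v' hv' => by
      simp only
      rw [hv']
    unfold pd
    rw [hev'.fderiv_eq]
  have hs : DifferentiableAt ℝ (fun u => f (chartInv x u)) v :=
    ((contDiffOn_comp_chartInv hf x).contDiffAt
      ((isOpen_chartDom x).mem_nhds hv)).differentiableAt (by simp)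
  have key := gradInnerLoc_comp_chart (x := extChartAt (𝓡 2) (chartInv x v) (chartInv x v))
    (g := fun u => f (chartInv x u)) (u := fun v => u (chartInv x v))
    (w := fun v => w (chartInv x v)) (by rwa [hψ₀']) (by rwa [hψ₀']) (by rwa [hψ₀'])
    (hψ.differentiableAt (by simp)) hJ
    (by rw [hψ₀']; exact (gramDet_comp_chartInv_pos hf himm x hv).ne')
  rw [hψ₀'] at key
  rw [← key]
  simp only [surfaceGradInner, gradInnerLoc, hpd]

end Charts

/-! ### The area measure in a chart -/

section AreaInCharts

variable {M : Type*} [TopologicalSpace M] [ChartedSpace Plane M]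

/-- The inverse of the preferred chart around `x`, as a partial homeomorphism. -/
def chartInvHomeomorph (x : M) : OpenPartialHomeomorph Plane M where
  toPartialEquiv := (extChartAt (𝓡 2) x).symm
  open_source := isOpen_extChartAt_target x
  open_target := isOpen_extChartAt_source x
  continuousOn_toFun := continuousOn_extChartAt_symm x
  continuousOn_invFun := continuousOn_extChartAt x

theorem aemeasurable_areaDensity [IsManifold (𝓡 2) ∞ M] {f : M → Space}
    (hf : ContMDiff (𝓡 2) 𝓘(ℝ, Space) ∞ f) (x : M) :
    AEMeasurable (fun u => ENNReal.ofReal (areaDensity (fun u => f (chartInv x u)) u))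
      (volume.restrict (chartDom x)) :=
  ((areaDensity_continuousOn (isOpen_chartDom x)
    ((contDiffOn_comp_chartInv hf x).of_le (by simp))).aemeasurable
    (isOpen_chartDom x).measurableSet).ennreal_ofReal

variable [MeasurableSpace M] [BorelSpace M]

theorem measurableEmbedding_chartInv (x : M) :
    MeasurableEmbedding ((chartDom x).domRestrict (chartInv x)) :=
  (chartInvHomeomorph x).isOpenEmbedding_restrict.measurableEmbedding

/-- The image of an embedded surface is a countable union of compact sets, hence measurable, even
when it is not closed. -/
theorem measurableEmbedding_of_isEmbedding [SecondCountableTopology M] {f : M → Space}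
    (hf : IsEmbedding f) : MeasurableEmbedding f := by
  have : LocallyCompactSpace M := ChartedSpace.locallyCompactSpace Plane M
  refine hf.measurableEmbedding ?_
  have : range f = ⋃ n, f '' compactCovering M n := by
    rw [← image_iUnion, iUnion_compactCovering, image_univ]
  rw [this]
  exact MeasurableSet.iUnion fun n =>
    ((isCompact_compactCovering M n).image hf.continuous).isClosed.measurableSet

variable [SecondCountableTopology M] [IsManifold (𝓡 2) ∞ M]

/-- The area measure, read in a chart, has the area density as its density. -/
theorem areaMeasure_restrict_chart {f : M → Space} (hf : ContMDiff (𝓡 2) 𝓘(ℝ, Space) ∞ f)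
    (himm : ∀ x, Function.Injective (mfderiv (𝓡 2) 𝓘(ℝ, Space) f x)) (hemb : IsEmbedding f)
    (x : M) :
    (areaMeasure f).restrict (extChartAt (𝓡 2) x).source =
      Measure.map ((chartDom x).domRestrict (chartInv x))
        ((volume.withDensity fun u => ENNReal.ofReal
          (areaDensity (fun u => f (chartInv x u)) u)).comap Subtype.val) := by
  have hfm := measurableEmbedding_of_isEmbedding hemb
  have hcm := measurableEmbedding_chartInv x
  have hval := MeasurableEmbedding.subtype_coe (isOpen_chartDom x).measurableSet
  have hsrc : MeasurableSet (extChartAt (𝓡 2) x).source :=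
    (isOpen_extChartAt_source x).measurableSet
  ext A hA
  have hpre : MeasurableSet ((chartDom x).domRestrict (chartInv x) ⁻¹' A) := hcm.measurable hA
  have hm := hval.measurableSet_image.2 hpre
  rw [Measure.restrict_apply hA, areaMeasure, hfm.comap_apply, hcm.map_apply, hval.comap_apply,
    withDensity_apply _ hm]
  have hsub : Subtype.val '' ((chartDom x).domRestrict (chartInv x) ⁻¹' A) ⊆ chartDom x := by
    rintro _ ⟨u, -, rfl⟩
    exact u.2
  rw [← euclideanHausdorffMeasure_image_eq_lintegral (isOpen_chartDom x)
    ((contDiffOn_comp_chartInv hf x).of_le (by simp)) ?_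
    (fun u hu => gramDet_comp_chartInv_pos hf himm x hu) hsub hm]
  · congr 1
    ext z
    constructor
    · rintro ⟨y, ⟨hyA, hys⟩, rfl⟩
      refine ⟨extChartAt (𝓡 2) x y, ⟨⟨_, (extChartAt (𝓡 2) x).map_source hys⟩, ?_, rfl⟩, ?_⟩
      · change chartInv x (extChartAt (𝓡 2) x y) ∈ A
        rwa [show chartInv x (extChartAt (𝓡 2) x y) = y from (extChartAt (𝓡 2) x).left_inv hys]
      · change f (chartInv x (extChartAt (𝓡 2) x y)) = f y
        rw [show chartInv x (extChartAt (𝓡 2) x y) = y from (extChartAt (𝓡 2) x).left_inv hys]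
    · rintro ⟨_, ⟨u, hu, rfl⟩, rfl⟩
      exact ⟨chartInv x u, ⟨hu, (extChartAt (𝓡 2) x).map_target u.2⟩, rfl⟩
  · intro u hu v hv huv
    exact (extChartAt (𝓡 2) x).symm.injOn hu hv (hemb.injective huv)

theorem integral_areaMeasure_chart {f : M → Space} (hf : ContMDiff (𝓡 2) 𝓘(ℝ, Space) ∞ f)
    (himm : ∀ x, Function.Injective (mfderiv (𝓡 2) 𝓘(ℝ, Space) f x)) (hemb : IsEmbedding f)
    (x : M) {h : M → ℝ} (hh : ∀ y, y ∉ (extChartAt (𝓡 2) x).source → h y = 0) :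
    ∫ y, h y ∂(areaMeasure f) =
      ∫ u in chartDom x, h (chartInv x u) * areaDensity (fun u => f (chartInv x u)) u := by
  have hV := (isOpen_chartDom x).measurableSet
  rw [← setIntegral_eq_integral_of_forall_compl_eq_zero hh, areaMeasure_restrict_chart hf himm hemb,
    (measurableEmbedding_chartInv x).integral_map]
  have := integral_subtype_comap (μ := volume.withDensity fun u => ENNReal.ofReal
    (areaDensity (fun u => f (chartInv x u)) u)) hV (fun u => h (chartInv x u))
  simp only [domRestrict_apply]
  rw [this, setIntegral_withDensity_eq_setIntegral_toReal_smul₀ (aemeasurable_areaDensity hf x)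
    (by simp) _ hV]
  refine setIntegral_congr_fun hV fun u _ => ?_
  simp only [smul_eq_mul]
  rw [ENNReal.toReal_ofReal (show 0 ≤ areaDensity _ _ from Real.sqrt_nonneg _), mul_comm]

theorem integrable_areaMeasure_chart {f : M → Space} (hf : ContMDiff (𝓡 2) 𝓘(ℝ, Space) ∞ f)
    (himm : ∀ x, Function.Injective (mfderiv (𝓡 2) 𝓘(ℝ, Space) f x)) (hemb : IsEmbedding f)
    (x : M) {h : M → ℝ} (hh : ∀ y, y ∉ (extChartAt (𝓡 2) x).source → h y = 0)
    (hint : IntegrableOn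
      (fun u => h (chartInv x u) * areaDensity (fun u => f (chartInv x u)) u) (chartDom x)) :
    Integrable h (areaMeasure f) := by
  have hV := (isOpen_chartDom x).measurableSet
  rw [← integrableOn_iff_integrable_of_support_subset (s := (extChartAt (𝓡 2) x).source)
    (fun y hy => by by_contra hc; exact hy (hh y hc)), IntegrableOn,
    areaMeasure_restrict_chart hf himm hemb, (measurableEmbedding_chartInv x).integrable_map_iff]
  have := (integrableOn_iff_comap_subtypeVal (μ := volume.withDensity fun u => ENNReal.ofReal
    (areaDensity (fun u => f (chartInv x u)) u)) (f := fun u => h (chartInv x u)) hV)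
  refine this.1 ?_
  rw [IntegrableOn, restrict_withDensity hV,
    integrable_withDensity_iff_integrable_smul₀' (aemeasurable_areaDensity hf x) (by simp)]
  refine hint.congr (Eventually.of_forall fun u => ?_)
  simp only [smul_eq_mul]
  rw [ENNReal.toReal_ofReal (show 0 ≤ areaDensity _ _ from Real.sqrt_nonneg _), mul_comm]

end AreaInCharts

/-! ### A mean curvature flow in a chart -/

section FlowInChart

variable {M : Type*} [TopologicalSpace M] [ChartedSpace Plane M]
variable {I : Set ℝ} {F ν : ℝ → M → Space}

/-- A continuous unit normal field along a smooth family of immersions is smooth: near a given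
point `q₀` it is the normalization of the normal part of its value at `q₀`. -/
theorem contDiffOn_normal {W : Type*} [NormedAddCommGroup W] [NormedSpace ℝ W] {Ω : Set W}
    {v w n : W → Space} (hΩ : IsOpen Ω) (hv : ContDiffOn ℝ ∞ v Ω) (hw : ContDiffOn ℝ ∞ w Ω)
    (hn : ContinuousOn n Ω) (hD : ∀ q ∈ Ω, 0 < gramDet (v q) (w q)) (h1 : ∀ q ∈ Ω, ‖n q‖ = 1)
    (hvn : ∀ q ∈ Ω, ⟪v q, n q⟫ = 0) (hwn : ∀ q ∈ Ω, ⟪w q, n q⟫ = 0) : ContDiffOn ℝ ∞ n Ω := by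
  intro q₀ hq₀
  set m : W → Space := fun q => n q₀ - tangentPart (v q) (w q) (n q₀) with hm
  have hmn : ∀ q ∈ Ω, m q = ⟪n q₀, n q⟫ • n q := fun q hq => by
    simp only [hm]
    rw [sub_eq_iff_eq_add']
    exact eq_tangentPart_add (hD q hq) (h1 q hq) (hvn q hq) (hwn q hq) (n q₀)
  have hms : ContDiffOn ℝ ∞ m Ω := by
    have hg : ∀ q ∈ Ω, gramDet (v q) (w q) ≠ 0 := fun q hq => (hD q hq).ne'
    have hgs : ContDiffOn ℝ ∞ (fun q => gramDet (v q) (w q)) Ω :=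
      ((hv.inner ℝ hv).mul (hw.inner ℝ hw)).sub ((hv.inner ℝ hw).pow 2)
    have cv : ContDiffOn ℝ ∞ (fun q => ⟪n q₀, v q⟫) Ω := contDiffOn_const.inner ℝ hv
    have cw : ContDiffOn ℝ ∞ (fun q => ⟪n q₀, w q⟫) Ω := contDiffOn_const.inner ℝ hw
    refine contDiffOn_const.sub (ContDiffOn.add (ContDiffOn.smul (ContDiffOn.div ?_ hgs hg) hv)
      (ContDiffOn.smul (ContDiffOn.div ?_ hgs hg) hw))
    · exact ((hw.inner ℝ hw).mul cv).sub ((hv.inner ℝ hw).mul cw)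
    · exact ((hv.inner ℝ hv).mul cw).sub ((hv.inner ℝ hw).mul cv)
  have hpos : ∀ᶠ q in 𝓝 q₀, 0 < ⟪n q₀, n q⟫ := by
    have hc : ContinuousAt (fun q => ⟪n q₀, n q⟫) q₀ :=
      continuousAt_const.inner (hn.continuousAt (hΩ.mem_nhds hq₀))
    refine hc.eventually (lt_mem_nhds ?_)
    simp only [real_inner_self_eq_norm_sq, h1 q₀ hq₀]
    norm_num
  have hm0 : m q₀ ≠ 0 := by
    rw [hmn q₀ hq₀, real_inner_self_eq_norm_sq, h1 q₀ hq₀, one_pow, one_smul]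
    intro h
    have := h1 q₀ hq₀
    rw [h, norm_zero] at this
    exact zero_ne_one this
  have hmA : ContDiffAt ℝ ∞ m q₀ := hms.contDiffAt (hΩ.mem_nhds hq₀)
  have hs : ContDiffAt ℝ ∞ (fun q => ‖m q‖⁻¹ • m q) q₀ :=
    ((hmA.norm ℝ hm0).inv (norm_ne_zero_iff.2 hm0)).smul hmA
  refine (hs.congr_of_eventuallyEq ?_).contDiffWithinAt
  filter_upwards [hpos, hΩ.mem_nhds hq₀] with q hq hqΩ
  rw [hmn q hqΩ, norm_smul, h1 q hqΩ, mul_one, Real.norm_of_nonneg hq.le, smul_smul,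
    inv_mul_cancel₀ hq.ne', one_smul]

namespace IsSmoothMCF

theorem contMDiff_slice (hF : IsSmoothMCF I F ν) {t : ℝ} (ht : t ∈ I) :
    ContMDiff (𝓡 2) 𝓘(ℝ, Space) ∞ (F t) := by
  have h1 : ContMDiff (𝓡 2) (𝓘(ℝ, ℝ).prod (𝓡 2)) ∞ (fun x : M => (t, x)) :=
    contMDiff_const.prodMk contMDiff_id
  exact hF.smooth.comp_contMDiff h1 fun x => ⟨ht, mem_univ x⟩

theorem continuousOn_normal_chart (hF : IsSmoothMCF I F ν) (x₀ : M) :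
    ContinuousOn (fun q : ℝ × Plane => ν q.1 (chartInv x₀ q.2)) (I ×ˢ chartDom x₀) :=
  hF.normal_continuous.comp (continuousOn_fst.prodMk
    ((continuousOn_chartInv x₀).comp continuousOn_snd fun _ hq => hq.2))
    fun _ hq => ⟨hq.1, mem_univ _⟩

variable [IsManifold (𝓡 2) ∞ M]

/-- The moving surface, read in a chart, is smooth up to the ends of the interval of time. -/
theorem contDiffOn_chart (hF : IsSmoothMCF I F ν) (x₀ : M) :
    ContDiffOn ℝ ∞ (fun q : ℝ × Plane => F q.1 (chartInv x₀ q.2)) (I ×ˢ chartDom x₀) := by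
  rw [← contMDiffOn_iff_contDiffOn]
  have h1 : ContMDiffOn 𝓘(ℝ, ℝ × Plane) 𝓘(ℝ, ℝ) ∞ (Prod.fst : ℝ × Plane → ℝ) (I ×ˢ chartDom x₀) :=
    contDiff_fst.contMDiff.contMDiffOn
  have h2 : ContMDiffOn 𝓘(ℝ, ℝ × Plane) 𝓘(ℝ, Plane) ∞ (Prod.snd : ℝ × Plane → Plane)
      (I ×ˢ chartDom x₀) := contDiff_snd.contMDiff.contMDiffOn
  have h3 : ContMDiffOn 𝓘(ℝ, ℝ × Plane) (𝓡 2) ∞ (fun q : ℝ × Plane => chartInv x₀ q.2)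
      (I ×ˢ chartDom x₀) :=
    (contMDiffOn_extChartAt_symm x₀).comp h2 fun q hq => hq.2
  exact hF.smooth.comp (h1.prodMk h3) fun q hq => ⟨hq.1, mem_univ _⟩

variable {a b : ℝ}

/-- In a chart, the mean curvature is continuous up to the ends of the interval of time, where the
flow is not differentiable as a map on an open set of `ℝ × ℝ²`. -/
theorem continuousOn_meanCurvature_chart (hF : IsSmoothMCF I F ν) (hab : a < b)
    (hsub : Icc a b ⊆ I) (x₀ : M) :
    ContinuousOn (fun q : ℝ × Plane => meanCurvature (F q.1) (ν q.1) (chartInv x₀ q.2))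
      (Icc a b ×ˢ chartDom x₀) := by
  have hS := (hF.contDiffOn_chart x₀).mono (prod_mono hsub subset_rfl)
  have hN := (hF.continuousOn_normal_chart x₀).mono (prod_mono hsub subset_rfl)
  have hJ := uniqueDiffOn_Icc hab
  have hV := isOpen_chartDom x₀
  have hp := fun v => contDiffOn_pd_slice hJ hV hS v
  have hpp := fun v w => (contDiffOn_pd_slice hJ hV (hp w) v).continuousOn
  have hs := fun v w => ((hpp v w).inner (𝕜 := ℝ) hN).neg
  refine (continuousOn_metricTrace (hp unit₁).continuousOn (hp unit₂).continuousOn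
    (hs unit₁ unit₁) (hs unit₁ unit₂) (hs unit₂ unit₂) fun q hq =>
    (gramDet_comp_chartInv_pos (hF.contMDiff_slice (hsub hq.1)) (hF.immersion _ (hsub hq.1)) x₀
      hq.2).ne').congr fun q hq => ?_
  exact meanCurvature_eq_curvH_chart (hF.contMDiff_slice (hsub hq.1))
    (hF.immersion _ (hsub hq.1)) (hF.normal_orthogonal _ (hsub hq.1)) hq.2

theorem continuousOn_areaDensity_chart (hF : IsSmoothMCF I F ν) (hab : a < b)
    (hsub : Icc a b ⊆ I) (x₀ : M) :
    ContinuousOn (fun q : ℝ × Plane => areaDensity (fun u => F q.1 (chartInv x₀ u)) q.2)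
      (Icc a b ×ˢ chartDom x₀) := by
  have hS := (hF.contDiffOn_chart x₀).mono (prod_mono hsub subset_rfl)
  have hp := fun v => (contDiffOn_pd_slice (uniqueDiffOn_Icc hab) (isOpen_chartDom x₀) hS
    v).continuousOn
  exact Real.continuous_sqrt.comp_continuousOn
    ((((hp unit₁).inner (𝕜 := ℝ) (hp unit₁)).mul ((hp unit₂).inner (𝕜 := ℝ) (hp unit₂))).sub
      (((hp unit₁).inner (𝕜 := ℝ) (hp unit₂)).pow 2))

theorem continuous_meanCurvature (hF : IsSmoothMCF I F ν) {t : ℝ} (ht : t ∈ I) :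
    Continuous (meanCurvature (F t) (ν t)) := by
  rw [continuous_iff_continuousAt]
  intro x₀
  have hf := hF.contMDiff_slice ht
  have hV := isOpen_chartDom x₀
  have hS := contDiffOn_comp_chartInv hf x₀
  have hN : ContinuousOn (fun u => ν t (chartInv x₀ u)) (chartDom x₀) :=
    (hF.continuousOn_normal_chart x₀).comp (continuousOn_const.prodMk continuousOn_id)
      fun u hu => ⟨ht, hu⟩
  have hp := fun v => hS.pd hV (m := ∞) le_rfl v
  have hs := fun v w => (((hp w).pd hV (m := ∞) le_rfl v).continuousOn.inner (𝕜 := ℝ) hN).neg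
  have key : ContinuousOn (fun u => meanCurvature (F t) (ν t) (chartInv x₀ u)) (chartDom x₀) :=
    (continuousOn_metricTrace (hp unit₁).continuousOn (hp unit₂).continuousOn
      (hs unit₁ unit₁) (hs unit₁ unit₂) (hs unit₂ unit₂) fun q hq =>
      (gramDet_comp_chartInv_pos hf (hF.immersion t ht) x₀ hq).ne').congr fun q hq =>
    meanCurvature_eq_curvH_chart hf (hF.immersion t ht) (hF.normal_orthogonal t ht) hq
  have h1 := ((key.continuousAt (extChartAt_target_mem_nhds x₀)).comp (x := x₀)
    (continuousAt_extChartAt (I := 𝓡 2) x₀))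
  refine h1.congr ?_
  filter_upwards [extChartAt_source_mem_nhds (I := 𝓡 2) x₀] with y hy
  simp only [Function.comp]
  rw [show chartInv x₀ (extChartAt (𝓡 2) x₀ y) = y from (extChartAt (𝓡 2) x₀).left_inv hy]

theorem pd_chart (hF : IsSmoothMCF I F ν) (hsub : Icc a b ⊆ I) (x₀ : M) {q : ℝ × Plane}
    (hq : q ∈ Ioo a b ×ˢ chartDom x₀) (v : Plane) :
    pd v (fun u => F q.1 (chartInv x₀ u)) q.2 =
      pd ((0 : ℝ), v) (fun q : ℝ × Plane => F q.1 (chartInv x₀ q.2)) q :=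
  pd_slice (G := fun q : ℝ × Plane => F q.1 (chartInv x₀ q.2)) (t := q.1) (u := q.2)
    (((hF.contDiffOn_chart x₀).mono (prod_mono (Ioo_subset_Icc_self.trans hsub) subset_rfl)).diffAt
      (isOpen_Ioo.prod (isOpen_chartDom x₀)) (by simp) hq) v

/-- In a chart and at interior times, the mean curvature is that of the parametrized surface. -/
theorem meanCurvature_chart (hF : IsSmoothMCF I F ν) (hsub : Icc a b ⊆ I) (x₀ : M) {q : ℝ × Plane}
    (hq : q ∈ Ioo a b ×ˢ chartDom x₀) :
    meanCurvature (F q.1) (ν q.1) (chartInv x₀ q.2) =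
      curvH dir₁ dir₂ (fun q : ℝ × Plane => F q.1 (chartInv x₀ q.2))
        (fun q : ℝ × Plane => ν q.1 (chartInv x₀ q.2)) q := by
  have hqI : q.1 ∈ I := hsub (Ioo_subset_Icc_self hq.1)
  have hΩ : IsOpen (Ioo a b ×ˢ chartDom x₀) := isOpen_Ioo.prod (isOpen_chartDom x₀)
  have hS := (hF.contDiffOn_chart x₀).mono
    (prod_mono (Ioo_subset_Icc_self.trans hsub) subset_rfl)
  have hpp : ∀ v w : Plane, pd v (pd w fun u => F q.1 (chartInv x₀ u)) q.2 =
      pd ((0 : ℝ), v) (pd ((0 : ℝ), w) fun q : ℝ × Plane => F q.1 (chartInv x₀ q.2)) q := by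
    intro v w
    rw [pd_congr (isOpen_chartDom x₀) (fun u hu => hF.pd_chart hsub x₀ (q := (q.1, u))
      ⟨hq.1, hu⟩ w) v hq.2]
    exact pd_slice (t := q.1) (u := q.2) ((hS.pd hΩ (m := ∞) le_rfl _).diffAt hΩ (by simp) hq) v
  rw [meanCurvature_eq_curvH_chart (hF.contMDiff_slice hqI) (hF.immersion _ hqI)
    (hF.normal_orthogonal _ hqI) hq.2]
  simp only [curvH, sff, hpp, hF.pd_chart hsub x₀ hq]

/-- In a chart and at interior times, a smooth mean curvature flow is a local one. -/
theorem isLocalMCF (hF : IsSmoothMCF I F ν) (hsub : Icc a b ⊆ I) (x₀ : M) :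
    IsLocalMCF (Ioo a b ×ˢ chartDom x₀) timeDir dir₁ dir₂
      (fun q : ℝ × Plane => F q.1 (chartInv x₀ q.2))
      (fun q : ℝ × Plane => ν q.1 (chartInv x₀ q.2)) := by
  have hΩ : IsOpen (Ioo a b ×ˢ chartDom x₀) := isOpen_Ioo.prod (isOpen_chartDom x₀)
  have hsub' : Ioo a b ⊆ I := Ioo_subset_Icc_self.trans hsub
  have hS := (hF.contDiffOn_chart x₀).mono (prod_mono hsub' subset_rfl)
  have hN := (hF.continuousOn_normal_chart x₀).mono (prod_mono hsub' subset_rfl)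
  have horth : ∀ v : Plane, ∀ q ∈ Ioo a b ×ˢ chartDom x₀,
      ⟪pd ((0 : ℝ), v) (fun q : ℝ × Plane => F q.1 (chartInv x₀ q.2)) q,
        ν q.1 (chartInv x₀ q.2)⟫ = 0 := fun v q hq => by
    rw [← hF.pd_chart hsub x₀ hq]
    exact inner_pd_comp_chartInv (hF.contMDiff_slice (hsub' hq.1))
      (hF.normal_orthogonal _ (hsub' hq.1)) x₀ hq.2 v
  have hD : ∀ q ∈ Ioo a b ×ˢ chartDom x₀,
      0 < gramDet (pd dir₁ (fun q : ℝ × Plane => F q.1 (chartInv x₀ q.2)) q)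
        (pd dir₂ (fun q : ℝ × Plane => F q.1 (chartInv x₀ q.2)) q) := fun q hq => by
    have := gramDet_comp_chartInv_pos (hF.contMDiff_slice (hsub' hq.1))
      (hF.immersion _ (hsub' hq.1)) x₀ hq.2
    rwa [hF.pd_chart hsub x₀ hq, hF.pd_chart hsub x₀ hq] at this
  have hunit : ∀ q ∈ Ioo a b ×ˢ chartDom x₀, ‖ν q.1 (chartInv x₀ q.2)‖ = 1 :=
    fun q hq => hF.normal_unit _ (hsub' hq.1) _
  refine ⟨hΩ, hS, contDiffOn_normal hΩ (hS.pd hΩ (m := ∞) le_rfl _) (hS.pd hΩ (m := ∞) le_rfl _)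
    hN hD hunit (horth _) (horth _), hunit, horth _, horth _, hD, fun q hq => ?_⟩
  rw [← hF.meanCurvature_chart hsub x₀ hq]
  have hd := (hF.evolves q.1 (hsub' hq.1) (chartInv x₀ q.2)).hasDerivAt
    (mem_of_superset (Ioo_mem_nhds hq.1.1 hq.1.2) hsub')
  have h1 : HasDerivAt (fun s : ℝ => (s, q.2)) ((1 : ℝ), (0 : Plane)) q.1 :=
    (hasDerivAt_id q.1).prodMk (hasDerivAt_const q.1 q.2)
  have h2 := HasFDerivAt.comp_hasDerivAt (f := fun s : ℝ => (s, q.2)) q.1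
    (hS.diffAt hΩ (by simp) hq).hasFDerivAt h1
  exact h2.unique hd

end IsSmoothMCF

end FlowInChart

/-! ### Cutoffs on the manifold -/

section Cutoffs

variable {M : Type*} [TopologicalSpace M] [ChartedSpace Plane M]

/-- A smooth nonnegative function on `M` whose support is compact and contained in the domain of
the preferred chart around `x₀`. -/
structure IsChartCutoff (x₀ : M) (φ : M → ℝ) : Prop where
  smooth : ContMDiff (𝓡 2) 𝓘(ℝ, ℝ) ∞ φ
  compact : HasCompactSupport φ
  tsupport_subset : tsupport φ ⊆ (extChartAt (𝓡 2) x₀).source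
  nonneg : ∀ x, 0 ≤ φ x

/-- A finite part of a smooth partition of unity on `M` that is complete on a given compact set. -/
theorem exists_finset_isChartCutoff [T2Space M] [SecondCountableTopology M]
    [IsManifold (𝓡 2) ∞ M] {K : Set M} (hK : IsCompact K) :
    ∃ (s : Finset M) (φ : M → M → ℝ), (∀ i, IsChartCutoff i (φ i)) ∧
      ∀ x ∈ K, ∑ i ∈ s, φ i x = 1 := by
  have : LocallyCompactSpace M := ChartedSpace.locallyCompactSpace Plane M
  have hC : ∀ i : M, ∃ C : Set M, IsCompact C ∧ i ∈ interior C ∧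
      C ⊆ (extChartAt (𝓡 2) i).source := fun i =>
    exists_compact_subset (isOpen_extChartAt_source i) (mem_extChartAt_source i)
  choose C hC hiC hCs using hC
  obtain ⟨f, hf⟩ := SmoothPartitionOfUnity.exists_isSubordinate (𝓡 2) (isClosed_univ (X := M))
    (fun i => interior (C i)) (fun i => isOpen_interior)
    (fun i _ => mem_iUnion_of_mem i (hiC i))
  have hfin := f.locallyFinite.finite_nonempty_inter_compact hK
  refine ⟨hfin.toFinset, fun i => f i, fun i => ⟨(f i).contMDiff, ?_, ?_, f.nonneg i⟩, ?_⟩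
  · exact (hC i).of_isClosed_subset (isClosed_tsupport _) ((hf i).trans interior_subset)
  · exact ((hf i).trans interior_subset).trans (hCs i)
  · intro x hx
    rw [← f.sum_eq_one (mem_univ x)]
    refine (finsum_eq_sum_of_support_subset _ fun i hi => ?_).symm
    simp only [Finite.coe_toFinset, mem_ofPred_eq]
    exact ⟨x, hi, hx⟩

/-- A cutoff of the chart around `x₀`, read in the chart and extended by zero. -/
def localCutoff (x₀ : M) (φ : M → ℝ) : Plane → ℝ :=
  (chartDom x₀).indicator fun u => φ (chartInv x₀ u)

namespace IsChartCutoff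

variable {x₀ : M} {φ : M → ℝ}

theorem eq_zero (h : IsChartCutoff x₀ φ) {y : M} (hy : y ∉ (extChartAt (𝓡 2) x₀).source) :
    φ y = 0 :=
  image_eq_zero_of_notMem_tsupport fun h' => hy (h.tsupport_subset h')

theorem isCompact_image (h : IsChartCutoff x₀ φ) :
    IsCompact (extChartAt (𝓡 2) x₀ '' tsupport φ) :=
  h.compact.image_of_continuousOn ((continuousOn_extChartAt x₀).mono h.tsupport_subset)

theorem localCutoff_eq_zero {u : Plane} (hu : u ∉ extChartAt (𝓡 2) x₀ '' tsupport φ) :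
    localCutoff x₀ φ u = 0 := by
  unfold localCutoff
  by_cases huV : u ∈ chartDom x₀
  · rw [indicator_of_mem huV]
    refine image_eq_zero_of_notMem_tsupport fun h' => hu ⟨_, h', ?_⟩
    exact (extChartAt (𝓡 2) x₀).right_inv huV
  · rw [indicator_of_notMem huV]

theorem tsupport_localCutoff_subset_image (h : IsChartCutoff x₀ φ) :
    tsupport (localCutoff x₀ φ) ⊆ extChartAt (𝓡 2) x₀ '' tsupport φ := by
  refine closure_minimal (fun u hu => ?_) h.isCompact_image.isClosed
  by_contra hc
  exact hu (localCutoff_eq_zero hc)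

theorem tsupport_localCutoff_subset (h : IsChartCutoff x₀ φ) :
    tsupport (localCutoff x₀ φ) ⊆ chartDom x₀ := by
  refine h.tsupport_localCutoff_subset_image.trans ?_
  rintro _ ⟨y, hy, rfl⟩
  exact (extChartAt (𝓡 2) x₀).map_source (h.tsupport_subset hy)

theorem hasCompactSupport_localCutoff (h : IsChartCutoff x₀ φ) :
    HasCompactSupport (localCutoff x₀ φ) :=
  h.isCompact_image.of_isClosed_subset (isClosed_tsupport _) h.tsupport_localCutoff_subset_image

theorem localCutoff_nonneg (h : IsChartCutoff x₀ φ) (u : Plane) : 0 ≤ localCutoff x₀ φ u :=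
  indicator_nonneg (fun _ _ => h.nonneg _) u

theorem contDiff_localCutoff [IsManifold (𝓡 2) ∞ M] (h : IsChartCutoff x₀ φ) :
    ContDiff ℝ ∞ (localCutoff x₀ φ) := by
  have hV := isOpen_chartDom x₀
  rw [contDiff_iff_contDiffAt]
  intro u
  by_cases hu : u ∈ chartDom x₀
  · have hs : ContDiffOn ℝ ∞ (fun u => φ (chartInv x₀ u)) (chartDom x₀) := by
      rw [← contMDiffOn_iff_contDiffOn]
      exact h.smooth.comp_contMDiffOn (contMDiffOn_extChartAt_symm x₀)
    refine (hs.contDiffAt (hV.mem_nhds hu)).congr_of_eventuallyEq ?_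
    filter_upwards [hV.mem_nhds hu] with v hv
    exact indicator_of_mem hv _
  · have : u ∉ tsupport (localCutoff x₀ φ) := fun h' => hu (h.tsupport_localCutoff_subset h')
    exact contDiffAt_const.congr_of_eventuallyEq (notMem_tsupport_iff_eventuallyEq.1 this)

end IsChartCutoff

end Cutoffs

section SurfaceGradient

variable {M : Type*} [TopologicalSpace M] [ChartedSpace Plane M] {f : M → Space} {u w : M → ℝ}
  {x : M}

theorem pd_comp_chartInv_eq_zero {z : Plane}
    (h : fderiv ℝ (fun v => u (chartInv x v)) (extChartAt (𝓡 2) x x) = 0) :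
    pd z (fun v => u (chartInv x v)) (extChartAt (𝓡 2) x x) = 0 := by
  rw [pd, h]
  rfl

theorem tendsto_chartInv (x : M) : Tendsto (chartInv x) (𝓝 (extChartAt (𝓡 2) x x)) (𝓝 x) := by
  have := (continuousOn_chartInv x).continuousAt (extChartAt_target_mem_nhds (I := 𝓡 2) x)
  rwa [ContinuousAt, show chartInv x (extChartAt (𝓡 2) x x) = x from extChartAt_to_inv x] at this

theorem surfaceGradInner_eq_zero_of_eventually_eq {c : ℝ} (h : ∀ᶠ y in 𝓝 x, u y = c) :
    surfaceGradInner f u w x = 0 := by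
  have h1 : (fun v => u (chartInv x v)) =ᶠ[𝓝 (extChartAt (𝓡 2) x x)] fun _ => c :=
    (tendsto_chartInv x).eventually h
  have h2 : fderiv ℝ (fun v => u (chartInv x v)) (extChartAt (𝓡 2) x x) = 0 := by
    rw [h1.fderiv_eq, fderiv_fun_const]
    rfl
  rw [surfaceGradInner, gradInnerLoc, pd_comp_chartInv_eq_zero h2, pd_comp_chartInv_eq_zero h2,
    dualInner]
  ring

/-- The differential of a function vanishes where the function attains its minimum. -/
theorem surfaceGradInner_eq_zero_of_isMin (h : ∀ y, w x ≤ w y) :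
    surfaceGradInner f u w x = 0 := by
  have h2 : fderiv ℝ (fun v => w (chartInv x v)) (extChartAt (𝓡 2) x x) = 0 := by
    refine IsLocalMin.fderiv_eq_zero (Eventually.of_forall fun v => ?_)
    simp only
    rw [show chartInv x (extChartAt (𝓡 2) x x) = x from extChartAt_to_inv x]
    exact h _
  rw [surfaceGradInner, gradInnerLoc, pd_comp_chartInv_eq_zero h2, pd_comp_chartInv_eq_zero h2,
    dualInner]
  ring

theorem sum_surfaceGradInner {ι : Type*} (s : Finset ι) (φ : ι → M → ℝ)
    (h : ∀ i ∈ s, DifferentiableAt ℝ (fun v => φ i (chartInv x v)) (extChartAt (𝓡 2) x x)) :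
    ∑ i ∈ s, surfaceGradInner f (φ i) w x =
      surfaceGradInner f (fun y => ∑ i ∈ s, φ i y) w x := by
  have hp : ∀ z, pd z (fun v => ∑ i ∈ s, φ i (chartInv x v)) (extChartAt (𝓡 2) x x) =
      ∑ i ∈ s, pd z (fun v => φ i (chartInv x v)) (extChartAt (𝓡 2) x x) := fun z => by
    unfold pd
    rw [fderiv_fun_sum h, _root_.sum_apply]
  simp only [surfaceGradInner, gradInnerLoc, dualInner, hp]
  rw [← Finset.sum_div]
  congr 1
  simp only [Finset.sum_add_distrib, Finset.sum_sub_distrib, Finset.sum_mul, ← Finset.mul_sum]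

end SurfaceGradient

/-! ### The weighted area of a piece of the surface -/

section WeightedArea

variable {M : Type*} [TopologicalSpace M] [ChartedSpace Plane M] {I : Set ℝ} {F ν : ℝ → M → Space}
  {p : Space} {t₀ a b c δ : ℝ}

/-- The backward heat kernel centred at `(p, t₀)`, up to the factor `1 / (4π)`, on the moving
surface. -/
def heatWeight (F : ℝ → M → Space) (p : Space) (t₀ t : ℝ) (x : M) : ℝ :=
  1 / (t₀ - t) * Real.exp (-(‖F t x - p‖ ^ 2 / (4 * (t₀ - t))))

/-- The truncation `exp(-cH) - δ (|x - p|² + 4 (t - a))` of `exp(-cH)`; where `H ≥ 0` and `t ≥ a`,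
it is positive on a bounded set only. -/
def cutoffExp (F ν : ℝ → M → Space) (p : Space) (a c δ t : ℝ) (x : M) : ℝ :=
  Real.exp (-c * meanCurvature (F t) (ν t) x) - δ * (‖F t x - p‖ ^ 2 + 4 * (t - a))

/-- The weight `max(exp(-cH) - δ (|x - p|² + 4 (t - a)), 0)³`, which tends to `exp(-3cH)` as `δ`
tends to zero. The cube makes it twice differentiable. -/
def cutoffWeight (F ν : ℝ → M → Space) (p : Space) (a c δ t : ℝ) (x : M) : ℝ :=
  max (cutoffExp F ν p a c δ t x) 0 ^ 3

theorem cutoffWeight_nonneg (t : ℝ) (x : M) : 0 ≤ cutoffWeight F ν p a c δ t x :=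
  pow_nonneg (le_max_right _ _) 3

theorem heatWeight_nonneg {S : Type*} {F : ℝ → S → Space} {t : ℝ} (ht : t < t₀) (x : S) :
    0 ≤ heatWeight F p t₀ t x :=
  mul_nonneg (one_div_nonneg.2 (sub_pos.2 ht).le) (Real.exp_pos _).le

theorem heatWeight_eq_exp_logKernel (x₀ : M) {q : ℝ × Plane} (hq : q.1 < t₀) :
    heatWeight F p t₀ q.1 (chartInv x₀ q.2) =
      Real.exp (logKernel (fun q : ℝ × Plane => F q.1 (chartInv x₀ q.2))
        (ContinuousLinearMap.fst ℝ ℝ Plane) p t₀ q) := by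
  rw [heatWeight, logKernel, sqDist, real_inner_self_eq_norm_sq, ContinuousLinearMap.coe_fst',
    sub_eq_add_neg (-Real.log _), Real.exp_add, Real.exp_neg (Real.log _),
    Real.exp_log (sub_pos.2 hq), one_div, div_eq_inv_mul]

/-- The boundary term which the cutoff `φ` brings into Green's formula, on the surface. -/
def surfaceGreenTerm (f : M → Space) (φ w ρ : M → ℝ) (x : M) : ℝ :=
  ρ x * surfaceGradInner f φ w x - w x * surfaceGradInner f φ ρ x

theorem surfaceGreenTerm_eq_zero {x₀ : M} {φ : M → ℝ} (hφ : IsChartCutoff x₀ φ) {f : M → Space}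
    {w ρ : M → ℝ} {y : M} (hy : y ∉ (extChartAt (𝓡 2) x₀).source) :
    surfaceGreenTerm f φ w ρ y = 0 := by
  have h : ∀ᶠ z in 𝓝 y, φ z = 0 :=
    notMem_tsupport_iff_eventuallyEq.1 fun h' => hy (hφ.tsupport_subset h')
  rw [surfaceGreenTerm, surfaceGradInner_eq_zero_of_eventually_eq h,
    surfaceGradInner_eq_zero_of_eventually_eq h]
  ring

variable [IsManifold (𝓡 2) ∞ M]

namespace IsSmoothMCF

theorem continuousOn_cutoffWeight_chart (hF : IsSmoothMCF I F ν) (hab : a < b)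
    (hsub : Icc a b ⊆ I) (x₀ : M) :
    ContinuousOn (fun q : ℝ × Plane => cutoffWeight F ν p a c δ q.1 (chartInv x₀ q.2))
      (Icc a b ×ˢ chartDom x₀) := by
  have hH := hF.continuousOn_meanCurvature_chart hab hsub x₀
  have hS := ((hF.contDiffOn_chart x₀).mono (prod_mono hsub subset_rfl)).continuousOn
  have h1 : ContinuousOn (fun q : ℝ × Plane => cutoffExp F ν p a c δ q.1 (chartInv x₀ q.2))
      (Icc a b ×ˢ chartDom x₀) :=
    (continuousOn_const.mul hH).rexp.sub (continuousOn_const.mul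
      (((hS.sub continuousOn_const).norm.pow 2).add
        (continuousOn_const.mul (continuousOn_fst.sub continuousOn_const))))
  exact (h1.sup continuousOn_const).pow 3

theorem continuousOn_heatWeight_chart (hF : IsSmoothMCF I F ν) (hb : b < t₀)
    (hsub : Icc a b ⊆ I) (x₀ : M) :
    ContinuousOn (fun q : ℝ × Plane => heatWeight F p t₀ q.1 (chartInv x₀ q.2))
      (Icc a b ×ˢ chartDom x₀) := by
  have hS := ((hF.contDiffOn_chart x₀).mono (prod_mono hsub subset_rfl)).continuousOn
  have ht : ContinuousOn (fun q : ℝ × Plane => t₀ - q.1) (Icc a b ×ˢ chartDom x₀) :=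
    continuousOn_const.sub continuousOn_fst
  have hne : ∀ q ∈ Icc a b ×ˢ chartDom x₀, t₀ - q.1 ≠ 0 := fun q hq =>
    (sub_pos.2 (hq.1.2.trans_lt hb)).ne'
  exact (continuousOn_const.div ht hne).mul
    ((((hS.sub continuousOn_const).norm.pow 2).div (continuousOn_const.mul ht)
      fun q hq => mul_ne_zero four_ne_zero (hne q hq)).neg.rexp)

theorem cutoffWeight_chart (hF : IsSmoothMCF I F ν) (hsub : Icc a b ⊆ I) (x₀ : M) {q : ℝ × Plane}
    (hq : q ∈ Ioo a b ×ˢ chartDom x₀) :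
    cutoffWeight F ν p a c δ q.1 (chartInv x₀ q.2) =
      max (barrier (curvH dir₁ dir₂ (fun q : ℝ × Plane => F q.1 (chartInv x₀ q.2))
        (fun q : ℝ × Plane => ν q.1 (chartInv x₀ q.2)))
        (fun q : ℝ × Plane => F q.1 (chartInv x₀ q.2)) (ContinuousLinearMap.fst ℝ ℝ Plane)
        p a c δ q) 0 ^ 3 := by
  rw [cutoffWeight, cutoffExp, hF.meanCurvature_chart hsub x₀ hq, barrier, sqDist,
    real_inner_self_eq_norm_sq, ContinuousLinearMap.coe_fst']
  ring_nf

end IsSmoothMCF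

namespace IsSmoothMCF

variable [SecondCountableTopology M] [MeasurableSpace M] [BorelSpace M] {x₀ : M} {φ : M → ℝ}

theorem integral_cutoff_mul (hF : IsSmoothMCF I F ν) (hφ : IsChartCutoff x₀ φ) {t : ℝ}
    (ht : t ∈ I) (h : M → ℝ) :
    ∫ x, φ x * h x ∂(areaMeasure (F t)) = ∫ u, localCutoff x₀ φ u *
      (h (chartInv x₀ u) * areaDensity (fun u => F t (chartInv x₀ u)) u) := by
  rw [integral_areaMeasure_chart (hF.contMDiff_slice ht) (hF.immersion t ht) (hF.embedding t ht) x₀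
    fun y hy => by rw [hφ.eq_zero hy, zero_mul],
    ← setIntegral_eq_integral_of_forall_compl_eq_zero (s := chartDom x₀)
      (f := fun u => localCutoff x₀ φ u * _) (fun u hu => by
        simp only [localCutoff]
        rw [indicator_of_notMem hu, zero_mul])]
  refine setIntegral_congr_fun (isOpen_chartDom x₀).measurableSet fun u hu => ?_
  simp only [localCutoff]
  rw [indicator_of_mem hu]
  ring

theorem integrable_cutoff_weight (hF : IsSmoothMCF I F ν) (hφ : IsChartCutoff x₀ φ) (hab : a < b)
    (hb : b < t₀) (hsub : Icc a b ⊆ I) {t : ℝ} (ht : t ∈ Icc a b) :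
    Integrable (fun x => φ x * (cutoffWeight F ν p a c δ t x * heatWeight F p t₀ t x))
      (areaMeasure (F t)) := by
  have hmap : MapsTo (fun u : Plane => (t, u)) (chartDom x₀) (Icc a b ×ˢ chartDom x₀) :=
    fun u hu => ⟨ht, hu⟩
  have hG := (((hF.continuousOn_cutoffWeight_chart (p := p) (c := c) (δ := δ) hab hsub x₀).mul
    (hF.continuousOn_heatWeight_chart (p := p) hb hsub x₀)).mul
    (hF.continuousOn_areaDensity_chart hab hsub x₀)).comp (by fun_prop) hmap
  refine integrable_areaMeasure_chart (hF.contMDiff_slice (hsub ht)) (hF.immersion t (hsub ht))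
    (hF.embedding t (hsub ht)) x₀ (fun y hy => by rw [hφ.eq_zero hy, zero_mul]) ?_
  refine (integrable_cutoff_mul (isOpen_chartDom x₀) hφ.contDiff_localCutoff.continuous
    hφ.hasCompactSupport_localCutoff hφ.tsupport_localCutoff_subset hG).integrableOn.congr_fun
    (fun u hu => ?_) (isOpen_chartDom x₀).measurableSet
  simp only [localCutoff, Function.comp, Pi.mul_apply]
  rw [indicator_of_mem hu]
  ring

theorem continuousOn_integral_cutoff_weight (hF : IsSmoothMCF I F ν) (hφ : IsChartCutoff x₀ φ)
    (hab : a < b) (hb : b < t₀) (hsub : Icc a b ⊆ I) :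
    ContinuousOn (fun t => ∫ x, φ x * (cutoffWeight F ν p a c δ t x * heatWeight F p t₀ t x)
      ∂(areaMeasure (F t))) (Icc a b) := by
  have hG := ((hF.continuousOn_cutoffWeight_chart (p := p) (c := c) (δ := δ) hab hsub x₀).mul
    (hF.continuousOn_heatWeight_chart (p := p) hb hsub x₀)).mul
    (hF.continuousOn_areaDensity_chart hab hsub x₀)
  refine (continuousOn_integral_cutoff_mul (isOpen_chartDom x₀)
    hφ.contDiff_localCutoff.continuous hφ.hasCompactSupport_localCutoff
    hφ.tsupport_localCutoff_subset hG).congr fun t ht => ?_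
  exact hF.integral_cutoff_mul hφ (hsub ht) _

/-- The weighted area of the part of the surface cut off by `φ` decreases up to the boundary term
in Green's formula. -/
theorem hasDerivAt_integral_cutoff_weight (hF : IsSmoothMCF I F ν) (hconvex : IsMeanConvex I F ν)
    (hφ : IsChartCutoff x₀ φ) (hb : b < t₀) (hsub : Icc a b ⊆ I) (hc : 0 ≤ c)
    {t : ℝ} (ht : t ∈ Ioo a b) :
    ∃ d, HasDerivAt (fun t => ∫ x, φ x * (cutoffWeight F ν p a c δ t x * heatWeight F p t₀ t x)
        ∂(areaMeasure (F t))) d t ∧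
      Integrable (surfaceGreenTerm (F t) φ (cutoffWeight F ν p a c δ t) (heatWeight F p t₀ t))
        (areaMeasure (F t)) ∧
      d ≤ -∫ x, surfaceGreenTerm (F t) φ (cutoffWeight F ν p a c δ t) (heatWeight F p t₀ t) x
        ∂(areaMeasure (F t)) := by
  have hV := isOpen_chartDom x₀
  have h := hF.isLocalMCF hsub x₀
  have hΩ := h.isOpen
  set X : ℝ × Plane → Space := fun q => F q.1 (chartInv x₀ q.2) with hX
  set N : ℝ × Plane → Space := fun q => ν q.1 (chartInv x₀ q.2) with hN
  set T := ContinuousLinearMap.fst ℝ ℝ Plane with hTdef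
  set χ := localCutoff x₀ φ with hχdef
  set f : ℝ × Plane → ℝ := barrier (curvH dir₁ dir₂ X N) X T p a c δ with hf
  set w : ℝ × Plane → ℝ := fun q => max (f q) 0 ^ 3 with hw
  set ρ : ℝ × Plane → ℝ := fun q => Real.exp (logKernel X T p t₀ q) with hρ
  have hsub' : Ioo a b ⊆ I := Ioo_subset_Icc_self.trans hsub
  have hwq : ∀ q ∈ Ioo a b ×ˢ chartDom x₀, cutoffWeight F ν p a c δ q.1 (chartInv x₀ q.2) = w q :=
    fun q hq => hF.cutoffWeight_chart hsub x₀ hq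
  have hρq : ∀ q ∈ Ioo a b ×ˢ chartDom x₀, heatWeight F p t₀ q.1 (chartInv x₀ q.2) = ρ q :=
    fun q hq => heatWeight_eq_exp_logKernel x₀ (hq.1.2.trans hb)
  have hT : ∀ q ∈ Ioo a b ×ˢ chartDom x₀, T q < t₀ := fun q hq => hq.1.2.trans hb
  have hfs : ContDiffOn ℝ 2 f (Ioo a b ×ˢ chartDom x₀) :=
    (h.smooth_barrier a c δ).of_le two_le_infty
  have hws : ContDiffOn ℝ 2 w (Ioo a b ×ˢ chartDom x₀) := contDiff_posPart_cube.comp_contDiffOn hfs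
  have hρs : ContDiffOn ℝ 2 ρ (Ioo a b ×ˢ chartDom x₀) :=
    ((h.smooth_logKernel hT).of_le two_le_infty).exp
  have hχ1 : ContDiff ℝ 1 χ := hφ.contDiff_localCutoff.of_le (by simp)
  have hDq : ∀ q ∈ Ioo a b ×ˢ chartDom x₀, areaDensity (fun u => F q.1 (chartInv x₀ u)) q.2 =
      √(gramDet (pd dir₁ X q) (pd dir₂ X q)) := fun q hq => by
    rw [← hF.pd_chart hsub x₀ hq, ← hF.pd_chart hsub x₀ hq]
    rfl
  have hT0 : T timeDir = 1 := rfl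
  have hT1 : T dir₁ = 0 := rfl
  have hT2 : T dir₂ = 0 := rfl
  obtain ⟨d, hd, hint, hle⟩ := h.hasDerivAt_weighted_area hV hχ1 hφ.hasCompactSupport_localCutoff
    hφ.tsupport_localCutoff_subset hφ.localCutoff_nonneg hws hρs
    (fun _ _ => pow_nonneg (le_max_right _ (0 : ℝ)) 3) (fun _ _ => (Real.exp_pos _).le)
    (fun q hq => h.heat_posPart_cube_nonpos hq hfs
      (h.heat_barrier_nonpos hq hT0 hT1 hT2 (by
        rw [← hF.meanCurvature_chart hsub x₀ hq]
        exact hconvex _ (hsub' hq.1) _) a δ hc))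
    (fun q hq => h.conjugate_heat_kernel_le hq hT hT0 hT1 hT2) ht
  have hgreen : ∀ u ∈ chartDom x₀, surfaceGreenTerm (F t) φ (cutoffWeight F ν p a c δ t)
      (heatWeight F p t₀ t) (chartInv x₀ u) * areaDensity (fun u => F t (chartInv x₀ u)) u =
      greenTerm X χ w ρ (t, u) * √(gramDet (pd dir₁ X (t, u)) (pd dir₂ X (t, u))) := by
    intro u hu
    have hq : (t, u) ∈ Ioo a b ×ˢ chartDom x₀ := ⟨ht, hu⟩
    have hχd : DifferentiableAt ℝ χ u := hχ1.differentiable one_ne_zero u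
    have hevχ : (fun u => φ (chartInv x₀ u)) =ᶠ[𝓝 u] χ := by
      filter_upwards [hV.mem_nhds hu] with v hv
      exact (indicator_of_mem hv fun u => φ (chartInv x₀ u)).symm
    -- A function on the surface and its local representative have the same gradient.
    have hgrad : ∀ (g : M → ℝ) (G : ℝ × Plane → ℝ), ContDiffOn ℝ 2 G (Ioo a b ×ˢ chartDom x₀) →
        (∀ q ∈ Ioo a b ×ˢ chartDom x₀, q.1 = t → g (chartInv x₀ q.2) = G q) →
        surfaceGradInner (F t) φ g (chartInv x₀ u) =
          gradInnerLoc dir₁ dir₂ X (fun x => χ x.2) G (t, u) := by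
      intro g G hG hgG
      have hGd := hG.diffAt hΩ two_ne_zero hq
      have hevg : (fun u => g (chartInv x₀ u)) =ᶠ[𝓝 u] fun u => G (t, u) := by
        filter_upwards [hV.mem_nhds hu] with v hv
        exact hgG (t, v) ⟨ht, hv⟩ rfl
      have hGt : DifferentiableAt ℝ (fun u => G (t, u)) u :=
        (hasFDerivAt_slice hGd).differentiableAt
      have e1 : ∀ v : Plane, pd v (fun u => φ (chartInv x₀ u)) u =
          pd ((0 : ℝ), v) (fun x => χ x.2) (t, u) := fun v => by
        rw [pd_snd hχ1, pd, hevχ.fderiv_eq]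
        rfl
      have e2 : ∀ v : Plane, pd v (fun u => g (chartInv x₀ u)) u = pd ((0 : ℝ), v) G (t, u) :=
        fun v => by
          rw [← pd_slice hGd, pd, hevg.fderiv_eq]
          rfl
      rw [surfaceGradInner_eq_chart (hF.contMDiff_slice (hsub' ht)) (hF.immersion t (hsub' ht)) hu
        (hχd.congr_of_eventuallyEq hevχ) (hGt.congr_of_eventuallyEq hevg)]
      simp only [gradInnerLoc, e1, e2, hF.pd_chart hsub x₀ hq]
      rfl
    rw [surfaceGreenTerm, greenTerm, hDq _ hq,
      hgrad (cutoffWeight F ν p a c δ t) w hws (fun q hq h => by rw [← h]; exact hwq q hq),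
      hgrad (heatWeight F p t₀ t) ρ hρs (fun q hq h => by rw [← h]; exact hρq q hq),
      hwq _ hq, hρq _ hq]
  have hgreen0 : ∀ u ∉ chartDom x₀,
      greenTerm X χ w ρ (t, u) * √(gramDet (pd dir₁ X (t, u)) (pd dir₂ X (t, u))) = 0 := by
    intro u hu
    have hu' : u ∉ tsupport χ := fun h' => hu (hφ.tsupport_localCutoff_subset h')
    have z : ∀ v, pd v χ u = 0 := fun v =>
      image_eq_zero_of_notMem_tsupport (f := pd v χ) fun h' =>
        hu' (tsupport_fderiv_apply_subset ℝ v h')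
    simp only [greenTerm, gradInnerLoc, dualInner, pd_snd hχ1, z]
    ring
  have hf' := hF.contMDiff_slice (hsub' ht)
  have himm := hF.immersion t (hsub' ht)
  have hemb := hF.embedding t (hsub' ht)
  refine ⟨d, hd.congr_of_eventuallyEq ?_, ?_, ?_⟩
  · filter_upwards [Ioo_mem_nhds ht.1 ht.2] with s hs
    rw [hF.integral_cutoff_mul hφ (hsub' hs)]
    congr 1
    ext u
    by_cases hu : u ∈ chartDom x₀
    · rw [hwq (s, u) ⟨hs, hu⟩, hρq (s, u) ⟨hs, hu⟩, hDq (s, u) ⟨hs, hu⟩]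
    · rw [hχdef, localCutoff, indicator_of_notMem hu, zero_mul, zero_mul]
  · exact integrable_areaMeasure_chart hf' himm hemb x₀ (fun y hy => surfaceGreenTerm_eq_zero hφ hy)
      (hint.integrableOn.congr_fun (fun u hu => (hgreen u hu).symm) hV.measurableSet)
  · rw [integral_areaMeasure_chart hf' himm hemb x₀ (fun y hy => surfaceGreenTerm_eq_zero hφ hy),
      setIntegral_congr_fun hV.measurableSet hgreen,
      setIntegral_eq_integral_of_forall_compl_eq_zero hgreen0]
    exact hle

end IsSmoothMCF

end WeightedArea

/-! ### Monotonicity of the weighted area -/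

section Monotonicity

variable {M : Type*} [TopologicalSpace M] [ChartedSpace Plane M] {I : Set ℝ} {F ν : ℝ → M → Space}
  {p : Space} {t₀ a b c δ : ℝ}

theorem norm_sq_le_of_cutoffWeight_ne_zero (hδ : 0 < δ) (hc : 0 ≤ c) {t : ℝ} (hat : a ≤ t) {x : M}
    (hH : 0 ≤ meanCurvature (F t) (ν t) x) (h : cutoffWeight F ν p a c δ t x ≠ 0) :
    ‖F t x - p‖ ^ 2 ≤ 1 / δ := by
  have h0 : 0 < cutoffExp F ν p a c δ t x := by
    by_contra! h0
    exact h (by rw [cutoffWeight, max_eq_right h0]; norm_num)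
  have h1 : Real.exp (-c * meanCurvature (F t) (ν t) x) ≤ 1 :=
    Real.exp_le_one_iff.2 (by nlinarith [mul_nonneg hc hH])
  have h2 : 0 ≤ δ * (4 * (t - a)) := mul_nonneg hδ.le (by linarith)
  rw [cutoffExp] at h0
  rw [le_div_iff₀ hδ]
  nlinarith

theorem cutoffWeight_le (hδ : 0 ≤ δ) {t : ℝ} (hat : a ≤ t) (x : M) :
    cutoffWeight F ν p a c δ t x ≤ Real.exp (-c * meanCurvature (F t) (ν t) x) ^ 3 := by
  refine pow_le_pow_left₀ (le_max_right _ _) (max_le ?_ (Real.exp_pos _).le) 3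
  rw [cutoffExp]
  have h1 : 0 ≤ ‖F t x - p‖ ^ 2 + 4 * (t - a) := by nlinarith [sq_nonneg ‖F t x - p‖]
  linarith [mul_nonneg hδ h1]

namespace IsSmoothMCF

theorem continuous_heatWeight (hF : IsSmoothMCF I F ν) {t : ℝ} (ht : t ∈ I) :
    Continuous (heatWeight F p t₀ t) := by
  have h := (hF.embedding t ht).continuous
  unfold heatWeight
  fun_prop

variable [IsManifold (𝓡 2) ∞ M]

theorem continuous_cutoffWeight (hF : IsSmoothMCF I F ν) {t : ℝ} (ht : t ∈ I) :
    Continuous (cutoffWeight F ν p a c δ t) := by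
  have h := (hF.embedding t ht).continuous
  have hH := hF.continuous_meanCurvature ht
  unfold cutoffWeight cutoffExp
  fun_prop

variable [MeasurableSpace M] [BorelSpace M]

/-- As `δ` tends to zero, the area weighted by the truncated weight tends to the area weighted by
`exp(-3cH)`. -/
theorem tendsto_integral_cutoffWeight (hF : IsSmoothMCF I F ν) (hconvex : IsMeanConvex I F ν)
    (hc : 0 ≤ c) {t : ℝ} (ht : t ∈ I) (hat : a ≤ t) (htt : t < t₀)
    (hint : Integrable (heatWeight F p t₀ t) (areaMeasure (F t))) :
    Tendsto (fun n : ℕ => ∫ x, cutoffWeight F ν p a c (1 / ((n : ℝ) + 1)) t x *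
      heatWeight F p t₀ t x ∂(areaMeasure (F t))) atTop
      (𝓝 (∫ x, Real.exp (-c * meanCurvature (F t) (ν t) x) ^ 3 * heatWeight F p t₀ t x
        ∂(areaMeasure (F t)))) := by
  refine tendsto_integral_of_dominated_convergence (heatWeight F p t₀ t) (fun n => ?_) hint
    (fun n => Eventually.of_forall fun x => ?_) (Eventually.of_forall fun x => ?_)
  · exact ((hF.continuous_cutoffWeight ht).mul
      (hF.continuous_heatWeight ht)).aestronglyMeasurable
  · have h0 := heatWeight_nonneg (F := F) (p := p) htt x
    rw [Real.norm_of_nonneg (mul_nonneg (cutoffWeight_nonneg t x) h0)]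
    refine mul_le_of_le_one_left h0 ((cutoffWeight_le (by positivity) hat x).trans ?_)
    refine pow_le_one₀ (Real.exp_pos _).le (Real.exp_le_one_iff.2 ?_)
    nlinarith [mul_nonneg hc (hconvex t ht x)]
  · refine Tendsto.mul_const _ ?_
    have h1 : Tendsto (fun δ : ℝ => cutoffWeight F ν p a c δ t x) (𝓝 0)
        (𝓝 (cutoffWeight F ν p a c 0 t x)) := by
      have : Continuous fun δ : ℝ => cutoffWeight F ν p a c δ t x := by
        unfold cutoffWeight cutoffExp
        fun_prop
      exact this.tendsto 0
    have h2 : cutoffWeight F ν p a c 0 t x =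
        Real.exp (-c * meanCurvature (F t) (ν t) x) ^ 3 := by
      rw [cutoffWeight, cutoffExp, zero_mul, sub_zero, max_eq_left (Real.exp_pos _).le]
    rw [← h2]
    exact h1.comp tendsto_one_div_add_atTop_nhds_zero_nat

variable [T2Space M] [SecondCountableTopology M]

/-- The area weighted by the truncated weight is nonincreasing: the boundary terms of a partition
of unity add up to zero, since the weight is supported where the partition is complete. -/
theorem antitoneOn_integral_cutoffWeight (hF : IsSmoothMCF I F ν) (hproper : IsProperFlow I F)
    (hconvex : IsMeanConvex I F ν) (hab : a < b) (hb : b < t₀) (hsub : Icc a b ⊆ I) (hc : 0 ≤ c)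
    (hδ : 0 < δ) :
    AntitoneOn (fun t => ∫ x, cutoffWeight F ν p a c δ t x * heatWeight F p t₀ t x
      ∂(areaMeasure (F t))) (Icc a b) := by
  set K : Set M := Prod.snd '' {q : ℝ × M | q.1 ∈ Icc a b ∧
    F q.1 q.2 ∈ Metric.closedBall p (√(1 / δ))} with hKdef
  have hK : IsCompact K :=
    (hproper a b hsub _ (isCompact_closedBall p _)).image continuous_snd
  have hwK : ∀ t ∈ Icc a b, ∀ x, cutoffWeight F ν p a c δ t x ≠ 0 → x ∈ K := by
    intro t ht x hx
    refine ⟨(t, x), ⟨ht, ?_⟩, rfl⟩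
    rw [mem_closedBall_iff_norm]
    exact Real.le_sqrt_of_sq_le
      (norm_sq_le_of_cutoffWeight_ne_zero hδ hc ht.1 (hconvex t (hsub ht) x) hx)
  obtain ⟨s, φ, hφ, hφK⟩ := exists_finset_isChartCutoff hK
  have hsum : ∀ t ∈ Icc a b, ∫ x, cutoffWeight F ν p a c δ t x * heatWeight F p t₀ t x
      ∂(areaMeasure (F t)) = ∑ i ∈ s, ∫ x, φ i x *
        (cutoffWeight F ν p a c δ t x * heatWeight F p t₀ t x) ∂(areaMeasure (F t)) := by
    intro t ht
    rw [← integral_finsetSum _ fun i _ => hF.integrable_cutoff_weight (hφ i) hab hb hsub ht]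
    congr 1
    ext x
    rw [← Finset.sum_mul]
    by_cases hx : cutoffWeight F ν p a c δ t x = 0
    · rw [hx, zero_mul, mul_zero]
    · rw [hφK x (hwK t ht x hx), one_mul]
  have hgreen : ∀ t ∈ Icc a b, ∀ x, ∑ i ∈ s, surfaceGreenTerm (F t) (φ i)
      (cutoffWeight F ν p a c δ t) (heatWeight F p t₀ t) x = 0 := by
    intro t ht x
    simp only [surfaceGreenTerm, Finset.sum_sub_distrib, ← Finset.mul_sum]
    -- Where the weight vanishes, it attains its minimum; elsewhere, the cutoffs add up to `1`.
    by_cases hx : cutoffWeight F ν p a c δ t x = 0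
    · have h0 : ∀ i, surfaceGradInner (F t) (φ i) (cutoffWeight F ν p a c δ t) x = 0 := fun i =>
        surfaceGradInner_eq_zero_of_isMin fun y => by
          rw [hx]
          exact cutoffWeight_nonneg t y
      simp [h0, hx]
    · have hd : ∀ i ∈ s, DifferentiableAt ℝ (fun v => φ i (chartInv x v))
          (extChartAt (𝓡 2) x x) := fun i _ => by
        have hs : ContDiffOn ℝ ∞ (fun u => φ i (chartInv x u)) (chartDom x) := by
          rw [← contMDiffOn_iff_contDiffOn]
          exact (hφ i).smooth.comp_contMDiffOn (contMDiffOn_extChartAt_symm x)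
        exact hs.diffAt (isOpen_chartDom x) (by simp) (mem_extChartAt_target x)
      have hev : ∀ᶠ y in 𝓝 x, ∑ i ∈ s, φ i y = 1 := by
        filter_upwards [(hF.continuous_cutoffWeight (hsub ht)).continuousAt.eventually_ne hx]
          with y hy
        exact hφK y (hwK t ht y hy)
      rw [sum_surfaceGradInner s φ hd, sum_surfaceGradInner s φ hd,
        surfaceGradInner_eq_zero_of_eventually_eq hev,
        surfaceGradInner_eq_zero_of_eventually_eq hev]
      ring
  refine AntitoneOn.congr (f₁ := fun t => ∑ i ∈ s, ∫ x, φ i x *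
    (cutoffWeight F ν p a c δ t x * heatWeight F p t₀ t x) ∂(areaMeasure (F t))) ?_
    fun t ht => (hsum t ht).symm
  have hderiv : ∀ t ∈ Ioo a b, ∃ d ≤ 0, HasDerivAt (fun t => ∑ i ∈ s, ∫ x, φ i x *
      (cutoffWeight F ν p a c δ t x * heatWeight F p t₀ t x) ∂(areaMeasure (F t))) d t := by
    intro t ht
    have h := fun i => hF.hasDerivAt_integral_cutoff_weight (p := p) (δ := δ) hconvex (hφ i) hb hsub
      hc ht
    choose d hd hint hle using h
    refine ⟨∑ i ∈ s, d i, (Finset.sum_le_sum fun i _ => hle i).trans ?_,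
      HasDerivAt.fun_sum fun i _ => hd i⟩
    rw [Finset.sum_neg_distrib, ← integral_finsetSum _ fun i _ => hint i]
    simp only [hgreen t (Ioo_subset_Icc_self ht), integral_zero, neg_zero, le_refl]
  refine antitoneOn_of_deriv_nonpos (convex_Icc a b) (continuousOn_finsetSum _ fun i _ =>
    hF.continuousOn_integral_cutoff_weight (hφ i) hab hb hsub) ?_ ?_
  · rw [interior_Icc]
    intro t ht
    obtain ⟨d, -, hd⟩ := hderiv t ht
    exact hd.differentiableAt.differentiableWithinAt
  · rw [interior_Icc]
    intro t ht
    obtain ⟨d, hd0, hd⟩ := hderiv t ht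
    rw [hd.deriv]
    exact hd0

end IsSmoothMCF

end Monotonicity

end

theorem proposition3p1 {M : Type*} [TopologicalSpace M] [T2Space M] [SecondCountableTopology M]
    [ChartedSpace Plane M] [IsManifold (𝓡 2) ∞ M] [MeasurableSpace M] [BorelSpace M]
    (I : Set ℝ) (hI : I.OrdConnected) (F ν : ℝ → M → Space)
    (hF : IsSmoothMCF I F ν) (hproper : IsProperFlow I F) (hconvex : IsMeanConvex I F ν)
    (p : Space) (t₀ : ℝ)
    (hfinite : ∀ t ∈ I, t < t₀ →
      Integrable (fun x => Real.exp (-(‖F t x - p‖ ^ 2 / (4 * (t₀ - t))))) (areaMeasure (F t)))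
    (r₀ : ℝ) (hr₀ : 0 < r₀) :
    (∀ t ∈ I, t < t₀ →
      Integrable (fun x => 1 / (4 * Real.pi * (t₀ - t)) *
        Real.exp (-(‖F t x - p‖ ^ 2 / (4 * (t₀ - t))) - r₀ * meanCurvature (F t) (ν t) x))
        (areaMeasure (F t))) ∧
    AntitoneOn (fun t => ∫ x, 1 / (4 * Real.pi * (t₀ - t)) *
        Real.exp (-(‖F t x - p‖ ^ 2 / (4 * (t₀ - t))) - r₀ * meanCurvature (F t) (ν t) x)
        ∂(areaMeasure (F t)))
      (I ∩ Iio t₀) := by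
  -- The truncated weight is a cube.
  have hc : 0 ≤ r₀ / 3 := by positivity
  have hweight : ∀ t x, 1 / (4 * Real.pi * (t₀ - t)) *
      Real.exp (-(‖F t x - p‖ ^ 2 / (4 * (t₀ - t))) - r₀ * meanCurvature (F t) (ν t) x) =
      (4 * Real.pi)⁻¹ * (Real.exp (-(r₀ / 3) * meanCurvature (F t) (ν t) x) ^ 3 *
        heatWeight F p t₀ t x) := by
    intro t x
    rw [heatWeight, ← Real.exp_nat_mul, sub_eq_add_neg (-(_ / _)), Real.exp_add, one_div,
      mul_inv, one_div]
    rw [show ((3 : ℕ) : ℝ) * (-(r₀ / 3) * meanCurvature (F t) (ν t) x) =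
      -(r₀ * meanCurvature (F t) (ν t) x) by push_cast; ring]
    ring
  have hheat : ∀ t ∈ I, t < t₀ → Integrable (heatWeight F p t₀ t) (areaMeasure (F t)) :=
    fun t ht htt => (hfinite t ht htt).const_mul _
  simp only [hweight]
  constructor
  · intro t ht htt
    refine Integrable.const_mul ((hheat t ht htt).mono' ?_ (Filter.Eventually.of_forall fun x =>
      ?_)) _
    · have hH := hF.continuous_meanCurvature ht
      have hρ := hF.continuous_heatWeight (p := p) (t₀ := t₀) ht
      exact (by fun_prop : Continuous _).aestronglyMeasurable
    · have h0 := heatWeight_nonneg (F := F) (p := p) htt x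
      rw [Real.norm_of_nonneg (by positivity)]
      refine mul_le_of_le_one_left h0 (pow_le_one₀ (Real.exp_pos _).le (Real.exp_le_one_iff.2 ?_))
      nlinarith [mul_nonneg hc (hconvex t ht x)]
  · rintro a ⟨haI, hat⟩ b ⟨hbI, hbt⟩ hle
    rcases hle.eq_or_lt with rfl | hab
    · exact le_refl _
    have hsub : Icc a b ⊆ I := hI.out haI hbI
    simp only [integral_const_mul]
    refine mul_le_mul_of_nonneg_left ?_ (by positivity)
    refine le_of_tendsto_of_tendsto'
      (hF.tendsto_integral_cutoffWeight hconvex hc hbI hab.le hbt (hheat b hbI hbt))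
      (hF.tendsto_integral_cutoffWeight hconvex hc haI le_rfl hat (hheat a haI hat)) fun n => ?_
    exact hF.antitoneOn_integral_cutoffWeight hproper hconvex hab hbt hsub hc (by positivity)
      (left_mem_Icc.2 hab.le) (right_mem_Icc.2 hab.le) hab.le
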